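/- Let $G$ be the simply-connected complex algebraic group of type $E_7$ with Dynkin nodes $1,\dots,7$ in Bourbaki's labelling, Chevalley generators $e_i,f_i,h_i$, one-parameter subgroups $x_i(a)=\exp(ae_i)$, $y_i(a)=\exp(af_i)$, transposition anti-automorphism $g\mapsto g^T$ exchanging $x_i(a)$ and $y_i(a)$, and Weyl group $W$ with simple reflections $s_i$. Put $\bar s_i=x_i(-1)y_i(1)x_i(-1)$ and let $\bar w$ be the product of the $\bar s_i$ along a reduced word of $w\in W$. For a fundamental weight $\omega_i$ let $V(\omega_i)$ be the irreducible representation of highest weight $\omega_i$, $v^+$ a highest weight vector, and $\langle v,v^+\rangle$ the coefficient of $v^+$ in $v$ (projecting along the other weight spaces). Put $$\Delta_{w_1\omega_i,w_2\omega_i}(g)=\langle \bar w_1^{-1}g\bar w_2 v^+,v^+\rangle,\qquad \Delta^T_{w_1\omega_i,w_2\omega_i}(g)=\Delta_{w_2w_0\omega_i,\,w_1w_0\omega_i}(g^T).$$ Fix the reduced expression $w_0=s_{r_{63}}\cdots s_{r_1}$ of the longest element whose labels are, from left to right ($r_{63},\dots,r_1$), $$1,2,3,1,4,2,3,1,4,3,5,4,2,3,1,4,3,5,4,2,6,5,4,2,3,1,4,3,5,4,2,6,5,4,3,1,$$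 $$7,6,5,4,3,2,4,5,6,1,3,4,7,5,2,4,3,1,6,5,4,2,3,4,5,6,7.$$ Put $u_{\ge k}=s_{r_{63}}\cdots s_{r_k}$ (and $u_{\ge k}=e$ for $k>63$), $\varphi(k,\omega_i)=\Delta^T_{u_{\ge k}\omega_i,w_0\omega_i}$, and $$U_-^\circ=\{y_{r_{27}}(a_{27})\cdots y_{r_1}(a_1)\mid a_k\in\mathbb C^*\}.$$ An index $k\in\{1,\dots,27\}$ is exchangeable if $\varphi(k,\omega_{r_k})$ is not identically $1$ on $U_-^\circ$. The mutable variables of the Geiss–Leclerc–Schröer (GLS) initial seed are the $\varphi(k,\omega_{r_k})$ with $1\le k\le 27$ exchangeable; the frozen variables are the $\varphi(t_i,\omega_i)$, $1\le i\le 7$, together with $\Delta^T_{\omega_7,\omega_7}$, where $t_i=\min\{t>27\mid r_t=i\}$ for $i\ne7$ and $t_7=63+7=70$. Plücker coordinates: the $56$-dimensional minuscule representation $V(\omega_7)$ has a weight basis $v_a$ in which $f_iv_a=v_b$ and $e_iv_b=v_a$ for the edges $v_a\to v_b$ labelled $i$ in the following list, and all other $f_iv_a$, $e_iv_b$ are zero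 ($h_i=[e_i,f_i]$; $v_{27}$ has highest and $v_0$ lowest weight): - $i=1$: $v_{22}''\to v_{21}''$, $v_{21}'\to v_{20}''$, $v_{20}'\to v_{19}''$, $v_{19}'\to v_{18}'$, $v_{18}\to v_{17}'$, $v_{17}\to v_{16}$, $v_{11}\to v_{10}$, $v_{10}'\to v_{9}$, $v_{9}'\to v_{8}'$, $v_{8}''\to v_{7}'$, $v_{7}''\to v_{6}'$, $v_{6}''\to v_{5}''$; - $i=2$: $v_{23}\to v_{22}'$, $v_{22}''\to v_{21}'$, $v_{21}''\to v_{20}''$, $v_{16}''\to v_{15}''$, $v_{15}'\to v_{14}''$, $v_{14}\to v_{13}'$, $v_{14}'\to v_{13}$, $v_{13}''\to v_{12}'$, $v_{12}''\to v_{11}''$, $v_{7}''\to v_{6}''$, $v_{6}'\to v_{5}''$, $v_{5}'\to v_{4}$; - $i=3$: $v_{23}\to v_{22}''$, $v_{22}'\to v_{21}'$, $v_{19}''\to v_{18}''$, $v_{18}'\to v_{17}''$, $v_{17}'\to v_{16}'$, $v_{16}\to v_{15}$, $v_{12}\to v_{11}$, $v_{11}'\to v_{10}'$, $v_{10}''\to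 v_{9}'$, $v_{9}''\to v_{8}''$, $v_{6}'\to v_{5}'$, $v_{5}''\to v_{4}$; - $i=4$: $v_{24}\to v_{23}$, $v_{21}'\to v_{20}'$, $v_{20}''\to v_{19}''$, $v_{17}''\to v_{16}''$, $v_{16}'\to v_{15}'$, $v_{15}\to v_{14}$, $v_{13}\to v_{12}$, $v_{12}'\to v_{11}'$, $v_{11}''\to v_{10}''$, $v_{8}''\to v_{7}''$, $v_{7}'\to v_{6}'$, $v_{4}\to v_{3}$; - $i=5$: $v_{25}\to v_{24}$, $v_{20}'\to v_{19}'$, $v_{19}''\to v_{18}'$, $v_{18}''\to v_{17}''$, $v_{15}'\to v_{14}'$, $v_{14}\to v_{13}''$, $v_{14}''\to v_{13}$, $v_{13}'\to v_{12}'$, $v_{10}''\to v_{9}''$, $v_{9}'\to v_{8}''$, $v_{8}'\to v_{7}'$, $v_{3}\to v_{2}$; - $i=6$: $v_{26}\to v_{25}$, $v_{19}'\to v_{18}$, $v_{18}'\to v_{17}'$, $v_{17}''\to v_{16}'$, $v_{16}''\to v_{15}'$, $v_{15}''\to v_{14}''$, $v_{13}''\to v_{12}''$, $v_{12}'\to v_{11}''$,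 $v_{11}'\to v_{10}''$, $v_{10}'\to v_{9}'$, $v_{9}\to v_{8}'$, $v_{2}\to v_{1}$; - $i=7$: $v_{27}\to v_{26}$, $v_{18}\to v_{17}$, $v_{17}'\to v_{16}$, $v_{16}'\to v_{15}$, $v_{15}'\to v_{14}$, $v_{14}'\to v_{13}''$, $v_{14}''\to v_{13}'$, $v_{13}\to v_{12}'$, $v_{12}\to v_{11}'$, $v_{11}\to v_{10}'$, $v_{10}\to v_{9}$, $v_{1}\to v_{0}$. For a label $a$ let $p_a(g)=v_0^*(g\,v_a)$, with $v_0^*$ the coordinate of $v_0$. Define the following polynomials in the $p_a$: - $q_{18}=p_{1}p_{17}-p_{0}p_{18}$ - $q_{36}=p_{10}p_{26}-p_{9}p_{27}$ - $q_{27}=p_{0}p_{27}-p_{1}p_{26}+p_{2}p_{25}-p_{3}p_{24}+p_{4}p_{23}-p_{5}''p_{22}''+p_{6}''p_{21}''$ - $q_{45}=(p_{9}p_{11}-p_{10}p_{10}')p_{25}-(p_{8}'p_{11}-p_{9}'p_{10})p_{26}+(p_{8}'p_{10}'-p_{9}p_{9}')p_{27}$ - $q_{36}'=(p_{0}p_{14}'-p_{1}p_{13}''+p_{2}p_{12}'')p_{22}'+(-p_{0}p_{13}+p_{1}p_{12}'-p_{2}p_{11}'')p_{23}+(p_{0}p_{12}-p_{1}p_{11}'+p_{2}p_{10}'')p_{24}-p_{2}p_{9}''p_{25}+p_{1}p_{9}''p_{26}-p_{0}p_{9}''p_{27}$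 - $q_{27}'=-p_{0}p_{27}+p_{1}p_{26}-p_{2}p_{25}+p_{3}p_{24}$ - $q_{27}''=-p_{6}''p_{21}''-p_{7}'p_{20}'+p_{7}''p_{20}''+p_{8}'p_{19}'-p_{9}p_{18}+p_{10}p_{17}$ - $q_{54}=(p_{5}''p_{7}''-p_{6}'p_{6}'')(p_{20}''p_{22}''-p_{21}'p_{21}'')-(p_{4}p_{7}''-p_{5}'p_{6}'')(p_{20}''p_{23}-p_{21}''p_{22}')+(p_{4}p_{6}'-p_{5}'p_{5}'')(p_{21}'p_{23}-p_{22}'p_{22}'')+q_{27}'q_{27}''$ - $q_{10}=p_{1}p_{9}-p_{10}$ - $q_{10}'=p_{2}p_{8}'-p_{1}p_{9}+p_{10}$ - $q_{10}''=p_{3}p_{7}'-p_{2}p_{8}'+p_{1}p_{9}-p_{10}$ - $q_{12}=p_{5}''p_{7}''-p_{6}'p_{6}''$ - $q_{14}=p_{2}p_{12}''-p_{1}p_{13}''+p_{14}'$ - $q_{19}'=p_{9}'(p_{10}-p_{1}p_{9})-p_{8}'(p_{11}-p_{1}p_{10}')$ - $q_{20}=p_{5}'p_{15}''-p_{4}p_{16}''+p_{3}p_{17}''-p_{2}p_{18}''$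 - $q_{23}=p_{5}''(p_{18}-p_{1}p_{17})-p_{6}''(p_{17}'-p_{1}p_{16})$ - $q_{18}'=p_{2}(p_{5}'p_{11}''-p_{4}p_{12}'')+p_{1}(p_{4}p_{13}''-p_{5}'p_{12}')+p_{5}'p_{13}-p_{4}p_{14}'$ - $q_{28}'=(p_{1}p_{15}-p_{16}')(p_{5}''p_{7}''-p_{6}'p_{6}'')-(p_{1}p_{16}-p_{17}')(p_{4}p_{7}''-p_{5}'p_{6}'')+(p_{1}p_{17}-p_{18})(p_{4}p_{6}'-p_{5}'p_{5}'')$ - $q_{30}=p_{18}''(p_{3}p_{9}''-p_{2}p_{10}''+p_{1}p_{11}'-p_{12})-p_{19}''(p_{3}p_{8}''-p_{2}p_{9}'+p_{1}p_{10}'-p_{11})-p_{20}'(-p_{3}p_{7}'+p_{2}p_{8}'-p_{1}p_{9}+p_{10})+p_{3}q_{27}''$ - $q_{40}=(p_{2}p_{12}''-p_{1}p_{13}''+p_{14}')(p_{6}''p_{20}''-p_{5}''p_{21}'+p_{4}p_{22}')+(p_{2}p_{11}''-p_{1}p_{12}'+p_{13})(-p_{5}'p_{22}'+p_{6}'p_{21}'-p_{7}''p_{20}''+q_{27}'')$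 **Lemma.** The mutable variables of the initial seed are the $20$ functions $\varphi(k,\omega_{r_k})$ in the list below; $t_1=28$, $t_2=33$, $t_3=29$, $t_4=30$, $t_5=31$, $t_6=32$, $t_7=70$; and the following identities hold on $U_-^\circ$. Mutable variables: $$\begin{array}{llll} \varphi(7,\omega_4)=p_4,&\varphi(8,\omega_5)=p_3,&\varphi(9,\omega_6)=p_2,&\varphi(11,\omega_3)=p_5'',\\ \varphi(12,\omega_4)=q_{10}'',&\varphi(13,\omega_2)=p_5',&\varphi(14,\omega_5)=q_{10}',&\varphi(15,\omega_7)=p_1,\\ \varphi(16,\omega_4)=q_{18}',&\varphi(17,\omega_3)=q_{12},&\varphi(18,\omega_1)=p_6'',&\varphi(19,\omega_6)=q_{10},\\ \varphi(20,\omega_5)=q_{19}',&\varphi(21,\omega_4)=q_{28}',&\varphi(22,\omega_2)=q_{14},&\varphi(23,\omega_3)=q_{23},\\ \varphi(24,\omega_4)=q_{40},&\varphi(25,\omega_5)=q_{30},&\varphi(26,\omega_6)=q_{20},&\varphi(27,\omega_7)=p_{10}. \end{array}$$ Frozen variables: $$\begin{array}{llll} \varphi(t_1,\omega_1)=q_{18},&\varphi(t_3,\omega_3)=q_{36}',&\varphi(t_4,\omega_4)=q_{54},&\varphi(t_5,\omega_5)=q_{45},\\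 \varphi(t_6,\omega_6)=q_{36},&\varphi(t_2,\omega_2)=q_{27},&\varphi(t_7,\omega_7)=p_{27},&\Delta^T_{\omega_7,\omega_7}=p_0. \end{array}$$ -/

import Mathlib

noncomputable section
namespace Freudenthal

/-- The complex simple Lie algebra of type `E₇` (Serre presentation, Bourbaki labelling; the node
labelled `n` in the Dynkin diagram is `n - 1 : Fin 7`). -/
abbrev Alg : Type := LieAlgebra.e₇ ℂ

/-- The quotient map from the free Lie algebra. -/
def toAlg (X : FreeLieAlgebra ℂ (CartanMatrix.Generators (Fin 7))) : Alg :=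
  LieSubmodule.Quotient.mk' (CartanMatrix.Relations.toIdeal ℂ CartanMatrix.E₇) X

/-- Chevalley generators. -/
def chevE (i : Fin 7) : Alg := toAlg (FreeLieAlgebra.of ℂ (.E i))
def chevF (i : Fin 7) : Alg := toAlg (FreeLieAlgebra.of ℂ (.F i))
def chevH (i : Fin 7) : Alg := toAlg (FreeLieAlgebra.of ℂ (.H i))

theorem toAlg_lie (X Y : FreeLieAlgebra ℂ (CartanMatrix.Generators (Fin 7))) :
    toAlg ⁅X, Y⁆ = ⁅toAlg X, toAlg Y⁆ := rfl

theorem toAlg_sub (X Y : FreeLieAlgebra ℂ (CartanMatrix.Generators (Fin 7))) :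
    toAlg (X - Y) = toAlg X - toAlg Y := rfl

theorem toAlg_add (X Y : FreeLieAlgebra ℂ (CartanMatrix.Generators (Fin 7))) :
    toAlg (X + Y) = toAlg X + toAlg Y := rfl

theorem toAlg_zsmul (n : ℤ) (X : FreeLieAlgebra ℂ (CartanMatrix.Generators (Fin 7))) :
    toAlg (n • X) = n • toAlg X :=
  map_zsmul (LieSubmodule.Quotient.mk' (CartanMatrix.Relations.toIdeal ℂ CartanMatrix.E₇)) n X

theorem toAlg_eq_zero {X : FreeLieAlgebra ℂ (CartanMatrix.Generators (Fin 7))}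
    (h : X ∈ CartanMatrix.Relations.toSet ℂ CartanMatrix.E₇) : toAlg X = 0 :=
  (LieSubmodule.Quotient.mk_eq_zero _).2 (LieSubmodule.subset_lieSpan h)

theorem toAlg_ad_pow (X : FreeLieAlgebra ℂ (CartanMatrix.Generators (Fin 7))) (n : ℕ)
    (Y : FreeLieAlgebra ℂ (CartanMatrix.Generators (Fin 7))) :
    toAlg ((LieAlgebra.ad ℂ _ X ^ n) Y) = (LieAlgebra.ad ℂ _ (toAlg X) ^ n) (toAlg Y) := by
  induction n with
  | zero => rfl
  | succ n ih =>
    rw [pow_succ', pow_succ', Module.End.mul_apply, Module.End.mul_apply, ← ih]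
    rfl

theorem lie_chevH_chevH (i j : Fin 7) : ⁅chevH i, chevH j⁆ = 0 :=
  toAlg_eq_zero (X := CartanMatrix.Relations.HH ℂ (i, j))
    (by simp only [CartanMatrix.Relations.toSet, Set.mem_union]
        exact Or.inl (Or.inl (Or.inl (Or.inl (Or.inl ⟨(i, j), rfl⟩)))))

theorem lie_chevE_chevF (i j : Fin 7) :
    ⁅chevE i, chevF j⁆ = if i = j then chevH i else 0 := by
  have h := toAlg_eq_zero (X := CartanMatrix.Relations.EF ℂ (i, j))
    (by simp only [CartanMatrix.Relations.toSet, Set.mem_union]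
        exact Or.inl (Or.inl (Or.inl (Or.inl (Or.inr ⟨(i, j), rfl⟩)))))
  by_cases hij : i = j
  · subst hij
    simp only [CartanMatrix.Relations.EF, Function.uncurry, if_true, toAlg_sub] at h
    rw [if_pos rfl]
    exact sub_eq_zero.1 h
  · simp only [CartanMatrix.Relations.EF, Function.uncurry, hij, if_false] at h
    rw [if_neg hij]
    exact h

theorem lie_chevH_chevE (i j : Fin 7) :
    ⁅chevH i, chevE j⁆ = CartanMatrix.E₇ i j • chevE j := by
  have h := toAlg_eq_zero (X := CartanMatrix.Relations.HE ℂ CartanMatrix.E₇ (i, j))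
    (by simp only [CartanMatrix.Relations.toSet, Set.mem_union]
        exact Or.inl (Or.inl (Or.inl (Or.inr ⟨(i, j), rfl⟩))))
  simp only [CartanMatrix.Relations.HE, Function.uncurry, toAlg_sub, toAlg_zsmul] at h
  exact sub_eq_zero.1 h

theorem lie_chevH_chevF (i j : Fin 7) :
    ⁅chevH i, chevF j⁆ = -(CartanMatrix.E₇ i j • chevF j) := by
  have h := toAlg_eq_zero (X := CartanMatrix.Relations.HF ℂ CartanMatrix.E₇ (i, j))
    (by simp only [CartanMatrix.Relations.toSet, Set.mem_union]
        exact Or.inl (Or.inl (Or.inr ⟨(i, j), rfl⟩)))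
  simp only [CartanMatrix.Relations.HF, Function.uncurry, toAlg_add, toAlg_zsmul] at h
  exact eq_neg_of_add_eq_zero_left h

theorem ad_chevE_pow (i j : Fin 7) :
    (LieAlgebra.ad ℂ Alg (chevE i) ^ (-CartanMatrix.E₇ i j).toNat) ⁅chevE i, chevE j⁆ = 0 := by
  have h := toAlg_eq_zero (X := CartanMatrix.Relations.adE ℂ CartanMatrix.E₇ (i, j))
    (by simp only [CartanMatrix.Relations.toSet, Set.mem_union]
        exact Or.inl (Or.inr ⟨(i, j), rfl⟩))
  simp only [CartanMatrix.Relations.adE, Function.uncurry] at h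
  exact (toAlg_ad_pow _ _ _).symm.trans h

theorem ad_chevF_pow (i j : Fin 7) :
    (LieAlgebra.ad ℂ Alg (chevF i) ^ (-CartanMatrix.E₇ i j).toNat) ⁅chevF i, chevF j⁆ = 0 := by
  have h := toAlg_eq_zero (X := CartanMatrix.Relations.adF ℂ CartanMatrix.E₇ (i, j))
    (by simp only [CartanMatrix.Relations.toSet, Set.mem_union]
        exact Or.inr ⟨(i, j), rfl⟩)
  simp only [CartanMatrix.Relations.adF, Function.uncurry] at h
  exact (toAlg_ad_pow _ _ _).symm.trans h

/-- Elements of a Lie algebra `L` satisfying the Serre relations of type `E₇`. -/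
structure SerreRel {L : Type*} [LieRing L] [LieAlgebra ℂ L] (h e f : Fin 7 → L) : Prop where
  hh : ∀ i j, ⁅h i, h j⁆ = 0
  ef : ∀ i j, ⁅e i, f j⁆ = if i = j then h i else 0
  he : ∀ i j, ⁅h i, e j⁆ = CartanMatrix.E₇ i j • e j
  hf : ∀ i j, ⁅h i, f j⁆ = -(CartanMatrix.E₇ i j • f j)
  ade : ∀ i j, (LieAlgebra.ad ℂ L (e i) ^ (-CartanMatrix.E₇ i j).toNat) ⁅e i, e j⁆ = 0
  adf : ∀ i j, (LieAlgebra.ad ℂ L (f i) ^ (-CartanMatrix.E₇ i j).toNat) ⁅f i, f j⁆ = 0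

section lift
variable {L : Type*} [LieRing L] [LieAlgebra ℂ L] {h e f : Fin 7 → L}

/-- The map out of the free Lie algebra determined by the images of the generators. -/
def freeLift (h e f : Fin 7 → L) : FreeLieAlgebra ℂ (CartanMatrix.Generators (Fin 7)) →ₗ⁅ℂ⁆ L :=
  FreeLieAlgebra.lift ℂ fun
    | .H i => h i
    | .E i => e i
    | .F i => f i

theorem map_ad_pow {L' : Type*} [LieRing L'] [LieAlgebra ℂ L'] (φ : L' →ₗ⁅ℂ⁆ L) (X : L') (n : ℕ)
    (Y : L') :
    φ ((LieAlgebra.ad ℂ _ X ^ n) Y) = (LieAlgebra.ad ℂ _ (φ X) ^ n) (φ Y) := by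
  induction n with
  | zero => rfl
  | succ n ih =>
    rw [pow_succ', pow_succ', Module.End.mul_apply, Module.End.mul_apply, ← ih,
      LieAlgebra.ad_apply, LieAlgebra.ad_apply, LieHom.map_lie]

theorem toIdeal_le_ker (S : SerreRel h e f) :
    CartanMatrix.Relations.toIdeal ℂ CartanMatrix.E₇ ≤ (freeLift h e f).ker := by
  refine LieSubmodule.lieSpan_le.2 ?_
  rintro X (((((⟨⟨i, j⟩, rfl⟩ | ⟨⟨i, j⟩, rfl⟩) | ⟨⟨i, j⟩, rfl⟩) | ⟨⟨i, j⟩, rfl⟩) | ⟨⟨i, j⟩, rfl⟩) |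
    ⟨⟨i, j⟩, rfl⟩)
  · simpa [CartanMatrix.Relations.HH, freeLift] using S.hh i j
  · have := S.ef i j
    by_cases hij : i = j
    · subst hij
      simpa [CartanMatrix.Relations.EF, freeLift, sub_eq_zero] using this
    · simpa [CartanMatrix.Relations.EF, freeLift, hij] using this
  · simpa [CartanMatrix.Relations.HE, freeLift, sub_eq_zero] using S.he i j
  · simpa [CartanMatrix.Relations.HF, freeLift, add_eq_zero_iff_eq_neg] using S.hf i j
  · have := S.ade i j
    simp only [CartanMatrix.Relations.adE, Function.uncurry, SetLike.mem_coe, LieHom.mem_ker,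
      map_ad_pow]
    simpa [freeLift] using this
  · have := S.adf i j
    simp only [CartanMatrix.Relations.adF, Function.uncurry, SetLike.mem_coe, LieHom.mem_ker,
      map_ad_pow]
    simpa [freeLift] using this

/-- The homomorphism from the Lie algebra of type `E₇` determined by elements satisfying the
Serre relations. -/
def liftAlg (S : SerreRel h e f) : Alg →ₗ⁅ℂ⁆ L where
  toLinearMap := Submodule.liftQ
    (CartanMatrix.Relations.toIdeal ℂ CartanMatrix.E₇).toSubmodule
    (freeLift h e f : FreeLieAlgebra ℂ (CartanMatrix.Generators (Fin 7)) →ₗ[ℂ] L)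
    (fun _ hX => toIdeal_le_ker S hX)
  map_lie' := by
    intro X Y
    obtain ⟨X, rfl⟩ := LieSubmodule.Quotient.surjective_mk'
      (CartanMatrix.Relations.toIdeal ℂ CartanMatrix.E₇) X
    obtain ⟨Y, rfl⟩ := LieSubmodule.Quotient.surjective_mk'
      (CartanMatrix.Relations.toIdeal ℂ CartanMatrix.E₇) Y
    exact (freeLift h e f).map_lie X Y

theorem liftAlg_chevE (S : SerreRel h e f) (i : Fin 7) : liftAlg S (chevE i) = e i :=
  FreeLieAlgebra.lift_of_apply ..
theorem liftAlg_chevF (S : SerreRel h e f) (i : Fin 7) : liftAlg S (chevF i) = f i :=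
  FreeLieAlgebra.lift_of_apply ..
theorem liftAlg_chevH (S : SerreRel h e f) (i : Fin 7) : liftAlg S (chevH i) = h i :=
  FreeLieAlgebra.lift_of_apply ..

end lift

theorem ad_neg_pow_eq_zero {L : Type*} [LieRing L] [LieAlgebra ℂ L] (X Y : L) (n : ℕ)
    (h : (LieAlgebra.ad ℂ L X ^ n) Y = 0) : (LieAlgebra.ad ℂ L (-X) ^ n) Y = 0 := by
  rw [map_neg, neg_pow]
  rcases neg_one_pow_eq_or (Module.End ℂ L) n with h1 | h1 <;> simp [h1, h]

/-- The Chevalley involution `e_i ↦ -f_i`, `f_i ↦ -e_i`, `h_i ↦ -h_i`. -/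
def chevInv : Alg →ₗ⁅ℂ⁆ Alg :=
  liftAlg (h := fun i => -chevH i) (e := fun i => -chevF i) (f := fun i => -chevE i)
    { hh := fun i j => by simp [lie_chevH_chevH]
      ef := fun i j => by
        rw [neg_lie, lie_neg, neg_neg, ← lie_skew, lie_chevE_chevF]
        by_cases hij : i = j <;> simp [hij, eq_comm]
      he := fun i j => by rw [neg_lie, lie_neg, neg_neg, lie_chevH_chevF, smul_neg]
      hf := fun i j => by rw [neg_lie, lie_neg, neg_neg, lie_chevH_chevE, smul_neg, neg_neg]
      ade := fun i j => by
        rw [neg_lie, lie_neg, neg_neg]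
        exact ad_neg_pow_eq_zero _ _ _ (ad_chevF_pow i j)
      adf := fun i j => by
        rw [neg_lie, lie_neg, neg_neg]
        exact ad_neg_pow_eq_zero _ _ _ (ad_chevE_pow i j) }

theorem isNilpotent_of_commutator {M : Type*} [AddCommGroup M] [Module ℂ M] [FiniteDimensional ℂ M]
    (A X : Module.End ℂ M) (c : ℂ) (hc : c ≠ 0) (h : A * X - X * A = c • X) : IsNilpotent X := by
  by_contra hX
  have hpow : ∀ n : ℕ, A * X ^ n - X ^ n * A = ((n : ℂ) * c) • X ^ n := by
    intro n
    induction n with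
    | zero => simp
    | succ n ih =>
      have h1 : A * X ^ (n + 1) - X ^ (n + 1) * A
          = (A * X ^ n - X ^ n * A) * X + X ^ n * (A * X - X * A) := by
        rw [pow_succ]; noncomm_ring
      rw [h1, ih, h, smul_mul_assoc, mul_smul_comm, ← pow_succ, ← add_smul]
      push_cast; ring_nf
  let D : Module.End ℂ (Module.End ℂ M) := LinearMap.mulLeft ℂ A - LinearMap.mulRight ℂ A
  have hD : ∀ n : ℕ, D.HasEigenvalue ((n : ℂ) * c) := fun n =>
    Module.End.hasEigenvalue_of_hasEigenvector (x := X ^ n)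
      ⟨Module.End.mem_eigenspace_iff.2 (by simpa [D] using hpow n), fun h0 => hX ⟨n, h0⟩⟩
  have hinj : Function.Injective fun n : ℕ => (n : ℂ) * c := fun m n hmn => by
    simpa [hc] using hmn
  exact (Set.infinite_range_of_injective hinj)
    ((Module.End.finite_hasEigenvalue (f := D)).subset (Set.range_subset_iff.2 hD))

section Module
variable (M : Type*) [AddCommGroup M] [Module ℂ M] [LieRingModule Alg M] [LieModule ℂ Alg M]

theorem isNilpotent_chevE [FiniteDimensional ℂ M] (i : Fin 7) (a : ℂ) :
    IsNilpotent (a • LieModule.toEnd ℂ Alg M (chevE i)) := by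
  refine IsNilpotent.smul (isNilpotent_of_commutator (LieModule.toEnd ℂ Alg M (chevH i)) _ 2
    two_ne_zero ?_) a
  ext m
  have h := lie_lie (chevH i) (chevE i) m
  rw [lie_chevH_chevE, CartanMatrix.E₇_diag, two_smul, add_lie, ← two_smul ℂ] at h
  exact h.symm

theorem isNilpotent_chevF [FiniteDimensional ℂ M] (i : Fin 7) (a : ℂ) :
    IsNilpotent (a • LieModule.toEnd ℂ Alg M (chevF i)) := by
  refine IsNilpotent.smul (isNilpotent_of_commutator (LieModule.toEnd ℂ Alg M (chevH i)) _ (-2)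
    (by norm_num) ?_) a
  ext m
  have h := lie_lie (chevH i) (chevF i) m
  rw [lie_chevH_chevF, CartanMatrix.E₇_diag, two_smul, neg_lie, add_lie, ← two_smul ℂ,
    ← neg_smul] at h
  exact h.symm

end Module

/-- The exponential of a nilpotent endomorphism. -/
def nexp {M : Type*} [AddCommGroup M] [Module ℂ M] (X : Module.End ℂ M) : Module.End ℂ M :=
  ∑ k ∈ Finset.range (nilpotencyClass X), ((k.factorial : ℂ)⁻¹) • X ^ k

section nexp
variable {M : Type*} [AddCommGroup M] [Module ℂ M]

theorem nexp_eq_sum {X : Module.End ℂ M} {n : ℕ} (h : X ^ n = 0) :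
    nexp X = ∑ k ∈ Finset.range n, ((k.factorial : ℂ)⁻¹) • X ^ k := by
  refine Finset.sum_subset (Finset.range_subset_range.2 (csInf_le' h)) fun k _ hk => ?_
  rw [pow_eq_zero_of_le (by simpa using hk) (pow_nilpotencyClass ⟨n, h⟩), smul_zero]

theorem nexp_mul_nexp_neg {X : Module.End ℂ M} (h : IsNilpotent X) :
    nexp X * nexp (-X) = 1 := by
  let : Module ℚ (Module.End ℂ M) := Module.compHom _ (algebraMap ℚ ℂ)
  have key : ∀ Y : Module.End ℂ M, nexp Y = IsNilpotent.exp Y := fun Y =>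
    Finset.sum_congr rfl fun k _ => by
      change _ = (algebraMap ℚ ℂ ((k.factorial : ℚ)⁻¹)) • Y ^ k
      simp
  rw [key, key]
  exact IsNilpotent.exp_mul_exp_neg_self h

theorem nexp_neg_mul_nexp {X : Module.End ℂ M} (h : IsNilpotent X) :
    nexp (-X) * nexp X = 1 := by
  simpa using nexp_mul_nexp_neg h.neg

theorem dualMap_pow (X : Module.End ℂ M) (n : ℕ) :
    (LinearMap.dualMap X : Module.End ℂ (Module.Dual ℂ M)) ^ n = LinearMap.dualMap (X ^ n) := by
  induction n with
  | zero => rfl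
  | succ n ih => rw [pow_succ, ih, pow_succ']; rfl

theorem nexp_dualMap {X : Module.End ℂ M} (h : IsNilpotent X) :
    nexp (LinearMap.dualMap X : Module.End ℂ (Module.Dual ℂ M)) = LinearMap.dualMap (nexp X) := by
  obtain ⟨n, hn⟩ := h
  have hn' : (LinearMap.dualMap X : Module.End ℂ (Module.Dual ℂ M)) ^ n = 0 := by
    rw [dualMap_pow, hn]; ext; simp
  rw [nexp_eq_sum hn, nexp_eq_sum hn']
  ext φ m
  simp [dualMap_pow, LinearMap.sum_apply, map_sum]

end nexp

/-! ### The simply-connected group -/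

/-- Symbols `x_i(a)` and `y_i(a)` for the elements of the simple root subgroups. -/
inductive GroupGen
  | x (i : Fin 7) (a : ℂ)
  | y (i : Fin 7) (a : ℂ)

section action
variable (M : Type*) [AddCommGroup M] [Module ℂ M] [LieRingModule Alg M] [LieModule ℂ Alg M]
  [FiniteDimensional ℂ M]

/-- `x_i(a)` acts as `exp (a e_i)` and `y_i(a)` as `exp (a f_i)`. -/
def genAct : GroupGen → (Module.End ℂ M)ˣ
  | .x i a =>
    { val := nexp (a • LieModule.toEnd ℂ Alg M (chevE i))
      inv := nexp (-(a • LieModule.toEnd ℂ Alg M (chevE i)))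
      val_inv := nexp_mul_nexp_neg (isNilpotent_chevE M i a)
      inv_val := nexp_neg_mul_nexp (isNilpotent_chevE M i a) }
  | .y i a =>
    { val := nexp (a • LieModule.toEnd ℂ Alg M (chevF i))
      inv := nexp (-(a • LieModule.toEnd ℂ Alg M (chevF i)))
      val_inv := nexp_mul_nexp_neg (isNilpotent_chevF M i a)
      inv_val := nexp_neg_mul_nexp (isNilpotent_chevF M i a) }

/-- The action of a word in the `x_i(a)^{±1}`, `y_i(a)^{±1}` on a finite-dimensional module. -/
def wordAct : FreeGroup GroupGen →* (Module.End ℂ M)ˣ := FreeGroup.lift (genAct M)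

end action

/-- The words acting trivially on every finite-dimensional module of the Lie algebra. -/
def trivialWords : Subgroup (FreeGroup GroupGen) where
  carrier := {w | ∀ (M : Type) [AddCommGroup M] [Module ℂ M] [LieRingModule Alg M]
    [LieModule ℂ Alg M] [FiniteDimensional ℂ M], wordAct M w = 1}
  one_mem' := fun M => by intros; exact map_one _
  mul_mem' := fun {a b} ha hb M => by intros; rw [map_mul, ha M, hb M, one_mul]
  inv_mem' := fun {a} ha M => by intros; rw [map_inv, ha M, inv_one]

instance : trivialWords.Normal where
  conj_mem := fun a ha g M => by
    intros
    rw [map_mul, map_mul, ha M, mul_one, ← map_mul, mul_inv_cancel, map_one]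

/-- The simply-connected complex group of type `E₇`: the group generated by the one-parameter
subgroups `x_i(a)`, `y_i(a)`, where two words are equal when they act equally on every
finite-dimensional module of the Lie algebra. -/
def Grp : Type := FreeGroup GroupGen ⧸ trivialWords

instance : Group Grp := inferInstanceAs (Group (FreeGroup GroupGen ⧸ trivialWords))

/-- `x_i(a) = exp (a e_i)`. -/
def x (i : Fin 7) (a : ℂ) : Grp := QuotientGroup.mk' trivialWords (.of (.x i a))
/-- `y_i(a) = exp (a f_i)`. -/
def y (i : Fin 7) (a : ℂ) : Grp := QuotientGroup.mk' trivialWords (.of (.y i a))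

/-- The action of the group on a finite-dimensional module of the Lie algebra. -/
def act (M : Type) [AddCommGroup M] [Module ℂ M] [LieRingModule Alg M] [LieModule ℂ Alg M]
    [FiniteDimensional ℂ M] : Grp →* (Module.End ℂ M)ˣ :=
  QuotientGroup.lift trivialWords (wordAct M) fun _ hw => hw M

/-! ### Transposition -/

/-- The dual module, with `e_i`, `f_i` acting by the transposes of `f_i`, `e_i`. -/
def TwistedDual (M : Type) [AddCommGroup M] [Module ℂ M] : Type := Module.Dual ℂ M

section twisted
variable (M : Type) [AddCommGroup M] [Module ℂ M] [LieRingModule Alg M] [LieModule ℂ Alg M]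

instance : AddCommGroup (TwistedDual M) := inferInstanceAs (AddCommGroup (Module.Dual ℂ M))
instance : Module ℂ (TwistedDual M) := inferInstanceAs (Module ℂ (Module.Dual ℂ M))
instance [FiniteDimensional ℂ M] : FiniteDimensional ℂ (TwistedDual M) :=
  inferInstanceAs (FiniteDimensional ℂ (Module.Dual ℂ M))
instance : LieRingModule Alg (TwistedDual M) :=
  LieRingModule.compLieHom (M →ₗ[ℂ] ℂ) chevInv
instance : LieModule ℂ Alg (TwistedDual M) :=
  LieModule.compLieHom (M →ₗ[ℂ] ℂ) chevInv

theorem smul_toEnd_twisted_chevE (i : Fin 7) (a : ℂ) :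
    a • LieModule.toEnd ℂ Alg (TwistedDual M) (chevE i) =
      LinearMap.dualMap (a • LieModule.toEnd ℂ Alg M (chevF i)) := by
  refine LinearMap.ext fun (φ : Module.Dual ℂ M) => LinearMap.ext fun m => ?_
  change a • -(φ ⁅chevInv (chevE i), m⁆) = φ (a • ⁅chevF i, m⁆)
  rw [chevInv, liftAlg_chevE, neg_lie, map_neg, neg_neg, map_smul]

theorem smul_toEnd_twisted_chevF (i : Fin 7) (a : ℂ) :
    a • LieModule.toEnd ℂ Alg (TwistedDual M) (chevF i) =
      LinearMap.dualMap (a • LieModule.toEnd ℂ Alg M (chevE i)) := by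
  refine LinearMap.ext fun (φ : Module.Dual ℂ M) => LinearMap.ext fun m => ?_
  change a • -(φ ⁅chevInv (chevF i), m⁆) = φ (a • ⁅chevE i, m⁆)
  rw [chevInv, liftAlg_chevF, neg_lie, map_neg, neg_neg, map_smul]

end twisted

theorem nexp_twisted (M : Type) [AddCommGroup M] [Module ℂ M] {X : Module.End ℂ M}
    {Y : Module.End ℂ (TwistedDual M)} (h : IsNilpotent X)
    (hY : Y = LinearMap.dualMap X) : nexp Y = LinearMap.dualMap (nexp X) := by
  subst hY
  exact nexp_dualMap h

/-- Transposition of words: reverse the order and exchange `x_i(a)` with `y_i(a)`. -/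
def wordTranspose : FreeGroup GroupGen →* (FreeGroup GroupGen)ᵐᵒᵖ :=
  FreeGroup.lift fun
    | .x i a => .op (.of (.y i a))
    | .y i a => .op (.of (.x i a))

theorem wordAct_twisted (M : Type) [AddCommGroup M] [Module ℂ M] [LieRingModule Alg M]
    [LieModule ℂ Alg M] [FiniteDimensional ℂ M] (w : FreeGroup GroupGen) :
    (wordAct (TwistedDual M) w : Module.End ℂ (TwistedDual M)) =
      LinearMap.dualMap (wordAct M (wordTranspose w).unop : Module.End ℂ M) := by
  have hE : ∀ (i : Fin 7) (a : ℂ),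
      nexp (a • LieModule.toEnd ℂ Alg (TwistedDual M) (chevE i)) =
        LinearMap.dualMap (nexp (a • LieModule.toEnd ℂ Alg M (chevF i))) := fun i a =>
    nexp_twisted M (isNilpotent_chevF M i a) (smul_toEnd_twisted_chevE M i a)
  have hF : ∀ (i : Fin 7) (a : ℂ),
      nexp (a • LieModule.toEnd ℂ Alg (TwistedDual M) (chevF i)) =
        LinearMap.dualMap (nexp (a • LieModule.toEnd ℂ Alg M (chevE i))) := fun i a =>
    nexp_twisted M (isNilpotent_chevE M i a) (smul_toEnd_twisted_chevF M i a)
  induction w using FreeGroup.induction_on with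
  | C1 => rfl
  | of g =>
    cases g with
    | x i a => simpa [wordAct, wordTranspose, genAct] using hE i a
    | y i a => simpa [wordAct, wordTranspose, genAct] using hF i a
  | inv_of g _ =>
    cases g with
    | x i a => simpa [wordAct, wordTranspose, genAct] using hE i (-a)
    | y i a => simpa [wordAct, wordTranspose, genAct] using hF i (-a)
  | mul v w hv hw =>
    rw [map_mul, map_mul, Units.val_mul, hv, hw, MulOpposite.unop_mul, map_mul, Units.val_mul]
    rfl

/-- The transposition anti-automorphism as a homomorphism to the opposite group. -/
def transposeHom : Grp →* Grpᵐᵒᵖ :=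
  QuotientGroup.lift trivialWords ((MonoidHom.op (QuotientGroup.mk' trivialWords)).comp
    wordTranspose) fun w hw => by
      refine MulOpposite.unop_injective ((QuotientGroup.eq_one_iff _).2 fun M => ?_)
      intros
      refine Units.ext (LinearMap.ext fun m => ?_)
      have h := wordAct_twisted M w
      rw [hw (TwistedDual M)] at h
      rw [← sub_eq_zero]
      refine (Module.forall_dual_apply_eq_zero_iff ℂ _).1 fun φ => ?_
      have h2 := LinearMap.congr_fun (LinearMap.congr_fun h φ) m
      rw [map_sub, sub_eq_zero]
      exact h2.symm

/-- The transposition anti-automorphism, `x_i(a) ↦ y_i(a)` and `y_i(a) ↦ x_i(a)`. -/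
def transpose (g : Grp) : Grp := (transposeHom g).unop

theorem transpose_x (i : Fin 7) (a : ℂ) : transpose (x i a) = y i a := rfl
theorem transpose_y (i : Fin 7) (a : ℂ) : transpose (y i a) = x i a := rfl
theorem transpose_mul (g h : Grp) : transpose (g * h) = transpose h * transpose g := by
  simp [transpose]

/-! ### The 56-dimensional minuscule module and the Plücker coordinates -/

/-- Labels of the weight basis of the minuscule module of highest weight `ω₇`; the number is the
height above the lowest weight. -/
inductive PIdx
  | v0 | v1 | v2 | v3 | v4 | v5' | v5'' | v6' | v6'' | v7' | v7'' | v8' | v8'' | v9 | v9'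
  | v9'' | v10 | v10' | v10'' | v11 | v11' | v11'' | v12 | v12' | v12'' | v13 | v13' | v13''
  | v14 | v14' | v14'' | v15 | v15' | v15'' | v16 | v16' | v16'' | v17 | v17' | v17'' | v18
  | v18' | v18'' | v19' | v19'' | v20' | v20'' | v21' | v21'' | v22' | v22'' | v23 | v24 | v25
  | v26 | v27
  deriving DecidableEq

instance : Fintype PIdx where
  elems := ⟨↑[PIdx.v0, .v1, .v2, .v3, .v4, .v5', .v5'', .v6', .v6'', .v7', .v7'', .v8', .v8'', .v9,
    .v9', .v9'', .v10, .v10', .v10'', .v11, .v11', .v11'', .v12, .v12', .v12'', .v13, .v13',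
    .v13'', .v14, .v14', .v14'', .v15, .v15', .v15'', .v16, .v16', .v16'', .v17, .v17', .v17'',
    .v18, .v18', .v18'', .v19', .v19'', .v20', .v20'', .v21', .v21'', .v22', .v22'', .v23,
    .v24, .v25, .v26, .v27], by decide +kernel⟩
  complete a := by cases a <;> exact List.mem_of_elem_eq_true rfl

/-! The weight diagram. The edge labelled `i` from `v_a` (left) down to `v_b` (right) means
`f_i v_a = v_b` and `e_i v_b = v_a`; all other `f_i v_a`, `e_i v_b` are zero. -/

/-- The edges labelled 1, read downwards. -/
def lower1 : PIdx → Option PIdx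
  | .v22'' => some .v21'' | .v21' => some .v20'' | .v20' => some .v19'' | .v19' => some .v18'
  | .v18 => some .v17' | .v17 => some .v16 | .v11 => some .v10 | .v10' => some .v9
  | .v9' => some .v8' | .v8'' => some .v7' | .v7'' => some .v6' | .v6'' => some .v5'' | _ => none

/-- The edges labelled 2, read downwards. -/
def lower2 : PIdx → Option PIdx
  | .v23 => some .v22' | .v22'' => some .v21' | .v21'' => some .v20'' | .v16'' => some .v15''
  | .v15' => some .v14'' | .v14 => some .v13' | .v14' => some .v13 | .v13'' => some .v12'
  | .v12'' => some .v11'' | .v7'' => some .v6'' | .v6' => some .v5'' | .v5' => some .v4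
  | _ => none

/-- The edges labelled 3, read downwards. -/
def lower3 : PIdx → Option PIdx
  | .v23 => some .v22'' | .v22' => some .v21' | .v19'' => some .v18'' | .v18' => some .v17''
  | .v17' => some .v16' | .v16 => some .v15 | .v12 => some .v11 | .v11' => some .v10'
  | .v10'' => some .v9' | .v9'' => some .v8'' | .v6' => some .v5' | .v5'' => some .v4 | _ => none

/-- The edges labelled 4, read downwards. -/
def lower4 : PIdx → Option PIdx
  | .v24 => some .v23 | .v21' => some .v20' | .v20'' => some .v19'' | .v17'' => some .v16''
  | .v16' => some .v15' | .v15 => some .v14 | .v13 => some .v12 | .v12' => some .v11'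
  | .v11'' => some .v10'' | .v8'' => some .v7'' | .v7' => some .v6' | .v4 => some .v3 | _ => none

/-- The edges labelled 5, read downwards. -/
def lower5 : PIdx → Option PIdx
  | .v25 => some .v24 | .v20' => some .v19' | .v19'' => some .v18' | .v18'' => some .v17''
  | .v15' => some .v14' | .v14 => some .v13'' | .v14'' => some .v13 | .v13' => some .v12'
  | .v10'' => some .v9'' | .v9' => some .v8'' | .v8' => some .v7' | .v3 => some .v2 | _ => none

/-- The edges labelled 6, read downwards. -/
def lower6 : PIdx → Option PIdx
  | .v26 => some .v25 | .v19' => some .v18 | .v18' => some .v17' | .v17'' => some .v16'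
  | .v16'' => some .v15' | .v15'' => some .v14'' | .v13'' => some .v12'' | .v12' => some .v11''
  | .v11' => some .v10'' | .v10' => some .v9' | .v9 => some .v8' | .v2 => some .v1 | _ => none

/-- The edges labelled 7, read downwards. -/
def lower7 : PIdx → Option PIdx
  | .v27 => some .v26 | .v18 => some .v17 | .v17' => some .v16 | .v16' => some .v15
  | .v15' => some .v14 | .v14' => some .v13'' | .v14'' => some .v13' | .v13 => some .v12'
  | .v12 => some .v11' | .v11 => some .v10' | .v10 => some .v9 | .v1 => some .v0 | _ => none

/-- The edges labelled 1, read upwards. -/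
def raise1 : PIdx → Option PIdx
  | .v21'' => some .v22'' | .v20'' => some .v21' | .v19'' => some .v20' | .v18' => some .v19'
  | .v17' => some .v18 | .v16 => some .v17 | .v10 => some .v11 | .v9 => some .v10'
  | .v8' => some .v9' | .v7' => some .v8'' | .v6' => some .v7'' | .v5'' => some .v6'' | _ => none

/-- The edges labelled 2, read upwards. -/
def raise2 : PIdx → Option PIdx
  | .v22' => some .v23 | .v21' => some .v22'' | .v20'' => some .v21'' | .v15'' => some .v16''
  | .v14'' => some .v15' | .v13' => some .v14 | .v13 => some .v14' | .v12' => some .v13''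
  | .v11'' => some .v12'' | .v6'' => some .v7'' | .v5'' => some .v6' | .v4 => some .v5'
  | _ => none

/-- The edges labelled 3, read upwards. -/
def raise3 : PIdx → Option PIdx
  | .v22'' => some .v23 | .v21' => some .v22' | .v18'' => some .v19'' | .v17'' => some .v18'
  | .v16' => some .v17' | .v15 => some .v16 | .v11 => some .v12 | .v10' => some .v11'
  | .v9' => some .v10'' | .v8'' => some .v9'' | .v5' => some .v6' | .v4 => some .v5'' | _ => none

/-- The edges labelled 4, read upwards. -/
def raise4 : PIdx → Option PIdx
  | .v23 => some .v24 | .v20' => some .v21' | .v19'' => some .v20'' | .v16'' => some .v17''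
  | .v15' => some .v16' | .v14 => some .v15 | .v12 => some .v13 | .v11' => some .v12'
  | .v10'' => some .v11'' | .v7'' => some .v8'' | .v6' => some .v7' | .v3 => some .v4 | _ => none

/-- The edges labelled 5, read upwards. -/
def raise5 : PIdx → Option PIdx
  | .v24 => some .v25 | .v19' => some .v20' | .v18' => some .v19'' | .v17'' => some .v18''
  | .v14' => some .v15' | .v13'' => some .v14 | .v13 => some .v14'' | .v12' => some .v13'
  | .v9'' => some .v10'' | .v8'' => some .v9' | .v7' => some .v8' | .v2 => some .v3 | _ => none

/-- The edges labelled 6, read upwards. -/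
def raise6 : PIdx → Option PIdx
  | .v25 => some .v26 | .v18 => some .v19' | .v17' => some .v18' | .v16' => some .v17''
  | .v15' => some .v16'' | .v14'' => some .v15'' | .v12'' => some .v13'' | .v11'' => some .v12'
  | .v10'' => some .v11' | .v9' => some .v10' | .v8' => some .v9 | .v1 => some .v2 | _ => none

/-- The edges labelled 7, read upwards. -/
def raise7 : PIdx → Option PIdx
  | .v26 => some .v27 | .v17 => some .v18 | .v16 => some .v17' | .v15 => some .v16'
  | .v14 => some .v15' | .v13'' => some .v14' | .v13' => some .v14'' | .v12' => some .v13
  | .v11' => some .v12 | .v10' => some .v11 | .v9 => some .v10 | .v0 => some .v1 | _ => none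

/-- `f_i v_a` is `v_b` if `lower i a = some b`, and zero if `lower i a = none`. -/
def lower : Fin 7 → PIdx → Option PIdx :=
  ![lower1, lower2, lower3, lower4, lower5, lower6, lower7]

/-- `e_i v_a` is `v_b` if `raise i a = some b`, and zero if `raise i a = none`. -/
def raise : Fin 7 → PIdx → Option PIdx :=
  ![raise1, raise2, raise3, raise4, raise5, raise6, raise7]

/-- The Cartan matrix. -/
def cartan (i j : Fin 7) : ℤ := CartanMatrix.E₇ i j

/-- The `i`-th coordinate of the weight of `v_a` in the basis of fundamental weights. -/
def wt (i : Fin 7) (a : PIdx) : ℤ :=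
  if (lower i a).isSome then 1 else if (raise i a).isSome then -1 else 0

/-- Precomposition with a partial map of the basis: the coordinate of index `b` of the result is
the coordinate of index `t b` of the argument, or zero. -/
def pull (t : PIdx → Option PIdx) : Module.End ℂ (PIdx → ℂ) where
  toFun φ b := (t b).elim 0 φ
  map_add' φ ψ := by ext b; cases h : t b <;> simp [h]
  map_smul' c φ := by ext b; cases h : t b <;> simp [h]

/-- `e_i` on `∑ φ_a v_a`: since `e_i v_a = v_b` iff `lower i b = some a`, the coordinate of `v_b`
in the result is `φ_a` for `lower i b = some a`. -/
def minE (i : Fin 7) : Module.End ℂ (PIdx → ℂ) := pull (lower i)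
/-- `f_i` on `∑ φ_a v_a`. -/
def minF (i : Fin 7) : Module.End ℂ (PIdx → ℂ) := pull (raise i)
/-- `h_i` on `∑ φ_a v_a`. -/
def minH (i : Fin 7) : Module.End ℂ (PIdx → ℂ) where
  toFun φ b := (wt i b : ℂ) * φ b
  map_add' φ ψ := by ext b; simp [mul_add]
  map_smul' c φ := by ext b; simp [mul_left_comm]

theorem pull_mul (s t : PIdx → Option PIdx) :
    pull s * pull t = pull fun b => (s b).bind t := by
  refine LinearMap.ext fun φ => funext fun b => ?_
  change (s b).elim 0 (fun c => (t c).elim 0 φ) = ((s b).bind t).elim 0 φ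
  cases s b <;> rfl

theorem pull_none : pull (fun _ => none) = 0 := rfl

theorem lower_lower (i j : Fin 7) (h : cartan i j = 0) (b : PIdx) :
    (lower i b).bind (lower j) = (lower j b).bind (lower i) := by
  revert i j b; decide +kernel

theorem raise_raise (i j : Fin 7) (h : cartan i j = 0) (b : PIdx) :
    (raise i b).bind (raise j) = (raise j b).bind (raise i) := by
  revert i j b; decide +kernel

theorem lower_self (i : Fin 7) (b : PIdx) : (lower i b).bind (lower i) = none := by
  revert i b; decide +kernel

theorem raise_self (i : Fin 7) (b : PIdx) : (raise i b).bind (raise i) = none := by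
  revert i b; decide +kernel

theorem lower_braid (i j : Fin 7) (h : cartan i j = -1) (b : PIdx) :
    (lower i b).bind (fun c => (lower j c).bind (lower i)) = none := by
  revert i j b; decide +kernel

theorem raise_braid (i j : Fin 7) (h : cartan i j = -1) (b : PIdx) :
    (raise i b).bind (fun c => (raise j c).bind (raise i)) = none := by
  revert i j b; decide +kernel

theorem lower_raise_ne (i j : Fin 7) (h : i ≠ j) (b : PIdx) :
    (lower i b).bind (raise j) = (raise j b).bind (lower i) := by
  revert i j b; decide +kernel

theorem lower_raise_self (i : Fin 7) (b : PIdx) :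
    (wt i b = 1 ∧ (lower i b).bind (raise i) = some b ∧ (raise i b).bind (lower i) = none) ∨
    (wt i b = 0 ∧ (lower i b).bind (raise i) = none ∧ (raise i b).bind (lower i) = none) ∨
    (wt i b = -1 ∧ (lower i b).bind (raise i) = none ∧ (raise i b).bind (lower i) = some b) := by
  revert i b; decide +kernel

theorem wt_lower (i j : Fin 7) (b : PIdx) :
    (lower j b).all (fun c => wt i b - wt i c = cartan i j) := by
  revert i j b; decide +kernel

theorem wt_raise (i j : Fin 7) (b : PIdx) :
    (raise j b).all (fun c => wt i b - wt i c = -cartan i j) := by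
  revert i j b; decide +kernel

theorem minH_mul_pull (i : Fin 7) (t : PIdx → Option PIdx) (n : ℤ)
    (h : ∀ b, (t b).all (fun c => wt i b - wt i c = n)) :
    minH i * pull t - pull t * minH i = n • pull t := by
  refine LinearMap.ext fun φ => funext fun b => ?_
  change (wt i b : ℂ) * (t b).elim 0 φ - (t b).elim 0 (fun c => (wt i c : ℂ) * φ c)
    = (n • fun b => (t b).elim 0 φ) b
  cases hb : t b with
  | none => simp [hb]
  | some c =>
    have := h b
    simp only [hb, Option.all_some, decide_eq_true_eq] at this
    simp [hb, ← this, sub_mul]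

attribute [local instance 100] LieRing.ofAssociativeRing

theorem ad_pull_pow {t : Fin 7 → PIdx → Option PIdx} {i j : Fin 7}
    (h0 : cartan i j = 0 → ∀ b, (t i b).bind (t j) = (t j b).bind (t i))
    (hs : ∀ b, (t i b).bind (t i) = none)
    (h1 : cartan i j = -1 → ∀ b, (t i b).bind (fun c => (t j c).bind (t i)) = none) :
    (LieAlgebra.ad ℂ (Module.End ℂ (PIdx → ℂ)) (pull (t i)) ^ (-cartan i j).toNat)
      ⁅pull (t i), pull (t j)⁆ = 0 := by
  have hcases : ∀ i j, i = j ∨ cartan i j = 0 ∨ cartan i j = -1 := by decide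
  rcases hcases i j with h | h | h
  · subst h
    rw [lie_self, map_zero]
  · rw [LieRing.of_associative_ring_bracket, pull_mul, pull_mul, funext (h0 h), sub_self, map_zero]
  · have hsq : pull (t i) * pull (t i) = 0 := by rw [pull_mul, funext hs, pull_none]
    have hbr : pull (t i) * (pull (t j) * pull (t i)) = 0 := by
      rw [pull_mul, pull_mul, funext (h1 h), pull_none]
    rw [h, neg_neg, Int.toNat_one, pow_one, LieAlgebra.ad_apply, LieRing.of_associative_ring_bracket,
      LieRing.of_associative_ring_bracket, mul_sub, sub_mul,
      ← mul_assoc, hsq, mul_assoc, hbr, mul_assoc, hsq]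
    simp

theorem serreRel_min : SerreRel (L := Module.End ℂ (PIdx → ℂ)) minH minE minF where
  hh i j := by
    rw [LieRing.of_associative_ring_bracket]
    refine LinearMap.ext fun φ => funext fun b => ?_
    change (wt i b : ℂ) * ((wt j b : ℂ) * φ b) - (wt j b : ℂ) * ((wt i b : ℂ) * φ b) = 0
    ring
  ef i j := by
    rw [LieRing.of_associative_ring_bracket, minE, minF, pull_mul, pull_mul]
    by_cases hij : i = j
    · subst hij
      rw [if_pos rfl]
      refine LinearMap.ext fun φ => funext fun b => ?_
      change ((lower i b).bind (raise i)).elim 0 φ - ((raise i b).bind (lower i)).elim 0 φ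
        = (wt i b : ℂ) * φ b
      rcases lower_raise_self i b with ⟨h, h1, h2⟩ | ⟨h, h1, h2⟩ | ⟨h, h1, h2⟩ <;>
        simp [h, h1, h2]
    · rw [if_neg hij, funext (lower_raise_ne i j hij), sub_self]
  he i j := minH_mul_pull i _ _ (wt_lower i j)
  hf i j := by
    have := minH_mul_pull i (raise j) (-cartan i j) (wt_raise i j)
    rw [neg_smul] at this
    exact this
  ade i j := ad_pull_pow (t := lower) (lower_lower i j) (lower_self i)
    (lower_braid i j)
  adf i j := ad_pull_pow (t := raise) (raise_raise i j) (raise_self i)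
    (raise_braid i j)

/-- The minuscule module of highest weight `ω₇`, with its weight basis `v_a`. -/
def Minuscule : Type := PIdx → ℂ

instance : AddCommGroup Minuscule := inferInstanceAs (AddCommGroup (PIdx → ℂ))
instance : Module ℂ Minuscule := inferInstanceAs (Module ℂ (PIdx → ℂ))
instance : FiniteDimensional ℂ Minuscule := inferInstanceAs (FiniteDimensional ℂ (PIdx → ℂ))
instance : LieRingModule Alg Minuscule :=
  LieRingModule.compLieHom (PIdx → ℂ) (liftAlg serreRel_min)
instance : LieModule ℂ Alg Minuscule :=
  LieModule.compLieHom (PIdx → ℂ) (liftAlg serreRel_min)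

/-- The basis vector `v_a`. -/
def Minuscule.v (a : PIdx) : Minuscule := (Pi.single a 1 : PIdx → ℂ)

/-- The generalized Plücker coordinate `p_a(g) = v₀^*(g · v_a)`. -/
def plucker (g : Grp) (a : PIdx) : ℂ :=
  (show PIdx → ℂ from (act Minuscule g : Module.End ℂ Minuscule) (Minuscule.v a)) .v0

/-! ### The Weyl group and representatives in the group -/

/-- The node labelled `n` in the Dynkin diagram, for `1 ≤ n ≤ 7`. -/
def node (n : ℕ) : Fin 7 := Fin.ofNat 7 (n - 1)

/-- The Weyl group of type `E₇` as a Coxeter group. -/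
abbrev Weyl : Type := CoxeterMatrix.E₇.Group

/-- The Weyl group with its simple reflections. -/
abbrev coxeter : CoxeterSystem CoxeterMatrix.E₇ Weyl := CoxeterMatrix.E₇.toCoxeterSystem

/-- The representative `x_i(-1) y_i(1) x_i(-1)` of the `i`-th simple reflection. -/
def sbar (i : Fin 7) : Grp := x i (-1) * y i 1 * x i (-1)

/-- The representative of a Weyl group element: the product of the `sbar i` along a reduced word
(by the braid relations, every reduced word gives the same element). -/
def wbar (w : Weyl) : Grp := ((coxeter.exists_isReduced w).choose.map sbar).prod

/-! ### Fundamental representations and generalized minors -/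

/-- The irreducible representation of highest weight `ω_i`, with a highest weight vector. -/
structure FundamentalRep (i : Fin 7) where
  M : Type
  [addCommGroup : AddCommGroup M]
  [module : Module ℂ M]
  [lieRingModule : LieRingModule Alg M]
  [lieModule : LieModule ℂ Alg M]
  [finiteDimensional : FiniteDimensional ℂ M]
  irreducible : LieModule.IsIrreducible ℂ Alg M
  /-- the highest weight vector -/
  v : M
  v_ne_zero : v ≠ 0
  chevE_v : ∀ j, ⁅chevE j, v⁆ = 0
  chevH_v : ∀ j, ⁅chevH j, v⁆ = (if j = i then (1 : ℂ) else 0) • v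

attribute [instance] FundamentalRep.addCommGroup FundamentalRep.module
  FundamentalRep.lieRingModule FundamentalRep.lieModule FundamentalRep.finiteDimensional

/-- The space of vectors of weight `μ`, a weight being given by its values on the `h_j`. -/
def wtSpace (M : Type) [AddCommGroup M] [Module ℂ M] [LieRingModule Alg M] [LieModule ℂ Alg M]
    (μ : Fin 7 → ℂ) : Submodule ℂ M :=
  ⨅ j, (LieModule.toEnd ℂ Alg M (chevH j)).eigenspace (μ j)

open Classical in
/-- The coefficient `⟨m, v⟩` of the highest weight vector `v` in `m`: the number `c` such that
`m - c v` is a sum of vectors of weights different from the highest weight. -/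
def hwCoeff {i : Fin 7} (V : FundamentalRep i) (m : V.M) : ℂ :=
  if h : ∃ c : ℂ, m - c • V.v ∈ ⨆ μ ∈ {μ : Fin 7 → ℂ | μ ≠ Pi.single i 1}, wtSpace V.M μ
  then h.choose else 0

/-- The generalized minor `Δ_{w₁ω_i, w₂ω_i}(g) = ⟨w̄₁⁻¹ g w̄₂ v, v⟩`. -/
def minor {i : Fin 7} (V : FundamentalRep i) (w₁ w₂ : Weyl) (g : Grp) : ℂ :=
  hwCoeff V ((act V.M ((wbar w₁)⁻¹ * g * wbar w₂) : Module.End ℂ V.M) V.v)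

/-! ### The reduced expression of the longest element and the initial seed -/

/-- The labels of the reduced expression of the longest element. -/
def w0Labels : List ℕ :=
  [1, 2, 3, 1, 4, 2, 3, 1, 4, 3, 5, 4, 2, 3, 1, 4, 3, 5, 4, 2, 6, 5, 4, 2, 3, 1, 4, 3, 5, 4, 2,
   6, 5, 4, 3, 1,
   7, 6, 5, 4, 3, 2, 4, 5, 6, 1, 3, 4, 7, 5, 2, 4, 3, 1, 6, 5, 4, 2, 3, 4, 5, 6, 7]

/-- The reduced word of the longest element, of length `63`. -/
def w0Word : List (Fin 7) := w0Labels.map node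

/-- The longest element of the Weyl group. -/
def w0 : Weyl := coxeter.wordProd w0Word

/-- The `k`-th simple reflection, counted from the right: `w₀ = s_{r 63} ⋯ s_{r 1}`. -/
def r (k : ℕ) : Fin 7 := w0Word.reverse.getD (k - 1) 0

/-- `u_{≥k} = s_{r 63} ⋯ s_{r k}`; it is `1` for `k ≥ 64`. -/
def uGe (k : ℕ) : Weyl := coxeter.wordProd (w0Word.take (64 - k))

/-- The transposed generalized minor
`Δ^T_{w₁ω_i, w₂ω_i}(g) = Δ_{w₂w₀ω_i, w₁w₀ω_i}(g^T)` (note that `-w₀ω_i = ω_i` in type `E₇`). -/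
def minorT {i : Fin 7} (V : FundamentalRep i) (w₁ w₂ : Weyl) (g : Grp) : ℂ :=
  minor V (w₂ * w0) (w₁ * w0) (transpose g)

/-- The functions `φ(k, ω_i) = Δ^T_{u_{≥k}ω_i, w₀ω_i}`. -/
def phi (V : ∀ i, FundamentalRep i) (k : ℕ) (i : Fin 7) (g : Grp) : ℂ :=
  minorT (V i) (uGe k) w0 g

/-- The open dense torus `{y_{r 27}(a₂₇) ⋯ y_{r 1}(a₁) | a_k ≠ 0}` of the unipotent cell. -/
def uMinusCirc : Set Grp :=
  {u | ∃ a : ℕ → ℂ, (∀ k, a k ≠ 0) ∧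
    u = (((List.range' 1 27).reverse).map fun k => y (r k) (a k)).prod}

/-- The index `k` is exchangeable if `φ(k, ω_{r k})` is not identically `1` on the unipotent cell,
equivalently on its open dense torus. -/
def Exchangeable (V : ∀ i, FundamentalRep i) (k : ℕ) : Prop :=
  ∃ u ∈ uMinusCirc, phi V k (r k) u ≠ 1

/-- The pairs `(k, i)` such that `φ(k, ω_i)` is a mutable variable of the initial seed. -/
def mutableIndices (V : ∀ i, FundamentalRep i) : Set (ℕ × Fin 7) :=
  {ki | (1 ≤ ki.1 ∧ ki.1 ≤ 27) ∧ Exchangeable V ki.1 ∧ ki.2 = r ki.1}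

/-- The index `t_i`: the functions `φ(t_i, ω_i)` together with `Δ^T_{ω₇, ω₇}` are the frozen
variables of the initial seed. -/
def frozenIndex (i : Fin 7) : ℕ :=
  if i = node 7 then 63 + 7 else sInf {t | 27 < t ∧ t ≤ 63 ∧ r t = i}


/-! ### The polynomials in the Plücker coordinates -/

def q18 (p : PIdx → ℂ) : ℂ :=
  p .v1 * p .v17 - p .v0 * p .v18

def q36 (p : PIdx → ℂ) : ℂ :=
  p .v10 * p .v26 - p .v9 * p .v27

def q27 (p : PIdx → ℂ) : ℂ :=
  p .v0 * p .v27 - p .v1 * p .v26 + p .v2 * p .v25 - p .v3 * p .v24 + p .v4 * p .v23 -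
    p .v5'' * p .v22'' + p .v6'' * p .v21''

def q45 (p : PIdx → ℂ) : ℂ :=
  (p .v9 * p .v11 - p .v10 * p .v10') * p .v25 - (p .v8' * p .v11 - p .v9' * p .v10) * p .v26 +
    (p .v8' * p .v10' - p .v9 * p .v9') * p .v27

def q36' (p : PIdx → ℂ) : ℂ :=
  (p .v0 * p .v14' - p .v1 * p .v13'' + p .v2 * p .v12'') * p .v22' +
    (-p .v0 * p .v13 + p .v1 * p .v12' - p .v2 * p .v11'') * p .v23 +
    (p .v0 * p .v12 - p .v1 * p .v11' + p .v2 * p .v10'') * p .v24 - p .v2 * p .v9'' * p .v25 +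
    p .v1 * p .v9'' * p .v26 - p .v0 * p .v9'' * p .v27

def q27' (p : PIdx → ℂ) : ℂ :=
  -p .v0 * p .v27 + p .v1 * p .v26 - p .v2 * p .v25 + p .v3 * p .v24

def q27'' (p : PIdx → ℂ) : ℂ :=
  -p .v6'' * p .v21'' - p .v7' * p .v20' + p .v7'' * p .v20'' + p .v8' * p .v19' - p .v9 * p .v18 +
    p .v10 * p .v17

def q54 (p : PIdx → ℂ) : ℂ :=
  (p .v5'' * p .v7'' - p .v6' * p .v6'') * (p .v20'' * p .v22'' - p .v21' * p .v21'') -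
    (p .v4 * p .v7'' - p .v5' * p .v6'') * (p .v20'' * p .v23 - p .v21'' * p .v22') +
    (p .v4 * p .v6' - p .v5' * p .v5'') * (p .v21' * p .v23 - p .v22' * p .v22'') +
    q27' p * q27'' p

def q10 (p : PIdx → ℂ) : ℂ :=
  p .v1 * p .v9 - p .v10

def q10' (p : PIdx → ℂ) : ℂ :=
  p .v2 * p .v8' - p .v1 * p .v9 + p .v10

def q10'' (p : PIdx → ℂ) : ℂ :=
  p .v3 * p .v7' - p .v2 * p .v8' + p .v1 * p .v9 - p .v10

def q12 (p : PIdx → ℂ) : ℂ :=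
  p .v5'' * p .v7'' - p .v6' * p .v6''

def q14 (p : PIdx → ℂ) : ℂ :=
  p .v2 * p .v12'' - p .v1 * p .v13'' + p .v14'

def q19' (p : PIdx → ℂ) : ℂ :=
  p .v9' * (p .v10 - p .v1 * p .v9) - p .v8' * (p .v11 - p .v1 * p .v10')

def q20 (p : PIdx → ℂ) : ℂ :=
  p .v5' * p .v15'' - p .v4 * p .v16'' + p .v3 * p .v17'' - p .v2 * p .v18''

def q23 (p : PIdx → ℂ) : ℂ :=
  p .v5'' * (p .v18 - p .v1 * p .v17) - p .v6'' * (p .v17' - p .v1 * p .v16)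

def q18' (p : PIdx → ℂ) : ℂ :=
  p .v2 * (p .v5' * p .v11'' - p .v4 * p .v12'') + p .v1 * (p .v4 * p .v13'' - p .v5' * p .v12') +
    p .v5' * p .v13 - p .v4 * p .v14'

def q28' (p : PIdx → ℂ) : ℂ :=
  (p .v1 * p .v15 - p .v16') * (p .v5'' * p .v7'' - p .v6' * p .v6'') -
    (p .v1 * p .v16 - p .v17') * (p .v4 * p .v7'' - p .v5' * p .v6'') +
    (p .v1 * p .v17 - p .v18) * (p .v4 * p .v6' - p .v5' * p .v5'')

def q30 (p : PIdx → ℂ) : ℂ :=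
  p .v18'' * (p .v3 * p .v9'' - p .v2 * p .v10'' + p .v1 * p .v11' - p .v12) -
    p .v19'' * (p .v3 * p .v8'' - p .v2 * p .v9' + p .v1 * p .v10' - p .v11) -
    p .v20' * (-p .v3 * p .v7' + p .v2 * p .v8' - p .v1 * p .v9 + p .v10) + p .v3 * q27'' p

def q40 (p : PIdx → ℂ) : ℂ :=
  (p .v2 * p .v12'' - p .v1 * p .v13'' + p .v14') *
      (p .v6'' * p .v20'' - p .v5'' * p .v21' + p .v4 * p .v22') +
    (p .v2 * p .v11'' - p .v1 * p .v12' + p .v13) *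
      (-p .v5' * p .v22' + p .v6' * p .v21' - p .v7'' * p .v20'' + q27'' p)

end Freudenthal
end

/-! For `u` in the torus, the transpose of `u` is `x_{r 1}(a₁) ⋯ x_{r 27}(a₂₇)`. Since `w₀` is a
central involution of the Weyl group, `φ(k, ω_i)(u)` is the coefficient of `v⁺` in this product
applied to `s̄_{r 1} ⋯ s̄_{r (k-1)} v⁺`. The minors and the Plücker coordinates are therefore
polynomials in `a₁, …, a₂₇` with integer coefficients, and every identity of the seed becomes an
equality of two explicit polynomials, decided by computation.

The minors must first be made computable for an arbitrary model of the fundamental representation.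
By `hwCoeff_act` the coefficient of `v⁺` may be computed in any finite-dimensional module `N` with a
highest weight vector `n` of the same weight and a functional of that weight normalized at `n`: the
submodule of `V × N` generated from `(v⁺, n)` by the `f_j` is stable under the group, and on it the
two coefficients agree. Here `N` is a tensor power of the 56-dimensional module and `n` is the
explicit vector `topTensor i`. On the minuscule module `x_i(a) = 1 + a e_i`, and each `s̄_i`
permutes the basis up to sign, so a minor is a signed sum of products of matrix entries (`phi_eq`).

The representative `wbar` is built from an unspecified reduced word. Replacing it by the given one
takes Matsumoto's theorem (`prod_map_eq_of_isReduced`), the braid relations for the `s̄_i` on the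
minuscule module (`act_sbar_braid`) and the reducedness of the given word (`isReduced_w0Word`). The
Coxeter-theoretic input comes from the classical parity representation of the Weyl group on `W ×
ZMod 2`.

An index is not exchangeable exactly when it is the first occurrence of its label, where the minor
is the constant polynomial `1`; at every other index the minor differs from `1` at the point with
all `a_k = 1`. -/

noncomputable section
namespace Freudenthal

/-! ### Parity of inversions and the exchange property -/

section coxeterTheory
variable {B W : Type*} [Group W] {M : CoxeterMatrix B} (cs : CoxeterSystem M W)

open Classical in
/-- The permutation `(t, ε) ↦ (s_i t s_i, ε + [t = s_i])` of `W × ZMod 2`. -/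
def parityStep (i : B) : Function.End (W × ZMod 2) := fun q =>
  (cs.simple i * q.1 * cs.simple i, q.2 + if q.1 = cs.simple i then 1 else 0)

-- The second component counts modulo 2 the occurrences of the tracked element in the inversion
-- sequence. Taking all of `W` as the first factor avoids singling out the reflections.
open Classical in
theorem prod_parityStep (ω : List B) (q : W × ZMod 2) :
    (ω.map (parityStep cs)).prod q =
      (cs.wordProd ω * q.1 * (cs.wordProd ω)⁻¹, q.2 + ((cs.rightInvSeq ω).count q.1 : ZMod 2)) := by
  induction ω with
  | nil => simp [Function.End.one_def]
  | cons i ω ih =>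
    rw [List.map_cons, List.prod_cons]
    change parityStep cs i ((ω.map (parityStep cs)).prod q) = _
    rw [ih, parityStep, cs.wordProd_cons, CoxeterSystem.rightInvSeq, List.count_cons]
    have h : (cs.wordProd ω * q.1 * (cs.wordProd ω)⁻¹ = cs.simple i) ↔
        ((cs.wordProd ω)⁻¹ * cs.simple i * cs.wordProd ω == q.1) = true := by
      rw [beq_iff_eq, mul_inv_eq_iff_eq_mul, mul_assoc, inv_mul_eq_iff_eq_mul]
      exact eq_comm
    refine Prod.ext ?_ ?_
    · simp [mul_assoc]
    · simp only [h]
      push_cast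
      ring

/-- A Coxeter matrix all of whose entries off the diagonal are `2` or `3`. -/
def SimplyLaced (M : CoxeterMatrix B) : Prop := ∀ i j, M i j = 1 ∨ M i j = 2 ∨ M i j = 3

variable {cs}

theorem simple_comm {i j : B} (h : M i j = 2) :
    cs.simple i * cs.simple j = cs.simple j * cs.simple i := by
  have h1 := cs.simple_mul_simple_pow i j
  rw [h, pow_two] at h1
  calc cs.simple i * cs.simple j = (cs.simple i * cs.simple j)⁻¹ := eq_inv_of_mul_eq_one_left h1
    _ = _ := by simp

theorem simple_braid {i j : B} (h : M i j = 3) :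
    cs.simple i * cs.simple j * cs.simple i = cs.simple j * cs.simple i * cs.simple j := by
  have h1 := cs.simple_mul_simple_pow i j
  have h2 : (cs.simple i * cs.simple j * cs.simple i) * (cs.simple j * cs.simple i * cs.simple j)
      = 1 := by
    rw [← h1, h]; simp [pow_succ, mul_assoc]
  calc _ = (cs.simple j * cs.simple i * cs.simple j)⁻¹ := eq_inv_of_mul_eq_one_left h2
    _ = _ := by simp [mul_assoc]

theorem conj_append (ω ω' : List B) (t : W) :
    (cs.wordProd (ω ++ ω'))⁻¹ * t * cs.wordProd (ω ++ ω') =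
      (cs.wordProd ω')⁻¹ * ((cs.wordProd ω)⁻¹ * t * cs.wordProd ω) * cs.wordProd ω' := by
  rw [cs.wordProd_append]
  group

/-- The word `(i j)^m` with `m = M i j` has trivial product, and its inversion sequence runs twice
through the same `m` entries, so all counts are even. The rank two cases `m = 1, 2, 3` are computed
by hand. -/
theorem parityStep_liftable (hM : SimplyLaced M) : M.IsLiftable (parityStep cs) := by
  classical
  intro i j
  have key : ∀ ω : List B, cs.wordProd ω = 1 →
      (∀ t, ((cs.rightInvSeq ω).count t : ZMod 2) = 0) → (ω.map (parityStep cs)).prod = 1 := by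
    intro ω h1 h2
    funext q
    rw [prod_parityStep, h1, h2]
    simp [Function.End.one_def]
  have two : ∀ a b c : ZMod 2, a + b + c + a + b + c = 0 := by decide
  have two' : ∀ a b : ZMod 2, a + b + a + b = 0 := by decide
  have hij := cs.simple_mul_simple_pow i j
  have ha := cs.simple_mul_simple_self i
  have hb := cs.simple_mul_simple_self j
  rcases hM i j with h | h | h
  · rw [h, pow_one] at hij ⊢
    have hs : cs.simple j = cs.simple i := by
      rw [eq_comm, ← mul_inv_eq_one]; simpa using hij
    have := key [i, j] (by simpa [CoxeterSystem.wordProd] using hij) fun t => by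
      simp only [CoxeterSystem.rightInvSeq, List.count_cons, List.count_nil,
        CoxeterSystem.wordProd_singleton, CoxeterSystem.wordProd_nil, hs]
      simp only [inv_mul_cancel, one_mul, inv_one, mul_one, zero_add, Nat.cast_add]
      exact CharTwo.add_self_eq_zero _
    simpa using this
  · have hc := simple_comm (cs := cs) h
    have := key [i, j, i, j] (by rw [h] at hij; simpa [CoxeterSystem.wordProd, pow_succ, mul_assoc] using hij) fun t => by
      have e1 : (cs.wordProd [j])⁻¹ * cs.simple i * cs.wordProd [j] = cs.simple i := by
        rw [cs.wordProd_singleton, mul_assoc, hc]; simp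
      have e2 : (cs.wordProd [i, j])⁻¹ * cs.simple j * cs.wordProd [i, j] = cs.simple j := by
        rw [mul_assoc, inv_mul_eq_iff_eq_mul, cs.wordProd_cons, cs.wordProd_singleton,
          ← mul_assoc, ← hc]
      have e3 : (cs.wordProd [j, i, j])⁻¹ * cs.simple i * cs.wordProd [j, i, j] = cs.simple i := by
        rw [mul_assoc, inv_mul_eq_iff_eq_mul, cs.wordProd_cons, cs.wordProd_cons,
          cs.wordProd_singleton, hc]
        simp
      simp only [CoxeterSystem.rightInvSeq, List.count_cons, List.count_nil, e1, e2, e3]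
      simp only [CoxeterSystem.wordProd_nil, inv_one, one_mul, mul_one, zero_add, Nat.cast_add]
      exact two' _ _
    rw [h]
    simpa [pow_succ, mul_assoc] using this
  · have hc := simple_braid (cs := cs) h
    have := key [i, j, i, j, i, j] (by rw [h] at hij; simpa [CoxeterSystem.wordProd, pow_succ, mul_assoc] using hij) fun t => by
      have e2 : (cs.wordProd [i, j])⁻¹ * cs.simple j * cs.wordProd [i, j] = cs.simple i := by
        rw [mul_assoc, inv_mul_eq_iff_eq_mul, cs.wordProd_cons, cs.wordProd_singleton,
          hc, mul_assoc]
      have e3 : (cs.wordProd [j, i, j])⁻¹ * cs.simple i * cs.wordProd [j, i, j] = cs.simple j := by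
        rw [mul_assoc, inv_mul_eq_iff_eq_mul, cs.wordProd_cons, cs.wordProd_cons,
          cs.wordProd_singleton, ← mul_assoc (cs.simple j)]
        nth_rw 1 [← hc]
        simp [mul_assoc]
      have e4 : (cs.wordProd [i, j, i, j])⁻¹ * cs.simple j * cs.wordProd [i, j, i, j]
          = (cs.wordProd [j])⁻¹ * cs.simple i * cs.wordProd [j] := by
        rw [show [i, j, i, j] = [i, j] ++ [i, j] from rfl, conj_append, e2]
        simp [cs.wordProd_cons, mul_assoc]
      have e5 : (cs.wordProd [j, i, j, i, j])⁻¹ * cs.simple i * cs.wordProd [j, i, j, i, j]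
          = cs.simple i := by
        rw [show [j, i, j, i, j] = [j, i, j] ++ [i, j] from rfl, conj_append, e3, e2]
      simp only [CoxeterSystem.rightInvSeq, List.count_cons, List.count_nil, e2, e3, e4, e5]
      simp only [CoxeterSystem.wordProd_nil, inv_one, one_mul, mul_one, zero_add, Nat.cast_add]
      exact two _ _ _
    rw [h]
    simpa [pow_succ, mul_assoc] using this

-- The operators extend to an action of `W`, so their product along a word depends only on the
-- element; its value at `(t, 0)` reads off the parity.
open Classical in
theorem count_rightInvSeq_eq (hM : SimplyLaced M) {ω ω' : List B}
    (h : cs.wordProd ω = cs.wordProd ω') (t : W) :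
    ((cs.rightInvSeq ω).count t : ZMod 2) = (cs.rightInvSeq ω').count t := by
  have hprod : ∀ ω : List B, (ω.map (parityStep cs)).prod =
      cs.lift ⟨_, parityStep_liftable hM⟩ (cs.wordProd ω) := fun ω => by
    rw [CoxeterSystem.wordProd, map_list_prod, List.map_map]
    congr 1
    refine List.map_congr_left fun i _ => ?_
    exact (cs.lift_apply_simple _ i).symm
  have h1 := congrFun (hprod ω) (t, 0)
  have h2 := congrFun (hprod ω') (t, 0)
  rw [h, ← h2, prod_parityStep, prod_parityStep] at h1
  simpa using congrArg Prod.snd h1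

/-- A word whose inversion sequence has no duplicates is reduced. -/
theorem isReduced_of_nodup (hM : SimplyLaced M) {ω : List B} (h : (cs.rightInvSeq ω).Nodup) :
    cs.IsReduced ω := by
  classical
  obtain ⟨ω', h1, h2⟩ := cs.exists_isReduced (cs.wordProd ω)
  -- An entry of multiplicity one has odd count, hence occurs in the inversion sequence of every
  -- word for the same element. A reduced word then has at least as many letters as `ω`.
  have hsub : cs.rightInvSeq ω ⊆ cs.rightInvSeq ω' := fun t ht => by
    have := count_rightInvSeq_eq hM h2 t
    rw [List.count_eq_one_of_mem h ht] at this
    by_contra hn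
    rw [List.count_eq_zero_of_not_mem hn] at this
    simp at this
  have hlen := (List.subperm_of_subset h hsub).length_le
  rw [cs.length_rightInvSeq, cs.length_rightInvSeq, ← h1.eq, ← h2] at hlen
  exact le_antisymm (cs.length_wordProd_le _) hlen

/-- The exchange property. -/
theorem exists_eraseIdx_right (hM : SimplyLaced M) (ω : List B) {i : B}
    (h : cs.IsRightDescent (cs.wordProd ω) i) :
    ∃ j < ω.length, cs.wordProd ω * cs.simple i = cs.wordProd (ω.eraseIdx j) := by
  classical
  obtain ⟨ω', h1, h2⟩ := cs.exists_isReduced (cs.wordProd ω * cs.simple i)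
  have hw : cs.wordProd ω = cs.wordProd (ω' ++ [i]) := by
    rw [cs.wordProd_append, ← h2]; simp
  have hr : cs.IsReduced (ω' ++ [i]) := by
    rw [CoxeterSystem.IsReduced, ← hw, ← cs.isRightDescent_iff.1 h, h2, h1.eq]; simp
  -- The last letter of a word is the last entry of its inversion sequence. Parity carries it over
  -- to `ω`, where an entry `s_i` marks the letter to delete.
  have hmem : cs.simple i ∈ cs.rightInvSeq (ω' ++ [i]) := by
    rw [← List.concat_eq_append, cs.rightInvSeq_concat]; simp
  have hc := count_rightInvSeq_eq hM hw (cs.simple i)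
  rw [List.count_eq_one_of_mem hr.nodup_rightInvSeq hmem] at hc
  have hmem2 : cs.simple i ∈ cs.rightInvSeq ω := by
    by_contra hn
    rw [List.count_eq_zero_of_not_mem hn] at hc
    simp at hc
  obtain ⟨j, hj, hjt⟩ := List.mem_iff_getElem.1 hmem2
  refine ⟨j, by simpa using hj, ?_⟩
  rw [← cs.wordProd_mul_getD_rightInvSeq, List.getD_eq_getElem _ _ hj, hjt]

theorem exists_eraseIdx_left (hM : SimplyLaced M) (ω : List B) {i : B}
    (h : cs.IsLeftDescent (cs.wordProd ω) i) :
    ∃ j < ω.length, cs.simple i * cs.wordProd ω = cs.wordProd (ω.eraseIdx j) := by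
  obtain ⟨j, hj, h1⟩ := exists_eraseIdx_right hM ω.reverse (i := i) (by
    rwa [cs.wordProd_reverse, cs.isRightDescent_inv_iff])
  rw [List.length_reverse] at hj
  have h2 : ω.reverse.eraseIdx j = (ω.eraseIdx (ω.length - 1 - j)).reverse := by
    rw [List.eraseIdx_eq_take_drop_succ, List.eraseIdx_eq_take_drop_succ, List.reverse_append,
      List.take_reverse, List.drop_reverse]
    congr 3 <;> omega
  refine ⟨ω.length - 1 - j, by omega, ?_⟩
  rw [cs.wordProd_reverse, h2, cs.wordProd_reverse] at h1
  rw [← inv_inj, ← h1]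
  simp

end coxeterTheory

/-! ### Matsumoto's theorem -/

section matsumoto
variable {B W : Type*} [Group W] {M : CoxeterMatrix B} {cs : CoxeterSystem M W}

theorem isReduced_tail {i : B} {ω : List B} (h : cs.IsReduced (i :: ω)) : cs.IsReduced ω := by
  simpa using h.drop 1

theorem isReduced_of_eq {ω ω' : List B} (h : cs.IsReduced ω) (hl : ω'.length = ω.length)
    (hp : cs.wordProd ω' = cs.wordProd ω) : cs.IsReduced ω' := by
  rw [CoxeterSystem.IsReduced, hp, h.eq, hl]

theorem isLeftDescent_of_isReduced {i : B} {ω : List B} (h : cs.IsReduced (i :: ω)) :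
    cs.IsLeftDescent (cs.wordProd (i :: ω)) i := by
  rw [CoxeterSystem.IsLeftDescent, h.eq, cs.wordProd_cons, cs.simple_mul_simple_cancel_left]
  exact Nat.lt_succ_of_le (cs.length_wordProd_le ω)

/-- Matsumoto's theorem for simply laced Coxeter systems. -/
theorem prod_map_eq_of_isReduced (hM : SimplyLaced M) (hinj : Function.Injective cs.simple)
    {G : Type*} [Monoid G] (f : B → G)
    (h2 : ∀ i j, M i j = 2 → f i * f j = f j * f i)
    (h3 : ∀ i j, M i j = 3 → f i * f j * f i = f j * f i * f j) :
    ∀ (n : ℕ) (ω ω' : List B), ω.length = n → cs.IsReduced ω → cs.IsReduced ω' →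
      cs.wordProd ω = cs.wordProd ω' → (ω.map f).prod = (ω'.map f).prod := by
  intro n
  induction n using Nat.strong_induction_on with
  | _ n ih =>
  intro ω ω' hn hr hr' hw
  have hlen : ω'.length = n := by rw [← hr'.eq, ← hw, hr.eq, hn]
  cases ω with
  | nil =>
    simp only [List.length_nil] at hn
    subst hn
    rw [List.length_eq_zero_iff.1 hlen]
  | cons i ω₁ =>
  cases ω' with
  | nil => simp at hn hlen; omega
  | cons j ω₂ =>
  simp only [List.length_cons] at hn hlen
  have hr₁ := isReduced_tail hr
  have hr₂ := isReduced_tail hr'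
  rw [List.map_cons, List.map_cons, List.prod_cons, List.prod_cons]
  by_cases hij : i = j
  · subst hij
    rw [cs.wordProd_cons, cs.wordProd_cons, mul_right_inj] at hw
    rw [ih ω₁.length (by omega) ω₁ ω₂ rfl hr₁ hr₂ hw]
  have hne : cs.simple i ≠ cs.simple j := fun h => hij (hinj h)
  have hi := isLeftDescent_of_isReduced hr
  have hj := isLeftDescent_of_isReduced hr'
  rw [hw] at hi
  -- Exchange `i` against the other word. Deleting its first letter `j` would give `s_i w = s_j w`,
  -- so the deleted letter lies in `ω₂` and `w = s_i s_j ω₃`.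
  obtain ⟨k, hk, he⟩ := exists_eraseIdx_left hM (j :: ω₂) hi
  rw [← hw] at he
  have hiw : cs.simple i * cs.wordProd (i :: ω₁) = cs.wordProd ω₁ := by
    rw [cs.wordProd_cons, cs.simple_mul_simple_cancel_left]
  have hjw : cs.simple j * cs.wordProd (i :: ω₁) = cs.wordProd ω₂ := by
    rw [hw, cs.wordProd_cons, cs.simple_mul_simple_cancel_left]
  obtain _ | k := k
  · exact absurd (mul_right_cancel (he.trans hjw.symm)) hne
  rw [List.eraseIdx_cons_succ, cs.wordProd_cons j] at he
  have hk2 : k < ω₂.length := by simpa using hk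
  have hlen₃ := List.length_eraseIdx_add_one hk2
  generalize ω₂.eraseIdx k = ω₃ at he hlen₃
  rcases hM i j with h | h | h
  · exact absurd h (M.off_diagonal i j hij)
  · have e1 : cs.wordProd (j :: ω₃) = cs.wordProd ω₁ := by rw [cs.wordProd_cons, ← he, hiw]
    have e2 : cs.wordProd (i :: ω₃) = cs.wordProd ω₂ := by
      rw [← hjw, cs.wordProd_cons i ω₁, ← e1, cs.wordProd_cons, cs.wordProd_cons, ← mul_assoc, ← mul_assoc,
        mul_assoc (cs.simple j), simple_comm h]
      simp
    have r1 := isReduced_of_eq hr₁ (by simp; omega) e1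
    have r2 := isReduced_of_eq hr₂ (by simp; omega) e2
    rw [ih ω₁.length (by omega) ω₁ (j :: ω₃) rfl hr₁ r1 e1.symm,
      ih ω₂.length (by omega) ω₂ (i :: ω₃) rfl hr₂ r2 e2.symm,
      List.map_cons, List.map_cons, List.prod_cons, List.prod_cons, ← mul_assoc, ← mul_assoc,
      h2 i j h]
  · have e1 : cs.wordProd (i :: ω₁) = cs.wordProd (i :: j :: ω₃) := by
      rw [cs.wordProd_cons i (j :: ω₃), cs.wordProd_cons j, ← he, cs.simple_mul_simple_cancel_left]
    have hj' := hj
    rw [← hw, e1] at hj'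
    -- Exchange again, now `j` against `i :: j :: ω₃`. Deleting the first letter makes `w` too
    -- short, deleting the second forces `s_i = s_j`. What remains is `w = s_j s_i s_j ω₄ = s_i s_j
    -- s_i ω₄`, and these two words are linked to the given ones by induction on the tails.
    obtain ⟨l, hl, hel⟩ := exists_eraseIdx_left hM _ hj'
    obtain _ | _ | l := l
    · exfalso
      rw [List.eraseIdx_zero, List.tail_cons, cs.wordProd_cons j, mul_right_inj] at hel
      have := hr.eq
      rw [e1, hel] at this
      have := cs.length_wordProd_le ω₃
      simp at *
      omega
    · exfalso
      simp only [List.eraseIdx_cons_succ, List.eraseIdx_zero, List.tail_cons, cs.wordProd_cons,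
        ← mul_assoc] at hel
      rw [mul_left_inj, ← simple_braid h, mul_assoc, mul_eq_left] at hel
      exact hne (by rw [eq_comm, ← mul_inv_eq_one]; simpa using hel)
    simp only [List.eraseIdx_cons_succ] at hel
    have hl2 : l < ω₃.length := by simpa using hl
    have hlen₄ := List.length_eraseIdx_add_one hl2
    generalize ω₃.eraseIdx l = ω₄ at hel hlen₄
    rw [← e1] at hel
    have e2 : cs.wordProd (i :: j :: ω₄) = cs.wordProd ω₂ := by rw [← hel, hjw]
    have e3 : cs.wordProd (j :: i :: ω₄) = cs.wordProd ω₁ := by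
      have : cs.wordProd (i :: ω₁) = cs.simple j * cs.wordProd (i :: j :: ω₄) := by
        rw [← hel, cs.simple_mul_simple_cancel_left]
      rw [← hiw, this]
      simp only [cs.wordProd_cons, ← mul_assoc]
      rw [mul_assoc (cs.simple i), mul_assoc (cs.simple i), ← simple_braid h]
      simp [mul_assoc]
    have r1 := isReduced_of_eq hr₁ (by simp; omega) e3
    have r2 := isReduced_of_eq hr₂ (by simp; omega) e2
    rw [ih ω₁.length (by omega) ω₁ _ rfl hr₁ r1 e3.symm,
      ih ω₂.length (by omega) ω₂ _ rfl hr₂ r2 e2.symm]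
    simp only [List.map_cons, List.prod_cons, ← mul_assoc]
    rw [h3 i j h]

end matsumoto

/-! ### The longest element of the Weyl group -/

/-- `bring n i ω` is, when it succeeds, a word `ω'` such that the word `i :: ω'` is obtained from
`ω` by braid moves. -/
def bring : ℕ → Fin 7 → List (Fin 7) → Option (List (Fin 7))
  | 0, _, _ => none
  | _ + 1, _, [] => none
  | n + 1, i, j :: ω =>
    if i = j then some ω else
      -- The moves are `j i ω₁ = i j ω₁` for commuting letters and `j i ω₁ = j i j ω₂ = i j i ω₂`
      -- otherwise; the leading `i` is left out of the result. The number `n` is fuel.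
      (bring n i ω).bind fun ω₁ =>
        if CoxeterMatrix.E₇ i j = 2 then some (j :: ω₁)
        else (bring n j ω₁).map fun ω₂ => j :: i :: ω₂

/-- Remove the letters of the second word successively from the front of the first word. -/
def bringAll (ω : List (Fin 7)) : List (Fin 7) → Option (List (Fin 7))
  | [] => some ω
  | i :: τ => (bring 64 i ω).bind fun ω' => bringAll ω' τ

theorem simplyLaced_E₇ : SimplyLaced CoxeterMatrix.E₇ := by
  intro i j
  fin_cases i <;> fin_cases j <;> simp [CoxeterMatrix.E₇]

theorem wordProd_bring {n : ℕ} {i : Fin 7} {ω ω' : List (Fin 7)} (h : bring n i ω = some ω') :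
    coxeter.wordProd ω = coxeter.wordProd (i :: ω') := by
  induction n generalizing i ω ω' with
  | zero => simp [bring] at h
  | succ n ih =>
    cases ω with
    | nil => simp [bring] at h
    | cons j ω =>
      rw [bring] at h
      by_cases hij : i = j
      · simp_all
      rw [if_neg hij] at h
      obtain ⟨ω₁, h1, h2⟩ := Option.bind_eq_some_iff.1 h
      by_cases hM : CoxeterMatrix.E₇ i j = 2
      · rw [if_pos hM, Option.some_inj] at h2
        rw [coxeter.wordProd_cons, ih h1, ← h2]
        simp only [coxeter.wordProd_cons, ← mul_assoc]
        rw [simple_comm hM]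
      · rw [if_neg hM] at h2
        obtain ⟨ω₂, h3, rfl⟩ := Option.map_eq_some_iff.1 h2
        have hM3 : CoxeterMatrix.E₇ i j = 3 := by
          rcases simplyLaced_E₇ i j with h | h | h
          · exact absurd h (CoxeterMatrix.E₇.off_diagonal i j hij)
          · exact absurd h hM
          · exact h
        rw [coxeter.wordProd_cons, ih h1, coxeter.wordProd_cons, ih h3]
        simp only [coxeter.wordProd_cons, ← mul_assoc]
        rw [simple_braid hM3]

theorem wordProd_bringAll {ω τ ω' : List (Fin 7)} (h : bringAll ω τ = some ω') :
    coxeter.wordProd ω = coxeter.wordProd (τ ++ ω') := by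
  induction τ generalizing ω with
  | nil => simp_all [bringAll]
  | cons i τ ih =>
    obtain ⟨ω₁, h1, h2⟩ := Option.bind_eq_some_iff.1 h
    rw [wordProd_bring h1, List.cons_append, coxeter.wordProd_cons, coxeter.wordProd_cons, ih h2]

/-- Braid moves turn the word into its reverse, whose product is the inverse. -/
theorem w0_inv : w0⁻¹ = w0 := by
  have h : bringAll w0Word w0Word.reverse = some [] := by decide +kernel
  have := wordProd_bringAll h
  rw [List.append_nil, coxeter.wordProd_reverse] at this
  exact this.symm

theorem w0_mul_w0 : w0 * w0 = 1 := by
  nth_rw 1 [← w0_inv]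
  exact inv_mul_cancel _

/-- In type `E₇` the longest element acts as `-1`. Concretely, braid moves give `w₀ = s_i ω` and
turn `ω s_i` back into the word of `w₀`, so both products equal `ω`. -/
theorem simple_mul_w0 (i : Fin 7) : coxeter.simple i * w0 = w0 * coxeter.simple i := by
  have h : ∀ i, ((bring 64 i w0Word).bind fun ω => bringAll (ω ++ [i]) w0Word) = some [] := by
    decide +kernel
  obtain ⟨ω, h1, h2⟩ := Option.bind_eq_some_iff.1 (h i)
  have e1 := wordProd_bring h1
  have e2 := wordProd_bringAll h2
  rw [List.append_nil, coxeter.wordProd_append, coxeter.wordProd_singleton] at e2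
  rw [coxeter.wordProd_cons] at e1
  rw [w0, e1, mul_assoc, e2, e1, coxeter.simple_mul_simple_cancel_left]

theorem mul_w0 (w : Weyl) : w * w0 = w0 * w := by
  induction w using coxeter.simple_induction_left with
  | one => simp
  | mul_simple_left w i h => rw [mul_assoc, h, ← mul_assoc, simple_mul_w0, mul_assoc]

/-- If `w₀ = u v`, then centrality and `w₀⁻¹ = w₀` give `u w₀ = v⁻¹`. With truncated subtraction the
number of letters is `k - 1` for `1 ≤ k ≤ 64` and stays `63` beyond, which covers `k = 70`. -/
theorem uGe_mul_w0 (k : ℕ) :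
    uGe k * w0 = coxeter.wordProd (w0Word.reverse.take (63 - (64 - k))) := by
  have h : w0 = uGe k * coxeter.wordProd (w0Word.drop (64 - k)) := by
    rw [uGe, ← coxeter.wordProd_append, List.take_append_drop, w0]
  have h2 : w0Word.reverse.take (63 - (64 - k)) = (w0Word.drop (64 - k)).reverse := by
    have hl : w0Word.length = 63 := by rw [w0Word, List.length_map]; rfl
    generalize w0Word = ω at hl
    rw [List.take_reverse, hl]
    by_cases hk : 64 - k ≤ 63
    · rw [Nat.sub_sub_self hk]
    · rw [List.drop_eq_nil_of_le (by omega), List.drop_eq_nil_of_le (by omega)]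
  rw [h2, coxeter.wordProd_reverse, mul_w0, ← w0_inv, h]
  simp

/-! ### Polynomials with integer coefficients -/

/-- A polynomial as a list of monomials with coefficients. A monomial is a natural number, the
variables being the prime numbers. -/
abbrev Poly : Type := List (ℕ × ℤ)

namespace Poly

/-- Prepend a term unless its coefficient vanishes. -/
def consTerm (m : ℕ) (c : ℤ) (p : Poly) : Poly :=
  match c with
  | .ofNat 0 => p
  | c => (m, c) :: p

/-- Addition, merging lists sorted by monomials. The recursors are used directly to make
evaluation in the kernel fast. -/
def add (p : Poly) : Poly → Poly :=
  List.rec (fun q => q) (fun s p ih q =>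
    List.rec (s :: p) (fun t q ih' =>
      Bool.rec (Bool.rec (consTerm s.1 (s.2 + t.2) (ih q)) (t :: ih') (Nat.blt t.1 s.1))
        (s :: ih (t :: q)) (Nat.blt s.1 t.1)) q) p

/-- Multiplication by a term. -/
def scale (m : ℕ) (c : ℤ) (p : Poly) : Poly :=
  List.rec [] (fun t _ ih => (m * t.1, c * t.2) :: ih) p

/-- Add up the polynomials of a list in pairs. -/
def addPairs : List Poly → List Poly
  | p :: q :: l => add p q :: addPairs l
  | l => l

/-- The sum of a list of polynomials, after `n` rounds of addition in pairs. -/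
def sum : ℕ → List Poly → Poly
  | 0, l => l.foldr add []
  | n + 1, l => sum n (addPairs l)

/-- Ten rounds of pairwise addition only balance the merges; the value is the same for any number.
Scaling by a positive monomial keeps a sorted list sorted, so equal polynomials are expected to come
out as equal lists. -/
def mul (p q : Poly) : Poly := sum 10 (p.map fun t => scale t.1 t.2 q)

def neg (p : Poly) : Poly := scale 1 (-1) p

def sub (p q : Poly) : Poly := add p (neg q)

/-- The value of a polynomial under a multiplicative map giving the values of the monomials. -/
def eval (μ : ℕ →* ℂ) (p : Poly) : ℂ := (p.map fun t => (t.2 : ℂ) * μ t.1).sum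

variable (μ : ℕ →* ℂ)

@[simp] theorem eval_nil : eval μ [] = 0 := rfl

@[simp] theorem eval_cons (t : ℕ × ℤ) (p : Poly) :
    eval μ (t :: p) = t.2 * μ t.1 + eval μ p := by simp [eval]

theorem eval_consTerm (m : ℕ) (c : ℤ) (p : Poly) :
    eval μ (consTerm m c p) = c * μ m + eval μ p := by
  unfold consTerm
  split <;> simp

theorem add_cons_cons (s t : ℕ × ℤ) (p q : Poly) :
    add (s :: p) (t :: q) =
      if s.1 < t.1 then s :: add p (t :: q)
      else if t.1 < s.1 then t :: add (s :: p) q else consTerm s.1 (s.2 + t.2) (add p q) := by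
  change (Bool.rec (motive := fun _ => Poly) (Bool.rec (motive := fun _ => Poly)
    (consTerm s.1 (s.2 + t.2) (add p q)) (t :: add (s :: p) q) (Nat.blt t.1 s.1))
    (s :: add p (t :: q)) (Nat.blt s.1 t.1)) = _
  cases h1 : Nat.blt s.1 t.1 <;> cases h2 : Nat.blt t.1 s.1 <;>
    simp only [Bool.eq_false_iff, ne_eq, Nat.blt_eq] at h1 h2 <;> simp [h1, h2]

@[simp] theorem eval_add (p q : Poly) : eval μ (add p q) = eval μ p + eval μ q := by
  induction p generalizing q with
  | nil => exact (zero_add _).symm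
  | cons s p ih =>
    induction q with
    | nil => exact (add_zero _).symm
    | cons t q ih' =>
      rw [add_cons_cons]
      split_ifs with h1 h2
      · rw [eval_cons, ih, eval_cons, eval_cons]; ring
      · rw [eval_cons, ih', eval_cons, eval_cons]; ring
      · rw [eval_consTerm, ih, eval_cons, eval_cons, le_antisymm (not_lt.1 h2) (not_lt.1 h1)]
        push_cast
        ring

@[simp] theorem eval_scale (m : ℕ) (c : ℤ) (p : Poly) :
    eval μ (scale m c p) = c * μ m * eval μ p := by
  induction p with
  | nil => simp [scale]
  | cons t p ih =>
    change eval μ ((m * t.1, c * t.2) :: scale m c p) = _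
    rw [eval_cons, ih, eval_cons, map_mul]
    push_cast
    ring

theorem eval_addPairs : ∀ l : List Poly,
    ((addPairs l).map (eval μ)).sum = (l.map (eval μ)).sum
  | [] => rfl
  | [_] => rfl
  | p :: q :: l => by
    rw [addPairs, List.map_cons, List.sum_cons, eval_addPairs l, eval_add, List.map_cons,
      List.sum_cons, List.map_cons, List.sum_cons, add_assoc]

theorem eval_sum (n : ℕ) (l : List Poly) : eval μ (sum n l) = (l.map (eval μ)).sum := by
  induction n generalizing l with
  | zero =>
    rw [sum]
    induction l with
    | nil => simp
    | cons p l ih => rw [List.foldr_cons, eval_add, ih, List.map_cons, List.sum_cons]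
  | succ n ih => rw [sum, ih, eval_addPairs]

@[simp] theorem eval_mul (p q : Poly) : eval μ (mul p q) = eval μ p * eval μ q := by
  rw [mul, eval_sum, List.map_map]
  induction p with
  | nil => simp
  | cons t p ih =>
    rw [List.map_cons, List.sum_cons, ih, Function.comp_apply, eval_scale, eval_cons]
    ring

@[simp] theorem eval_neg (p : Poly) : eval μ (neg p) = -eval μ p := by simp [neg]

@[simp] theorem eval_sub (p q : Poly) : eval μ (sub p q) = eval μ p - eval μ q := by
  rw [sub, eval_add, eval_neg, sub_eq_add_neg]

/-- The variables. -/
def var (k : ℕ) : ℕ :=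
  [1, 2, 3, 5, 7, 11, 13, 17, 19, 23, 29, 31, 37, 41, 43, 47, 53, 59, 61, 67, 71, 73, 79, 83, 89,
    97, 101, 103].getD k 1

/-- Arbitrary values can be assigned to the variables. -/
theorem exists_eval_var (a : ℕ → ℂ) :
    ∃ μ : ℕ →* ℂ, ∀ k, 1 ≤ k → k ≤ 27 → μ (var k) = a k := by
  have hp : ∀ k : Fin 27, (var (k + 1)).Prime := by
    intro k; fin_cases k <;> norm_num [var]
  have hinj : ∀ j k : Fin 27, var (j + 1) = var (k + 1) → j = k := by decide
  -- The map sends `m` to the product of the `a_k` raised to the multiplicities of the corresponding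
  -- primes in `m`. Zero is sent to zero separately, since its factorization is empty.
  refine ⟨{
    toFun := fun m => if m = 0 then 0 else ∏ k : Fin 27, a (k + 1) ^ m.factorization (var (k + 1))
    map_one' := by simp
    map_mul' := fun m n => by
      by_cases hm : m = 0
      · simp [hm]
      by_cases hn : n = 0
      · simp [hn]
      simp [hm, hn, Nat.factorization_mul hm hn, pow_add, Finset.prod_mul_distrib] }, ?_⟩
  intro k h1 h2
  obtain ⟨k, rfl⟩ : ∃ j : Fin 27, k = j + 1 := ⟨⟨k - 1, by omega⟩, by simp; omega⟩
  change (if var (k + 1) = 0 then 0 else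
    ∏ j : Fin 27, a (j + 1) ^ (var (k + 1)).factorization (var (j + 1))) = _
  rw [if_neg (hp k).ne_zero, Finset.prod_eq_single k]
  · simp [(hp k).factorization]
  · intro j _ hj
    rw [(hp k).factorization, Finsupp.single_eq_of_ne, pow_zero]
    exact fun h => hj (hinj _ _ h)
  · simp

end Poly

/-! ### Row vectors with polynomial entries -/

/-- The row vector of the coordinate of `v_c`. -/
def rowUnit (c : PIdx) : PIdx → Poly := fun b => if b = c then [(1, 1)] else []

/-- The product of a row vector with `1 + a_k T`, where `T` maps the basis by the partial map
`t`. -/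
def rowStep (t : PIdx → Option PIdx) (k : ℕ) (R : PIdx → Poly) : PIdx → Poly :=
  fun b => (t b).elim (R b) fun b' => (R b).add ((R b').scale (Poly.var k) 1)

/-- The row of `x_{r s}(a_s) ⋯ x_{r 27}(a_{27})` indexed by `c`. -/
def rowX (s : ℕ) (c : PIdx) : PIdx → Poly :=
  (List.range' s (28 - s)).foldl (fun R k => rowStep (raise (r k)) k R) (rowUnit c)

/-- The Plücker coordinates of `y_{r 27}(a_{27}) ⋯ y_{r 1}(a_1)`. -/
def pluckerPoly : PIdx → Poly :=
  (List.range' 1 27).foldr (fun k R => rowStep (lower (r k)) k R) (rowUnit .v0)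

/-! ### The combinatorial data of the fundamental representations -/

/-- `sbar i` maps `v_a` to `± v_b`: the label `b` and the sign. -/
def stepIdx (i : Fin 7) (a : PIdx) : PIdx × ℤ :=
  match lower i a with
  | some b => (b, 1)
  | none =>
    match raise i a with
    | some b => (b, -1)
    | none => (a, 1)

/-- The product of the `sbar i` along a word maps `v_a` to `± v_b`: the label `b` and the sign. -/
def wordIdx (ω : List (Fin 7)) (a : PIdx) : PIdx × ℤ :=
  ω.foldr (fun i q => ((stepIdx i q.1).1, (stepIdx i q.1).2 * q.2)) (a, 1)

/-- A linear combination of tensors of basis vectors of the minuscule module. -/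
abbrev FormalTensor : Type := List (ℤ × List PIdx)

/-- The antisymmetrization of `v_{a_1} ⊗ ⋯ ⊗ v_{a_n}`. -/
def wedge : List PIdx → FormalTensor
  | [] => [(1, [])]
  | a :: l => (wedge l).flatMap fun t =>
      (List.range (t.2.length + 1)).map fun n => ((-1) ^ n * t.1, t.2.insertIdx n a)

/-- The action on a linear combination of tensors of a Lie algebra element mapping the basis
vectors by the partial map `t`. -/
def derive (t : PIdx → Option PIdx) : List PIdx → List (List PIdx)
  | [] => []
  | a :: l => (t a).elim [] (fun b => [b :: l]) ++ (derive t l).map (a :: ·)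

def deriveTensor (t : PIdx → Option PIdx) (v : FormalTensor) : FormalTensor :=
  v.flatMap fun s => (derive t s.2).map fun l => (s.1, l)

def tensorMul (v w : FormalTensor) : FormalTensor :=
  v.flatMap fun s => w.map fun t => (s.1 * t.1, s.2 ++ t.2)

def tensorSmul (c : ℤ) (v : FormalTensor) : FormalTensor := v.map fun t => (c * t.1, t.2)

/-- The highest weight vector of the adjoint representation in the symmetric square of the
minuscule module. -/
def adjointTop : FormalTensor :=
  [(1, [.v27, .v17]), (-1, [.v26, .v18]), (1, [.v25, .v19']), (-1, [.v24, .v20']),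
   (1, [.v23, .v21']), (-1, [.v22', .v22'']), (-1, [.v22'', .v22']), (1, [.v21', .v23]),
   (-1, [.v20', .v24]), (1, [.v19', .v25]), (-1, [.v18, .v26]), (1, [.v17, .v27])]

/-- The highest weight vector of weight `ω₂` in the third tensor power of the minuscule module:
the alternating sum of the tensors of the `v_a` along the path `1, 3, 4, 5, 6, 7` with the
vectors obtained by lowering the highest weight vector of the adjoint representation. -/
def omega2Top : List (Fin 7) → List PIdx → ℤ → FormalTensor → FormalTensor
  | _, [], _, _ => []
  | [], a :: _, c, v => tensorMul [(c, [a])] v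
  | i :: ω, a :: l, c, v =>
    tensorMul [(c, [a])] v ++ omega2Top ω l (-c) (deriveTensor (lower i) v)

/-- Highest weight vectors of the fundamental representations in tensor powers of the minuscule
module. -/
def topTensor : Fin 7 → FormalTensor :=
  ![adjointTop,
    omega2Top [0, 2, 3, 4, 5, 6] [.v21'', .v22'', .v23, .v24, .v25, .v26, .v27] 1 adjointTop,
    tensorMul adjointTop (deriveTensor (lower 0) adjointTop) ++
      tensorSmul (-1) (tensorMul (deriveTensor (lower 0) adjointTop) adjointTop),
    wedge [.v27, .v26, .v25, .v24],
    wedge [.v27, .v26, .v25],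
    wedge [.v27, .v26],
    [(1, [.v27])]]

/-- A tensor of basis vectors occurring in the highest weight vector. -/
def topCoord : Fin 7 → List PIdx :=
  ![[.v27, .v17], [.v27, .v12'', .v26], [.v27, .v17, .v27, .v16], [.v27, .v26, .v25, .v24],
    [.v27, .v26, .v25], [.v27, .v26], [.v27]]

/-- The first position at which the label `i` occurs in the word of the longest element. -/
def firstPos : Fin 7 → ℕ := ![10, 6, 5, 4, 3, 2, 1]

/-- The value of a product of row vectors on a tensor of translated basis vectors. -/
def termPoly (ω : List (Fin 7)) : List (PIdx → Poly) → List PIdx → Poly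
  | [], [] => [(1, 1)]
  | R :: Rs, a :: l =>
    ((R (wordIdx ω a).1).scale 1 (wordIdx ω a).2).mul (termPoly ω Rs l)
  | _, _ => []

/-- The generalized minor on the torus as a polynomial. -/
def minorPoly (i : Fin 7) (k : ℕ) : Poly :=
  Poly.sum 10 ((topTensor i).map fun t => (termPoly (w0Word.reverse.take (63 - (64 - k)))
    ((topCoord i).map (rowX (firstPos i))) t.2).scale 1 t.1)

/-! ### Highest weight vectors -/

section cyclic
variable {M : Type*} [AddCommGroup M] [Module ℂ M]

/-- The result of applying a word of operators to a vector. -/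
def lowerWord (f : Fin 7 → Module.End ℂ M) (l : List (Fin 7)) (w : M) : M :=
  l.foldr (fun j m => f j m) w

/-- The span of the results of applying words of operators of a given length. -/
def lengthSpan (f : Fin 7 → Module.End ℂ M) (w : M) (n : ℕ) : Submodule ℂ M :=
  Submodule.span ℂ {m | ∃ l : List (Fin 7), l.length = n ∧ m = lowerWord f l w}

/-- The span of the results of applying words of operators. -/
def cyclicSpan (f : Fin 7 → Module.End ℂ M) (w : M) : Submodule ℂ M :=
  Submodule.span ℂ (Set.range fun l => lowerWord f l w)

theorem lengthSpan_le (f : Fin 7 → Module.End ℂ M) (w : M) (n : ℕ) :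
    lengthSpan f w n ≤ cyclicSpan f w :=
  Submodule.span_mono fun _ ⟨l, _, hl⟩ => ⟨l, hl.symm⟩

theorem mem_cyclicSpan (f : Fin 7 → Module.End ℂ M) (w : M) : w ∈ cyclicSpan f w :=
  Submodule.subset_span ⟨[], rfl⟩

theorem map_cyclicSpan {f : Fin 7 → Module.End ℂ M} {w : M} {X : Module.End ℂ M}
    {S : Submodule ℂ M} (h : ∀ l, X (lowerWord f l w) ∈ S) {m : M} (hm : m ∈ cyclicSpan f w) :
    X m ∈ S := by
  have : cyclicSpan f w ≤ S.comap X := Submodule.span_le.2 (by rintro _ ⟨l, rfl⟩; exact h l)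
  exact this hm

/-- Operators `h_i, e_i, f_i` with a vector annihilated by the `e_i` and of weight `wt` for the
`h_i`, satisfying the relations that determine the action of `e_i` and `h_i` on the vectors
obtained by applying the `f_i`. -/
structure TopVector (h e f : Fin 7 → Module.End ℂ M) (wt : Fin 7 → ℂ) (w : M) : Prop where
  ef : ∀ i j m, e i (f j m) = f j (e i m) + if i = j then h i m else 0
  hf : ∀ i j m, h i (f j m) = f j (h i m) - (CartanMatrix.E₇ i j : ℂ) • f j m
  e_top : ∀ i, e i w = 0
  h_top : ∀ i, h i w = wt i • w

variable {h e f : Fin 7 → Module.End ℂ M} {wt : Fin 7 → ℂ} {w : M}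

theorem TopVector.h_lowerWord (T : TopVector h e f wt w) (i : Fin 7) (l : List (Fin 7)) :
    h i (lowerWord f l w) =
      (wt i - ((l.map fun j => CartanMatrix.E₇ i j).sum : ℤ)) • lowerWord f l w := by
  induction l with
  | nil => simp [lowerWord, T.h_top]
  | cons j l ih =>
    change h i (f j (lowerWord f l w)) = _ • f j (lowerWord f l w)
    rw [T.hf, ih, map_smul, ← sub_smul, List.map_cons, List.sum_cons]
    congr 1
    push_cast
    ring

theorem f_mem_lengthSpan (j : Fin 7) {m : M} {n : ℕ} (hm : m ∈ lengthSpan f w n) :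
    f j m ∈ lengthSpan f w (n + 1) := by
  have : lengthSpan f w n ≤ (lengthSpan f w (n + 1)).comap (f j) :=
    Submodule.span_le.2 (by
      rintro _ ⟨l, hl, rfl⟩
      exact Submodule.subset_span ⟨j :: l, by simp [hl], rfl⟩)
  exact this hm

/-- Moving `e_i` to the right through the `f_j` leaves only terms in which one letter has been
replaced by the scalar of some `h_i`. -/
theorem TopVector.e_lowerWord (T : TopVector h e f wt w) (i j : Fin 7) (l : List (Fin 7)) :
    e i (lowerWord f (j :: l) w) ∈ lengthSpan f w l.length := by
  induction l generalizing j with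
  | nil =>
    change e i (f j w) ∈ _
    rw [T.ef, T.e_top, map_zero, zero_add]
    split_ifs
    · rw [T.h_top]
      exact Submodule.smul_mem _ _ (Submodule.subset_span ⟨[], rfl, rfl⟩)
    · exact zero_mem _
  | cons k l ih =>
    change e i (f j (lowerWord f (k :: l) w)) ∈ _
    rw [T.ef]
    refine add_mem (f_mem_lengthSpan j (ih k)) ?_
    split_ifs
    · rw [T.h_lowerWord]
      exact Submodule.smul_mem _ _ (Submodule.subset_span ⟨_, rfl, rfl⟩)
    · exact zero_mem _

theorem TopVector.e_mem (T : TopVector h e f wt w) (i : Fin 7) {m : M}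
    (hm : m ∈ cyclicSpan f w) : e i m ∈ cyclicSpan f w := by
  refine map_cyclicSpan (fun l => ?_) hm
  cases l with
  | nil => exact (T.e_top i).symm ▸ zero_mem _
  | cons j l => exact lengthSpan_le _ _ _ (T.e_lowerWord i j l)

theorem f_mem (j : Fin 7) {m : M} (hm : m ∈ cyclicSpan f w) : f j m ∈ cyclicSpan f w := by
  refine map_cyclicSpan (fun l => ?_) hm
  exact Submodule.subset_span ⟨j :: l, rfl⟩

/-- A nonempty sum of simple roots is not zero. -/
theorem exists_cartan_sum_ne_zero (l : List (Fin 7)) (hl : l ≠ []) :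
    ∃ i, (l.map fun j => CartanMatrix.E₇ i j).sum ≠ 0 := by
  by_contra! hn
  -- These are the coefficients of `2ρ^∨`, the sum of the positive coroots, in the simple coroots.
  -- It pairs to `2` with every simple root, hence to twice the length with the sum over `l`.
  let c : Fin 7 → ℤ := ![34, 49, 66, 96, 75, 52, 27]
  have h1 : ∀ j, ∑ i, c i * CartanMatrix.E₇ i j = 2 := by decide
  have h2 : ∀ l : List (Fin 7),
      ∑ i, c i * (l.map fun j => CartanMatrix.E₇ i j).sum = 2 * l.length := by
    intro l
    induction l with
    | nil => simp
    | cons j l ih =>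
      simp only [List.map_cons, List.sum_cons, mul_add, Finset.sum_add_distrib, ih, h1,
        List.length_cons]
      push_cast
      ring
  have h3 := h2 l
  simp only [hn, mul_zero, Finset.sum_const_zero] at h3
  have : l.length ≠ 0 := by simpa using hl
  omega

/-- Lowering changes the eigenvalue of some `h_i`, and a functional of weight `wt` kills
eigenvectors with a different eigenvalue. -/
theorem TopVector.functional_lowerWord (T : TopVector h e f wt w) (ψ : M →ₗ[ℂ] ℂ)
    (hψ : ∀ i m, ψ (h i m) = wt i * ψ m) {l : List (Fin 7)} (hl : l ≠ []) :
    ψ (lowerWord f l w) = 0 := by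
  obtain ⟨i, hi⟩ := exists_cartan_sum_ne_zero l hl
  have h1 := hψ i (lowerWord f l w)
  rw [T.h_lowerWord, map_smul, smul_eq_mul, sub_mul, sub_eq_self] at h1
  exact (mul_eq_zero.1 h1).resolve_left (by exact_mod_cast hi)

/-- From words of length at least two, `e_i` produces combinations of nonempty words, which `ψ`
kills. From a single letter only `h_i w = wt i • w = 0` can survive. -/
theorem TopVector.functional_e (T : TopVector h e f wt w) (ψ : M →ₗ[ℂ] ℂ)
    (hψ : ∀ i m, ψ (h i m) = wt i * ψ m) {i : Fin 7} (hi : wt i = 0) {m : M}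
    (hm : m ∈ cyclicSpan f w) : ψ (e i m) = 0 := by
  suffices e i m ∈ LinearMap.ker ψ from this
  refine map_cyclicSpan (fun l => ?_) hm
  rw [LinearMap.mem_ker]
  obtain _ | ⟨j, l⟩ := l
  · exact (congrArg ψ (T.e_top i)).trans (map_zero ψ)
  by_cases hl : l = []
  · subst hl
    change ψ (e i (f j w)) = 0
    rw [T.ef, T.e_top, map_zero, zero_add]
    split_ifs
    · rw [T.h_top, hi, zero_smul, map_zero]
    · exact map_zero ψ
  · have : lengthSpan f w l.length ≤ LinearMap.ker ψ := Submodule.span_le.2 (by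
      rintro _ ⟨l', hl', rfl⟩
      refine T.functional_lowerWord ψ hψ ?_
      rintro rfl
      exact hl (List.length_eq_zero_iff.1 hl'.symm))
    exact this (T.e_lowerWord i j l)

end cyclic

/-! ### Exponentials and invariant subspaces -/

section nexp
variable {M N : Type*} [AddCommGroup M] [Module ℂ M] [AddCommGroup N] [Module ℂ N]

/-- A common exponent beyond which both powers vanish makes the pair of exponentials a single
polynomial in the operator `(X, Y)`. -/
theorem nexp_prod_mem {X : Module.End ℂ M} {Y : Module.End ℂ N} (hX : IsNilpotent X)
    (hY : IsNilpotent Y) {S : Submodule ℂ (M × N)} (h : ∀ q ∈ S, (X q.1, Y q.2) ∈ S)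
    {q : M × N} (hq : q ∈ S) : (nexp X q.1, nexp Y q.2) ∈ S := by
  obtain ⟨k, hk⟩ := hX
  obtain ⟨l, hl⟩ := hY
  have hk' : X ^ (k + l) = 0 := pow_eq_zero_of_le (by omega) hk
  have hl' : Y ^ (k + l) = 0 := pow_eq_zero_of_le (by omega) hl
  have hpow : ∀ n : ℕ, ((X ^ n) q.1, (Y ^ n) q.2) ∈ S := fun n => by
    induction n with
    | zero => exact hq
    | succ n ih => rw [pow_succ', pow_succ']; exact h _ ih
  have hsum : (nexp X q.1, nexp Y q.2) =
      ∑ n ∈ Finset.range (k + l), ((n.factorial : ℂ)⁻¹) • ((X ^ n) q.1, (Y ^ n) q.2) := by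
    rw [nexp_eq_sum hk', nexp_eq_sum hl']
    refine Prod.ext ?_ ?_
    · simp [LinearMap.sum_apply, Prod.fst_sum]
    · simp [LinearMap.sum_apply, Prod.snd_sum]
  rw [hsum]
  exact sum_mem fun n _ => S.smul_mem _ (hpow n)

theorem functional_nexp {X : Module.End ℂ M} (hX : IsNilpotent X) {S : Submodule ℂ M}
    (hS : ∀ m ∈ S, X m ∈ S) (ψ : M →ₗ[ℂ] ℂ) (hψ : ∀ m ∈ S, ψ (X m) = 0) {m : M} (hm : m ∈ S) :
    ψ (nexp X m) = ψ m := by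
  obtain ⟨k, hk⟩ := hX
  have hk' : X ^ (k + 1) = 0 := pow_eq_zero_of_le (by omega) hk
  have hpow : ∀ n : ℕ, (X ^ n) m ∈ S := fun n => by
    induction n with
    | zero => exact hm
    | succ n ih => rw [pow_succ']; exact hS _ ih
  rw [nexp_eq_sum hk', Finset.sum_range_succ', LinearMap.add_apply, map_add, LinearMap.sum_apply,
    map_sum, Finset.sum_eq_zero]
  · simp
  · intro n _
    rw [LinearMap.smul_apply, map_smul, pow_succ', Module.End.mul_apply, hψ _ (hpow n), smul_zero]

end nexp

/-! ### Comparison of the highest weight coefficients in different modules -/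

section comparison
variable (M : Type) [AddCommGroup M] [Module ℂ M] [LieRingModule Alg M] [LieModule ℂ Alg M]
variable (N : Type) [AddCommGroup N] [Module ℂ N] [LieRingModule Alg N] [LieModule ℂ Alg N]

/-- The action of a Lie algebra element on a pair of modules. -/
def pairEnd (X : Alg) : Module.End ℂ (M × N) :=
  (LieModule.toEnd ℂ Alg M X).prodMap (LieModule.toEnd ℂ Alg N X)

variable {M N}

/-- A vector annihilated by the `e_i` of weight `wt`. -/
structure IsTop (wt : Fin 7 → ℂ) (m : M) : Prop where
  e_top : ∀ i, ⁅chevE i, m⁆ = 0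
  h_top : ∀ i, ⁅chevH i, m⁆ = wt i • m

theorem lie_chevE_chevF_apply {K : Type} [AddCommGroup K] [LieRingModule Alg K] (i j : Fin 7)
    (m : K) :
    ⁅chevE i, ⁅chevF j, m⁆⁆ = ⁅chevF j, ⁅chevE i, m⁆⁆ + if i = j then ⁅chevH i, m⁆ else 0 := by
  rw [leibniz_lie, lie_chevE_chevF, add_comm]
  split_ifs <;> simp

theorem lie_chevH_chevF_apply (i j : Fin 7) (m : M) :
    ⁅chevH i, ⁅chevF j, m⁆⁆ =
      ⁅chevF j, ⁅chevH i, m⁆⁆ - (CartanMatrix.E₇ i j : ℂ) • ⁅chevF j, m⁆ := by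
  rw [leibniz_lie, lie_chevH_chevF, neg_lie, ← Int.cast_smul_eq_zsmul ℂ, smul_lie]
  abel

theorem IsTop.topVector {wt : Fin 7 → ℂ} {m : M} (hm : IsTop wt m) :
    TopVector (fun i => LieModule.toEnd ℂ Alg M (chevH i))
      (fun i => LieModule.toEnd ℂ Alg M (chevE i)) (fun i => LieModule.toEnd ℂ Alg M (chevF i))
      wt m where
  ef := lie_chevE_chevF_apply
  hf := lie_chevH_chevF_apply
  e_top := hm.e_top
  h_top := hm.h_top

theorem IsTop.topVector_pair {wt : Fin 7 → ℂ} {m : M} {n : N} (hm : IsTop wt m)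
    (hn : IsTop wt n) :
    TopVector (fun i => pairEnd M N (chevH i)) (fun i => pairEnd M N (chevE i))
      (fun i => pairEnd M N (chevF i)) wt (m, n) where
  ef i j q := by
    refine Prod.ext ((lie_chevE_chevF_apply i j q.1).trans ?_)
      ((lie_chevE_chevF_apply i j q.2).trans ?_) <;> split_ifs <;> rfl
  hf i j q := Prod.ext (lie_chevH_chevF_apply i j q.1) (lie_chevH_chevF_apply i j q.2)
  e_top i := Prod.ext (hm.e_top i) (hn.e_top i)
  h_top i := Prod.ext (hm.h_top i) (hn.h_top i)

theorem lowerWord_pair (l : List (Fin 7)) (m : M) (n : N) :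
    lowerWord (fun i => pairEnd M N (chevF i)) l (m, n) =
      (lowerWord (fun i => LieModule.toEnd ℂ Alg M (chevF i)) l m,
        lowerWord (fun i => LieModule.toEnd ℂ Alg N (chevF i)) l n) := by
  induction l with
  | nil => rfl
  | cons j l ih =>
    change pairEnd M N (chevF j) (lowerWord _ l (m, n)) = _
    rw [ih]
    rfl

variable [FiniteDimensional ℂ M] [FiniteDimensional ℂ N]

theorem act_pair_mem {S : Submodule ℂ (M × N)} (hE : ∀ i, ∀ q ∈ S, pairEnd M N (chevE i) q ∈ S)
    (hF : ∀ i, ∀ q ∈ S, pairEnd M N (chevF i) q ∈ S) (g : Grp) :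
    ∀ q ∈ S, ((act M g : Module.End ℂ M) q.1, (act N g : Module.End ℂ N) q.2) ∈ S := by
  obtain ⟨g, rfl⟩ := QuotientGroup.mk_surjective g
  change ∀ q ∈ S, ((wordAct M g : Module.End ℂ M) q.1, (wordAct N g : Module.End ℂ N) q.2) ∈ S
  induction g using FreeGroup.induction_on with
  | C1 => exact fun q hq => hq
  | of g =>
    intro q hq
    rw [wordAct, wordAct, FreeGroup.lift_apply_of, FreeGroup.lift_apply_of]
    cases g with
    | x i a =>
      exact nexp_prod_mem (isNilpotent_chevE M i a) (isNilpotent_chevE N i a)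
        (fun q hq => S.smul_mem a (hE i q hq)) hq
    | y i a =>
      exact nexp_prod_mem (isNilpotent_chevF M i a) (isNilpotent_chevF N i a)
        (fun q hq => S.smul_mem a (hF i q hq)) hq
  | inv_of g _ =>
    intro q hq
    rw [map_inv, map_inv, wordAct, wordAct, FreeGroup.lift_apply_of, FreeGroup.lift_apply_of]
    cases g with
    | x i a =>
      exact nexp_prod_mem (isNilpotent_chevE M i a).neg (isNilpotent_chevE N i a).neg
        (fun q hq => S.neg_mem (S.smul_mem a (hE i q hq))) hq
    | y i a =>
      exact nexp_prod_mem (isNilpotent_chevF M i a).neg (isNilpotent_chevF N i a).neg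
        (fun q hq => S.neg_mem (S.smul_mem a (hF i q hq))) hq
  | mul g g' h h' =>
    intro q hq
    rw [map_mul, map_mul]
    exact h _ (h' _ hq)

/-- The sum of the weight spaces of weights different from `wt`. -/
def otherWeights (M : Type) [AddCommGroup M] [Module ℂ M] [LieRingModule Alg M]
    [LieModule ℂ Alg M] (wt : Fin 7 → ℂ) : Submodule ℂ M :=
  ⨆ μ ∈ {μ : Fin 7 → ℂ | μ ≠ wt}, wtSpace M μ

/-- The `h_i` commute, so their joint generalized eigenspaces are independent, and the weight spaces
lie inside these. -/
theorem disjoint_otherWeights (M : Type) [AddCommGroup M] [Module ℂ M] [LieRingModule Alg M]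
    [LieModule ℂ Alg M] (wt : Fin 7 → ℂ) : Disjoint (wtSpace M wt) (otherWeights M wt) := by
  have h := Module.End.independent_iInf_maxGenEigenspace_of_forall_mapsTo
    (fun i => LieModule.toEnd ℂ Alg M (chevH i)) (fun i j φ => by
      refine Module.End.mapsTo_maxGenEigenspace_of_comm ?_ φ
      refine LinearMap.ext fun m => ?_
      change ⁅chevH _, ⁅chevH _, m⁆⁆ = ⁅chevH _, ⁅chevH _, m⁆⁆
      rw [leibniz_lie, lie_chevH_chevH, zero_lie, zero_add])
  exact (h.mono fun μ => iInf_mono fun i => Module.End.eigenspace_le_maxGenEigenspace) wt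

/-- Two admissible coefficients differ by a scalar whose multiple of `v⁺` lies both in the highest
weight space and in the sum of the other weight spaces, hence vanishes. -/
theorem hwCoeff_eq {i : Fin 7} (V : FundamentalRep i) {m : V.M} {c : ℂ}
    (h : m - c • V.v ∈ otherWeights V.M (Pi.single i 1)) : hwCoeff V m = c := by
  have hex : ∃ c : ℂ, m - c • V.v ∈ ⨆ μ ∈ {μ : Fin 7 → ℂ | μ ≠ Pi.single i 1}, wtSpace V.M μ :=
    ⟨c, h⟩
  rw [hwCoeff, dif_pos hex]
  have h1 := hex.choose_spec
  set d := hex.choose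
  have hv : V.v ∈ wtSpace V.M (Pi.single i 1) := by
    refine (Submodule.mem_iInf _).2 fun j => Module.End.mem_eigenspace_iff.2 ?_
    rw [Pi.single_apply]
    exact V.chevH_v j
  have h2 : (d - c) • V.v ∈ otherWeights V.M (Pi.single i 1) := by
    have := sub_mem h h1
    rwa [sub_sub_sub_cancel_left, ← sub_smul] at this
  have h3 := (Submodule.disjoint_def.1 (disjoint_otherWeights V.M _)) _
    (Submodule.smul_mem _ _ hv) h2
  exact sub_eq_zero.1 ((smul_eq_zero.1 h3).resolve_right V.v_ne_zero)

theorem FundamentalRep.isTop {i : Fin 7} (V : FundamentalRep i) :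
    IsTop (Pi.single i 1) V.v where
  e_top := V.chevE_v
  h_top j := by rw [Pi.single_apply]; exact V.chevH_v j

/-- The coefficient of the highest weight vector in the fundamental representation can be computed
in any module with a vector of the same highest weight. -/
theorem hwCoeff_act {i : Fin 7} (V : FundamentalRep i) {n : N} (hn : IsTop (Pi.single i 1) n)
    (ψ : N →ₗ[ℂ] ℂ) (hψ : ∀ j m, ψ ⁅chevH j, m⁆ = (Pi.single i 1 : Fin 7 → ℂ) j * ψ m)
    (hψn : ψ n = 1) (g : Grp) :
    hwCoeff V ((act V.M g : Module.End ℂ V.M) V.v) = ψ ((act N g : Module.End ℂ N) n) := by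
  refine hwCoeff_eq V ?_
  have T := V.isTop.topVector_pair hn
  have hmem := act_pair_mem (fun i _ hq => T.e_mem i hq) (fun i _ hq => f_mem i hq) g _
    (mem_cyclicSpan (fun i => pairEnd V.M N (chevF i)) (V.v, n))
  -- At `(g v, g n)`, `D` takes the value that must have no highest weight component. It vanishes on
  -- the generator `(v, n)`. After a nonempty lowering `ψ` gives zero and the first component has
  -- another weight.
  let D : V.M × N →ₗ[ℂ] V.M :=
    LinearMap.fst ℂ V.M N - (ψ ∘ₗ LinearMap.snd ℂ V.M N).smulRight V.v
  have hle : cyclicSpan (fun i => pairEnd V.M N (chevF i)) (V.v, n) ≤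
      (otherWeights V.M (Pi.single i 1)).comap D := by
    refine Submodule.span_le.2 ?_
    rintro _ ⟨l, rfl⟩
    change lowerWord _ l (V.v, n) ∈ (otherWeights V.M (Pi.single i 1)).comap D
    rw [lowerWord_pair, Submodule.mem_comap]
    change _ - ψ (lowerWord _ l n) • V.v ∈ _
    by_cases hl : l = []
    · subst hl
      change V.v - ψ n • V.v ∈ _
      rw [hψn, one_smul, sub_self]
      exact zero_mem _
    · rw [hn.topVector.functional_lowerWord ψ hψ hl, zero_smul, sub_zero]
      obtain ⟨j, hj⟩ := exists_cartan_sum_ne_zero l hl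
      refine Submodule.mem_iSup_of_mem (fun j => (Pi.single i 1 : Fin 7 → ℂ) j -
        ((l.map fun k => CartanMatrix.E₇ j k).sum : ℤ)) (Submodule.mem_iSup_of_mem ?_ ?_)
      · intro h
        have := congrFun h j
        simp only [sub_eq_self] at this
        exact hj (by exact_mod_cast this)
      · exact (Submodule.mem_iInf _).2 fun j =>
          Module.End.mem_eigenspace_iff.2 (V.isTop.topVector.h_lowerWord j l)
  exact hle hmem

theorem act_mem_cyclicSpan {wt : Fin 7 → ℂ} {n : N} (hn : IsTop wt n) (g : Grp) {m : N}
    (hm : m ∈ cyclicSpan (fun i => LieModule.toEnd ℂ Alg N (chevF i)) n) :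
    (act N g : Module.End ℂ N) m ∈ cyclicSpan (fun i => LieModule.toEnd ℂ Alg N (chevF i)) n :=
  act_pair_mem (M := N) (N := N)
    (S := (cyclicSpan (fun i => LieModule.toEnd ℂ Alg N (chevF i)) n).comap
      (LinearMap.fst ℂ N N))
    (fun i _ hq => hn.topVector.e_mem i hq) (fun i _ hq => f_mem i hq) g (m, m) hm

theorem coe_act_x (i : Fin 7) (a : ℂ) :
    (act N (x i a) : Module.End ℂ N) = nexp (a • LieModule.toEnd ℂ Alg N (chevE i)) := by
  change (wordAct N (.of (.x i a)) : Module.End ℂ N) = _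
  rw [wordAct, FreeGroup.lift_apply_of]
  rfl

theorem coe_act_y (i : Fin 7) (a : ℂ) :
    (act N (y i a) : Module.End ℂ N) = nexp (a • LieModule.toEnd ℂ Alg N (chevF i)) := by
  change (wordAct N (.of (.y i a)) : Module.End ℂ N) = _
  rw [wordAct, FreeGroup.lift_apply_of]
  rfl

/-- The highest weight coefficient is invariant under the `x_j(a)` for which the weight
vanishes on `h_j`. -/
theorem functional_act_x_mul {wt : Fin 7 → ℂ} {n : N} (hn : IsTop wt n) (ψ : N →ₗ[ℂ] ℂ)
    (hψ : ∀ j m, ψ ⁅chevH j, m⁆ = wt j * ψ m) {j : Fin 7} (hj : wt j = 0) (a : ℂ) (g : Grp) :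
    ψ ((act N (x j a * g) : Module.End ℂ N) n) = ψ ((act N g : Module.End ℂ N) n) := by
  rw [map_mul, Units.val_mul, Module.End.mul_apply, coe_act_x]
  refine functional_nexp (isNilpotent_chevE N j a)
    (fun m hm => Submodule.smul_mem _ a (hn.topVector.e_mem j hm)) ψ (fun m hm => ?_)
    (act_mem_cyclicSpan hn g (mem_cyclicSpan _ n))
  rw [LinearMap.smul_apply, map_smul, hn.topVector.functional_e ψ hψ hj hm, smul_zero]

end comparison
open scoped TensorProduct

/-! ### Tensor products -/

section tensor
variable {M : Type} [AddCommGroup M] [Module ℂ M]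
variable {N : Type} [AddCommGroup N] [Module ℂ N]

/-- Restriction of scalars for endomorphisms. -/
abbrev ratModule (M : Type) [AddCommGroup M] [Module ℂ M] : Module ℚ (Module.End ℂ M) :=
  Module.compHom _ (algebraMap ℚ ℂ)

theorem nexp_eq_exp (X : Module.End ℂ M) :
    nexp X = @IsNilpotent.exp _ _ (ratModule M) X := by
  let := ratModule M
  exact Finset.sum_congr rfl fun k _ => by
    change _ = (algebraMap ℚ ℂ ((k.factorial : ℚ)⁻¹)) • X ^ k
    simp

/-- The operators `A ⊗ 1` and `1 ⊗ B` commute, and `T ↦ T ⊗ 1`, `T ↦ 1 ⊗ T` are algebra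
homomorphisms, hence compatible with exponentials. -/
theorem nexp_tensor {A : Module.End ℂ M} {B : Module.End ℂ N} (hA : IsNilpotent A)
    (hB : IsNilpotent B) (m : M) (n : N) :
    nexp (A.rTensor N + B.lTensor M : Module.End ℂ (M ⊗[ℂ] N)) (m ⊗ₜ[ℂ] n) =
      nexp A m ⊗ₜ[ℂ] nexp B n := by
  let := ratModule M
  let := ratModule N
  let := ratModule (M ⊗[ℂ] N)
  have hA' : IsNilpotent (A.rTensor N : Module.End ℂ (M ⊗[ℂ] N)) :=
    hA.map (Module.End.rTensorAlgHom ℂ M N)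
  have hB' : IsNilpotent (B.lTensor M : Module.End ℂ (M ⊗[ℂ] N)) :=
    hB.map (Module.End.lTensorAlgHom ℂ N M)
  have hc : Commute (A.rTensor N : Module.End ℂ (M ⊗[ℂ] N)) (B.lTensor M) :=
    (LinearMap.rTensor_comp_lTensor _ _ _).trans (LinearMap.lTensor_comp_rTensor _ _ _).symm
  have h1 : IsNilpotent.exp (A.rTensor N : Module.End ℂ (M ⊗[ℂ] N)) =
      (IsNilpotent.exp A).rTensor N := (hA.map_exp (Module.End.rTensorAlgHom ℂ M N)).symm
  have h2 : IsNilpotent.exp (B.lTensor M : Module.End ℂ (M ⊗[ℂ] N)) =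
      (IsNilpotent.exp B).lTensor M := (hB.map_exp (Module.End.lTensorAlgHom ℂ N M)).symm
  rw [nexp_eq_exp, nexp_eq_exp, nexp_eq_exp, IsNilpotent.exp_add_of_commute hc hA' hB', h1, h2]
  rfl

variable [LieRingModule Alg M] [LieModule ℂ Alg M] [LieRingModule Alg N] [LieModule ℂ Alg N]

theorem smul_toEnd_tensor (c : ℂ) (X : Alg) :
    c • LieModule.toEnd ℂ Alg (M ⊗[ℂ] N) X =
      ((c • LieModule.toEnd ℂ Alg M X).rTensor N + (c • LieModule.toEnd ℂ Alg N X).lTensor M :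
        Module.End ℂ (M ⊗[ℂ] N)) := by
  rw [LinearMap.rTensor_smul, LinearMap.lTensor_smul, ← smul_add]
  rfl

variable [FiniteDimensional ℂ M] [FiniteDimensional ℂ N]

theorem act_tmul (g : Grp) (m : M) (n : N) :
    (act (M ⊗[ℂ] N) g : Module.End ℂ (M ⊗[ℂ] N)) (m ⊗ₜ n) =
      (act M g : Module.End ℂ M) m ⊗ₜ (act N g : Module.End ℂ N) n := by
  obtain ⟨g, rfl⟩ := QuotientGroup.mk_surjective g
  change (wordAct (M ⊗[ℂ] N) g : Module.End ℂ (M ⊗[ℂ] N)) (m ⊗ₜ n) =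
      (wordAct M g : Module.End ℂ M) m ⊗ₜ (wordAct N g : Module.End ℂ N) n
  have hgen : ∀ g : GroupGen, ∀ m n, (genAct (M ⊗[ℂ] N) g : Module.End ℂ (M ⊗[ℂ] N)) (m ⊗ₜ n) =
      (genAct M g : Module.End ℂ M) m ⊗ₜ (genAct N g : Module.End ℂ N) n := by
    intro g m n
    cases g with
    | x i a =>
      refine Eq.trans ?_ (nexp_tensor (isNilpotent_chevE M i a) (isNilpotent_chevE N i a) m n)
      rw [← smul_toEnd_tensor]
      rfl
    | y i a =>
      refine Eq.trans ?_ (nexp_tensor (isNilpotent_chevF M i a) (isNilpotent_chevF N i a) m n)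
      rw [← smul_toEnd_tensor]
      rfl
  induction g using FreeGroup.induction_on generalizing m n with
  | C1 => rfl
  | of g =>
    rw [wordAct, wordAct, wordAct, FreeGroup.lift_apply_of, FreeGroup.lift_apply_of,
      FreeGroup.lift_apply_of]
    exact hgen g m n
  | inv_of g _ =>
    rw [map_inv, map_inv, map_inv, wordAct, wordAct, wordAct, FreeGroup.lift_apply_of,
      FreeGroup.lift_apply_of, FreeGroup.lift_apply_of]
    -- The case of an inverse follows from that of the generator, applied to the inverse images of
    -- `m` and `n`.
    have h := hgen g ((((genAct M g)⁻¹ : (Module.End ℂ M)ˣ) : Module.End ℂ M) m)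
      ((((genAct N g)⁻¹ : (Module.End ℂ N)ˣ) : Module.End ℂ N) n)
    rw [← Module.End.mul_apply, ← Module.End.mul_apply, ← Units.val_mul, ← Units.val_mul,
      mul_inv_cancel, mul_inv_cancel, Units.val_one, Units.val_one, Module.End.one_apply,
      Module.End.one_apply] at h
    rw [← h, ← Module.End.mul_apply, ← Units.val_mul, inv_mul_cancel]
    rfl
  | mul g g' h h' =>
    rw [map_mul, map_mul, map_mul, Units.val_mul, Units.val_mul, Units.val_mul,
      Module.End.mul_apply, h', h]
    rfl

end tensor

/-! ### The minuscule module -/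

theorem minuscule_ext {M : Type*} [AddCommGroup M] [Module ℂ M] {f g : Minuscule →ₗ[ℂ] M}
    (h : ∀ a, f (Minuscule.v a) = g (Minuscule.v a)) : f = g := by
  refine (Pi.basisFun ℂ PIdx).ext fun a => ?_
  rw [Pi.basisFun_apply]
  exact h a

/-- The coordinate of the basis vector `v_c`. -/
def minCoord (c : PIdx) : Minuscule →ₗ[ℂ] ℂ := LinearMap.proj (φ := fun _ : PIdx => ℂ) c

theorem minCoord_v (c a : PIdx) : minCoord c (Minuscule.v a) = if a = c then 1 else 0 := by
  change (Pi.single a 1 : PIdx → ℂ) c = _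
  rw [Pi.single_apply]
  simp [eq_comm]

theorem lower_eq_some_iff (i : Fin 7) (a b : PIdx) : lower i a = some b ↔ raise i b = some a := by
  revert i a b
  decide +kernel

/-- `pull` is defined on coordinates, so basis vectors move along the inverse partial map. This is
why `minE` is built from `lower` although `e_i` raises basis vectors. -/
theorem pull_single {s t : PIdx → Option PIdx} (h : ∀ a b, s a = some b ↔ t b = some a)
    (a : PIdx) :
    pull s (Pi.single a 1) = (t a).elim 0 fun b => (Pi.single b 1 : PIdx → ℂ) := by
  funext b
  change (s b).elim 0 (Pi.single a 1 : PIdx → ℂ) = _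
  cases hs : s b with
  | none =>
    cases ht : t a with
    | none => rfl
    | some c =>
      have : c ≠ b := by rintro rfl; rw [(h _ _).2 ht] at hs; exact absurd hs (by simp)
      simp [this.symm]
  | some c =>
    by_cases hc : c = a
    · subst hc
      simp [(h _ _).1 hs]
    · cases ht : t a with
      | none => simp [hc]
      | some d =>
        have : d ≠ b := by
          rintro rfl
          rw [(h _ _).2 ht] at hs
          exact hc (Option.some_injective _ hs).symm
        simp [hc, this.symm]

attribute [local instance 100] LieRing.ofAssociativeRing

theorem lie_chevE_v (i : Fin 7) (a : PIdx) :
    ⁅chevE i, Minuscule.v a⁆ = (raise i a).elim 0 Minuscule.v := by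
  change (liftAlg serreRel_min (chevE i)) (Pi.single a 1 : PIdx → ℂ) = _
  rw [liftAlg_chevE, minE, pull_single (lower_eq_some_iff i)]
  rfl

theorem lie_chevF_v (i : Fin 7) (a : PIdx) :
    ⁅chevF i, Minuscule.v a⁆ = (lower i a).elim 0 Minuscule.v := by
  change (liftAlg serreRel_min (chevF i)) (Pi.single a 1 : PIdx → ℂ) = _
  rw [liftAlg_chevF, minF, pull_single fun a b => (lower_eq_some_iff i b a).symm]
  rfl

theorem minCoord_lie_chevH (i : Fin 7) (c : PIdx) (m : Minuscule) :
    minCoord c ⁅chevH i, m⁆ = wt i c * minCoord c m := by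
  change (liftAlg serreRel_min (chevH i)) (show PIdx → ℂ from m) c = _
  rw [liftAlg_chevH]
  rfl

theorem lie_chevH_v (i : Fin 7) (a : PIdx) :
    ⁅chevH i, Minuscule.v a⁆ = (wt i a : ℂ) • Minuscule.v a := by
  funext c
  have h := minCoord_lie_chevH i c (Minuscule.v a)
  rw [minCoord_v] at h
  refine h.trans ?_
  change _ = (wt i a : ℂ) * minCoord c (Minuscule.v a)
  rw [minCoord_v]
  split_ifs with hc
  · rw [hc]
  · simp

/-- In this minuscule module no edge labelled `i` is followed by another one, so `e_i` squares to
zero and its exponential has only the linear term. -/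
theorem act_x_v (i : Fin 7) (a : ℂ) (b : PIdx) :
    (act Minuscule (x i a) : Module.End ℂ Minuscule) (Minuscule.v b) =
      Minuscule.v b + a • (raise i b).elim 0 Minuscule.v := by
  have hsq : (a • LieModule.toEnd ℂ Alg Minuscule (chevE i)) ^ 2 = 0 := by
    refine minuscule_ext fun b => ?_
    rw [pow_two]
    change a • ⁅chevE i, a • ⁅chevE i, Minuscule.v b⁆⁆ = 0
    rw [lie_chevE_v]
    have h := raise_self i b
    cases hb : raise i b with
    | none => simp
    | some c =>
      rw [hb] at h
      rw [Option.elim_some, lie_smul, lie_chevE_v, show raise i c = none from h]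
      simp
  rw [coe_act_x, nexp_eq_sum hsq, Finset.sum_range_succ, Finset.sum_range_one]
  simp only [Nat.factorial_zero, Nat.factorial_one, Nat.cast_one, inv_one, one_smul, pow_zero,
    pow_one]
  change Minuscule.v b + a • ⁅chevE i, Minuscule.v b⁆ = _
  rw [lie_chevE_v]

theorem act_y_v (i : Fin 7) (a : ℂ) (b : PIdx) :
    (act Minuscule (y i a) : Module.End ℂ Minuscule) (Minuscule.v b) =
      Minuscule.v b + a • (lower i b).elim 0 Minuscule.v := by
  have hsq : (a • LieModule.toEnd ℂ Alg Minuscule (chevF i)) ^ 2 = 0 := by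
    refine minuscule_ext fun b => ?_
    rw [pow_two]
    change a • ⁅chevF i, a • ⁅chevF i, Minuscule.v b⁆⁆ = 0
    rw [lie_chevF_v]
    have h := lower_self i b
    cases hb : lower i b with
    | none => simp
    | some c =>
      rw [hb] at h
      rw [Option.elim_some, lie_smul, lie_chevF_v, show lower i c = none from h]
      simp
  rw [coe_act_y, nexp_eq_sum hsq, Finset.sum_range_succ, Finset.sum_range_one]
  simp only [Nat.factorial_zero, Nat.factorial_one, Nat.cast_one, inv_one, one_smul, pow_zero,
    pow_one]
  change Minuscule.v b + a • ⁅chevF i, Minuscule.v b⁆ = _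
  rw [lie_chevF_v]

/-- On a string with two weights `x_i(-1) y_i(1) x_i(-1)` is a quarter turn: the upper vector goes
to the lower one and the lower one to minus the upper one. -/
theorem act_sbar_v (i : Fin 7) (a : PIdx) :
    (act Minuscule (sbar i) : Module.End ℂ Minuscule) (Minuscule.v a) =
      ((stepIdx i a).2 : ℂ) • Minuscule.v (stepIdx i a).1 := by
  rw [sbar, map_mul, map_mul, Units.val_mul, Units.val_mul, Module.End.mul_apply,
    Module.End.mul_apply, act_x_v, stepIdx]
  have hl := lower_self i a
  have hr := raise_self i a
  cases h1 : lower i a with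
  | some b =>
    have h2 : raise i b = some a := (lower_eq_some_iff i a b).1 h1
    have h3 : raise i a = none := by
      have := raise_self i b
      rwa [h2] at this
    rw [h3, Option.elim_none, smul_zero, add_zero, act_y_v, h1, map_add, map_smul,
      Option.elim_some, act_x_v, act_x_v, h3, h2]
    simp
  | none =>
    cases h2 : raise i a with
    | none =>
      rw [Option.elim_none, smul_zero, add_zero, act_y_v, h1, map_add, map_smul,
        act_x_v, h2]
      simp
    | some b =>
      have h3 : lower i b = some a := (lower_eq_some_iff i b a).2 h2
      have h4 : raise i b = none := by rwa [h2] at hr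
      rw [Option.elim_some, map_add, map_smul, act_y_v, act_y_v, h1, h3, map_add, map_smul,
        map_add, map_smul, map_add, map_smul, Option.elim_some, Option.elim_none, map_zero,
        act_x_v, act_x_v, h2, h4]
      simp

theorem act_word_v (ω : List (Fin 7)) (a : PIdx) :
    (act Minuscule (ω.map sbar).prod : Module.End ℂ Minuscule) (Minuscule.v a) =
      ((wordIdx ω a).2 : ℂ) • Minuscule.v (wordIdx ω a).1 := by
  induction ω with
  | nil => simp [wordIdx]
  | cons i ω ih =>
    rw [List.map_cons, List.prod_cons, map_mul, Units.val_mul, Module.End.mul_apply, ih, map_smul,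
      act_sbar_v, smul_smul]
    change _ = (((stepIdx i (wordIdx ω a).1).2 * (wordIdx ω a).2 : ℤ) : ℂ) •
      Minuscule.v (stepIdx i (wordIdx ω a).1).1
    push_cast
    rw [mul_comm]

/-! ### Representatives of Weyl group elements on the minuscule module -/

/-- The permutation of the weights by a simple reflection. -/
def stepEnd (i : Fin 7) : Function.End PIdx := fun a => (stepIdx i a).1

/-- The entries of the Coxeter matrix. -/
def coxeterEntry (i j : Fin 7) : ℕ := CoxeterMatrix.E₇ i j

theorem stepEnd_liftable : CoxeterMatrix.E₇.IsLiftable stepEnd := by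
  have h1 : ∀ i a, (stepIdx i (stepIdx i a).1).1 = a := by decide +kernel
  have h2 : ∀ i j, coxeterEntry i j = 2 → ∀ a,
      (stepIdx i (stepIdx j (stepIdx i (stepIdx j a).1).1).1).1 = a := by decide +kernel
  have h3 : ∀ i j, coxeterEntry i j = 3 → ∀ a,
      (stepIdx i (stepIdx j (stepIdx i (stepIdx j (stepIdx i (stepIdx j a).1).1).1).1).1).1 = a := by
    decide +kernel
  intro i j
  rcases simplyLaced_E₇ i j with h | h | h
  · rw [h, pow_one]
    have hij : i = j := by
      by_contra hne
      exact CoxeterMatrix.E₇.off_diagonal i j hne h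
    subst hij
    exact funext (h1 i)
  · rw [h, pow_two]
    exact funext (h2 i j h)
  · rw [h, pow_three]
    exact funext (h3 i j h)

/-- The action of the Weyl group on the weights of the minuscule module. -/
def weylPerm : Weyl →* Function.End PIdx := coxeter.lift ⟨_, stepEnd_liftable⟩

theorem weylPerm_simple (i : Fin 7) (a : PIdx) :
    weylPerm (coxeter.simple i) a = (stepIdx i a).1 :=
  congrFun (coxeter.lift_apply_simple stepEnd_liftable i) a

theorem weylPerm_wordProd (ω : List (Fin 7)) (a : PIdx) :
    weylPerm (coxeter.wordProd ω) a = ω.foldr (fun i b => (stepIdx i b).1) a := by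
  induction ω with
  | nil => simp [Function.End.one_def]
  | cons i ω ih =>
    rw [coxeter.wordProd_cons, map_mul]
    change weylPerm (coxeter.simple i) (weylPerm (coxeter.wordProd ω) a) = _
    rw [weylPerm_simple, ih]
    rfl

theorem simple_injective : Function.Injective coxeter.simple := by
  have h : ∀ i j : Fin 7, (∀ a, (stepIdx i a).1 = (stepIdx j a).1) → i = j := by decide +kernel
  intro i j hij
  refine h i j fun a => ?_
  rw [← weylPerm_simple, ← weylPerm_simple, hij]

/-- The images of some weights under the reflections in the inversion sequence of a word. -/
def invCodes (pts : List PIdx) : List (Fin 7) → List (List PIdx)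
  | [] => []
  | i :: ω => pts.map (fun a => (ω.reverse ++ i :: ω).foldr (fun i b => (stepIdx i b).1) a) ::
      invCodes pts ω

theorem map_rightInvSeq (pts : List PIdx) (ω : List (Fin 7)) :
    (coxeter.rightInvSeq ω).map (fun t => pts.map (weylPerm t)) = invCodes pts ω := by
  induction ω with
  | nil => rfl
  | cons i ω ih =>
    rw [CoxeterSystem.rightInvSeq, List.map_cons, ih, invCodes]
    congr 1
    refine List.map_congr_left fun a _ => ?_
    rw [← weylPerm_wordProd, coxeter.wordProd_append, coxeter.wordProd_reverse,
      coxeter.wordProd_cons, mul_assoc]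

theorem isReduced_w0Word : coxeter.IsReduced w0Word := by
  refine isReduced_of_nodup simplyLaced_E₇ (List.Nodup.of_map
    -- The images of these five weights already separate the 63 entries of the inversion sequence.
    (fun t => [PIdx.v1, .v22'', .v12, .v6'', .v25].map (weylPerm t)) ?_)
  rw [map_rightInvSeq]
  decide +kernel

/-- Both sides are signed permutations of the 56 basis vectors. The minuscule module suffices
because all minors are computed in its tensor powers. -/
theorem act_sbar_braid (i j : Fin 7) :
    (CoxeterMatrix.E₇ i j = 2 → act Minuscule (sbar i) * act Minuscule (sbar j) =
      act Minuscule (sbar j) * act Minuscule (sbar i)) ∧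
    (CoxeterMatrix.E₇ i j = 3 →
      act Minuscule (sbar i) * act Minuscule (sbar j) * act Minuscule (sbar i) =
      act Minuscule (sbar j) * act Minuscule (sbar i) * act Minuscule (sbar j)) := by
  have key : ∀ ω ω' : List (Fin 7), (∀ a, wordIdx ω a = wordIdx ω' a) →
      act Minuscule (ω.map sbar).prod = act Minuscule (ω'.map sbar).prod := fun ω ω' h =>
    Units.ext (minuscule_ext fun a => by rw [act_word_v, act_word_v, h])
  have h2 : ∀ i j, coxeterEntry i j = 2 → ∀ a, wordIdx [i, j] a = wordIdx [j, i] a := by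
    decide +kernel
  have h3 : ∀ i j, coxeterEntry i j = 3 → ∀ a,
      wordIdx [i, j, i] a = wordIdx [j, i, j] a := by decide +kernel
  refine ⟨fun h => ?_, fun h => ?_⟩
  · simpa using key _ _ (h2 i j h)
  · simpa [mul_assoc] using key _ _ (h3 i j h)

/-- The word chosen inside `wbar` is unspecified; Matsumoto's theorem and the braid relations allow
any reduced word in its place. -/
theorem act_wbar {ω : List (Fin 7)} (h : coxeter.IsReduced ω) (a : PIdx) :
    (act Minuscule (wbar (coxeter.wordProd ω)) : Module.End ℂ Minuscule) (Minuscule.v a) =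
      ((wordIdx ω a).2 : ℂ) • Minuscule.v (wordIdx ω a).1 := by
  obtain ⟨h1, h2⟩ := (coxeter.exists_isReduced (coxeter.wordProd ω)).choose_spec
  rw [← act_word_v, wbar, map_list_prod, map_list_prod, List.map_map, List.map_map]
  rw [prod_map_eq_of_isReduced simplyLaced_E₇ simple_injective
    (act Minuscule ∘ sbar) (fun i j => (act_sbar_braid i j).1) (fun i j => (act_sbar_braid i j).2)
    _ _ ω rfl h1 h h2.symm]

theorem wbar_one : wbar 1 = 1 := by
  obtain ⟨h1, h2⟩ := (coxeter.exists_isReduced 1).choose_spec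
  rw [CoxeterSystem.IsReduced, ← h2, coxeter.length_one, eq_comm, List.length_eq_zero_iff] at h1
  rw [wbar, h1]
  rfl
open scoped TensorProduct

/-! ### Tensor powers of the minuscule module -/

/-- The matrix coefficients of `g` on tensors of basis vectors of the minuscule module. -/
def matrixCoeff (g : Grp) : List PIdx → List PIdx → ℂ
  | [], [] => 1
  | c :: cs, a :: l =>
    minCoord c ((act Minuscule g : Module.End ℂ Minuscule) (Minuscule.v a)) * matrixCoeff g cs l
  | _, _ => 0

/-- A realization of the `n`-th tensor power of the minuscule module, with the tensors of basis
vectors and their coordinates. -/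
structure TensorModel (n : ℕ) where
  M : Type
  [addCommGroup : AddCommGroup M]
  [module : Module ℂ M]
  [lieRingModule : LieRingModule Alg M]
  [lieModule : LieModule ℂ Alg M]
  [finiteDimensional : FiniteDimensional ℂ M]
  vec : List PIdx → M
  coord : List PIdx → M →ₗ[ℂ] ℂ
  lie_vec : ∀ (X : Alg) (t : PIdx → Option PIdx),
    (∀ a, ⁅X, Minuscule.v a⁆ = (t a).elim 0 Minuscule.v) →
    ∀ l, l.length = n → ⁅X, vec l⁆ = ((derive t l).map vec).sum
  lie_chevH_vec : ∀ j l, l.length = n → ⁅chevH j, vec l⁆ = ((l.map (wt j)).sum : ℂ) • vec l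
  coord_lie_chevH : ∀ j l, l.length = n →
    ∀ m, coord l ⁅chevH j, m⁆ = ((l.map (wt j)).sum : ℂ) * coord l m
  coord_vec : ∀ c l, c.length = n → l.length = n → coord c (vec l) = if l = c then 1 else 0
  coord_act : ∀ g c l, c.length = n → l.length = n →
    coord c ((act M g : Module.End ℂ M) (vec l)) = matrixCoeff g c l

attribute [instance] TensorModel.addCommGroup TensorModel.module
  TensorModel.lieRingModule TensorModel.lieModule TensorModel.finiteDimensional

/-- The minuscule module itself. -/
def TensorModel.one : TensorModel 1 where
  M := Minuscule
  -- The default label is irrelevant: the properties concern only lists of length one.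
  vec l := Minuscule.v (l.headD .v0)
  coord l := minCoord (l.headD .v0)
  lie_vec X t h l hl := by
    obtain ⟨a, rfl⟩ := List.length_eq_one_iff.1 hl
    rw [List.headD_cons, h, derive, derive]
    cases t a <;> simp
  lie_chevH_vec j l hl := by
    obtain ⟨a, rfl⟩ := List.length_eq_one_iff.1 hl
    simp [lie_chevH_v]
  coord_lie_chevH j l hl m := by
    obtain ⟨a, rfl⟩ := List.length_eq_one_iff.1 hl
    simp [minCoord_lie_chevH]
  coord_vec c l hc hl := by
    obtain ⟨a, rfl⟩ := List.length_eq_one_iff.1 hl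
    obtain ⟨c, rfl⟩ := List.length_eq_one_iff.1 hc
    simp [minCoord_v]
  coord_act g c l hc hl := by
    obtain ⟨a, rfl⟩ := List.length_eq_one_iff.1 hl
    obtain ⟨c, rfl⟩ := List.length_eq_one_iff.1 hc
    simp [matrixCoeff]

/-- The tensor product of the minuscule module with a tensor power. -/
def TensorModel.succ {n : ℕ} (T : TensorModel n) : TensorModel (n + 1) where
  M := Minuscule ⊗[ℂ] T.M
  vec l := Minuscule.v (l.headD .v0) ⊗ₜ T.vec l.tail
  coord l := (TensorProduct.lid ℂ ℂ).toLinearMap ∘ₗ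
    TensorProduct.map (minCoord (l.headD .v0)) (T.coord l.tail)
  lie_vec X t h l hl := by
    obtain ⟨a, l, rfl⟩ := List.exists_cons_of_length_eq_add_one hl
    rw [TensorProduct.LieModule.lie_tmul_right, List.headD_cons, List.tail_cons, h,
      T.lie_vec X t h l (by simpa using hl), derive, List.map_append, List.sum_append, List.map_map]
    congr 1
    · cases t a <;> simp
    · induction derive t l with
      | nil => simp
      | cons d D ih => simp [TensorProduct.tmul_add, ih]
  lie_chevH_vec j l hl := by
    obtain ⟨a, l, rfl⟩ := List.exists_cons_of_length_eq_add_one hl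
    rw [TensorProduct.LieModule.lie_tmul_right, List.headD_cons, List.tail_cons, lie_chevH_v,
      T.lie_chevH_vec j l (by simpa using hl), TensorProduct.tmul_smul, ← TensorProduct.smul_tmul',
      List.map_cons, List.sum_cons, ← add_smul]
    push_cast
    rfl
  coord_lie_chevH j l hl m := by
    obtain ⟨a, l, rfl⟩ := List.exists_cons_of_length_eq_add_one hl
    induction m using TensorProduct.induction_on with
    | zero => simp
    | tmul m n =>
      rw [TensorProduct.LieModule.lie_tmul_right]
      simp only [List.headD_cons, List.tail_cons, LinearMap.comp_apply, map_add,
        TensorProduct.map_tmul, minCoord_lie_chevH, T.coord_lie_chevH j l (by simpa using hl),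
        LinearEquiv.coe_coe, TensorProduct.lid_tmul, smul_eq_mul, List.map_cons, List.sum_cons]
      push_cast
      ring
    | add m n hm hn => rw [lie_add, map_add, hm, hn, map_add, mul_add]
  coord_vec c l hc hl := by
    obtain ⟨a, l, rfl⟩ := List.exists_cons_of_length_eq_add_one hl
    obtain ⟨c, cs, rfl⟩ := List.exists_cons_of_length_eq_add_one hc
    simp only [List.headD_cons, List.tail_cons, LinearMap.comp_apply,
        TensorProduct.map_tmul, minCoord_v, T.coord_vec cs l (by simpa using hc) (by simpa using hl),
        LinearEquiv.coe_coe, TensorProduct.lid_tmul, smul_eq_mul, List.cons.injEq]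
    by_cases h1 : a = c <;> by_cases h2 : l = cs <;> simp [h1, h2]
  coord_act g c l hc hl := by
    obtain ⟨a, l, rfl⟩ := List.exists_cons_of_length_eq_add_one hl
    obtain ⟨c, cs, rfl⟩ := List.exists_cons_of_length_eq_add_one hc
    rw [act_tmul]
    simp only [List.headD_cons, List.tail_cons, LinearMap.comp_apply,
        TensorProduct.map_tmul, T.coord_act g cs l (by simpa using hc) (by simpa using hl),
        LinearEquiv.coe_coe, TensorProduct.lid_tmul, smul_eq_mul, matrixCoeff]

/-- The tensor powers of the minuscule module. -/
def tensorModel : (n : ℕ) → TensorModel (n + 1)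
  | 0 => .one
  | n + 1 => (tensorModel n).succ

/-! ### Linear combinations of tensors -/

/-- Add a multiple of a tensor to a linear combination without repetitions. -/
def insertTerm (t : ℤ × List PIdx) : FormalTensor → FormalTensor
  | [] => [t]
  | s :: v =>
    if t.2 = s.2 then (if t.1 + s.1 = 0 then v else (t.1 + s.1, s.2) :: v)
    else s :: insertTerm t v

/-- Cancelling like terms turns the vanishing of a vector into the checkable statement that a list
is empty. -/
def collect (v : FormalTensor) : FormalTensor := v.foldr insertTerm []

section formal
variable {n : ℕ} (T : TensorModel n)

/-- The vector given by a linear combination of tensors. -/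
def formalVec (v : FormalTensor) : T.M := (v.map fun t => (t.1 : ℂ) • T.vec t.2).sum

theorem formalVec_cons (t : ℤ × List PIdx) (v : FormalTensor) :
    formalVec T (t :: v) = (t.1 : ℂ) • T.vec t.2 + formalVec T v := by
  simp [formalVec]

theorem formalVec_insertTerm (t : ℤ × List PIdx) (v : FormalTensor) :
    formalVec T (insertTerm t v) = (t.1 : ℂ) • T.vec t.2 + formalVec T v := by
  induction v with
  | nil => rw [insertTerm, formalVec_cons]
  | cons s v ih =>
    rw [insertTerm]
    split_ifs with h1 h2
    · have h2' : ((t.1 : ℂ) + s.1) = 0 := by exact_mod_cast h2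
      rw [formalVec_cons, ← add_assoc, h1, ← add_smul, h2', zero_smul, zero_add]
    · rw [formalVec_cons, formalVec_cons, ← add_assoc, h1, ← add_smul]
      push_cast
      rfl
    · rw [formalVec_cons, ih, formalVec_cons]
      abel

theorem formalVec_collect (v : FormalTensor) : formalVec T (collect v) = formalVec T v := by
  induction v with
  | nil => rfl
  | cons t v ih =>
    rw [collect, List.foldr_cons, ← collect, formalVec_insertTerm, ih, formalVec_cons]

theorem formalVec_append (v w : FormalTensor) :
    formalVec T (v ++ w) = formalVec T v + formalVec T w := by
  simp [formalVec]

theorem lie_formalVec {X : Alg} {t : PIdx → Option PIdx}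
    (h : ∀ a, ⁅X, Minuscule.v a⁆ = (t a).elim 0 Minuscule.v) {v : FormalTensor}
    (hv : ∀ s ∈ v, s.2.length = n) :
    ⁅X, formalVec T v⁆ = formalVec T (deriveTensor t v) := by
  induction v with
  | nil => simp [formalVec, deriveTensor]
  | cons s v ih =>
    rw [formalVec_cons, lie_add, lie_smul, T.lie_vec X t h _ (hv s (by simp)),
      ih fun s hs => hv s (by simp [hs])]
    change _ = formalVec T ((derive t s.2).map (fun l => (s.1, l)) ++ deriveTensor t v)
    rw [formalVec_append]
    congr 1
    induction derive t s.2 with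
    | nil => simp [formalVec]
    | cons d D ih => rw [List.map_cons, List.sum_cons, smul_add, ih, List.map_cons, formalVec_cons]

theorem lie_chevH_formalVec {j : Fin 7} {c : ℤ} {v : FormalTensor}
    (hv : ∀ s ∈ v, s.2.length = n) (h : ∀ s ∈ v, (s.2.map (wt j)).sum = c) :
    ⁅chevH j, formalVec T v⁆ = (c : ℂ) • formalVec T v := by
  induction v with
  | nil => simp [formalVec]
  | cons s v ih =>
    rw [formalVec_cons, lie_add, lie_smul, T.lie_chevH_vec j _ (hv s (by simp)),
      ih (fun s hs => hv s (by simp [hs])) (fun s hs => h s (by simp [hs])), h s (by simp),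
      smul_add, smul_comm]

/-- The value of a matrix coefficient on a linear combination of tensors. -/
theorem coord_act_formalVec (g : Grp) {c : List PIdx} (hc : c.length = n) {v : FormalTensor}
    (hv : ∀ s ∈ v, s.2.length = n) :
    T.coord c ((act T.M g : Module.End ℂ T.M) (formalVec T v)) =
      (v.map fun t => (t.1 : ℂ) * matrixCoeff g c t.2).sum := by
  induction v with
  | nil => simp [formalVec]
  | cons s v ih =>
    rw [formalVec_cons, map_add, map_add, map_smul, map_smul, T.coord_act g c _ hc (hv s (by simp)),
      ih fun s hs => hv s (by simp [hs])]
    rfl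

theorem coord_formalVec {c : List PIdx} (hc : c.length = n) {v : FormalTensor}
    (hv : ∀ s ∈ v, s.2.length = n) :
    T.coord c (formalVec T v) = ((v.map fun s => if s.2 = c then s.1 else 0).sum : ℤ) := by
  induction v with
  | nil => simp [formalVec]
  | cons s v ih =>
    rw [formalVec_cons, map_add, map_smul, T.coord_vec c _ hc (hv s (by simp)),
      ih fun s hs => hv s (by simp [hs])]
    split_ifs with h <;> simp [h]

end formal

/-! ### Highest weight vectors of the fundamental representations -/

/-- The tensor power containing a fundamental representation. -/
abbrev fundModel (i : Fin 7) : TensorModel (![1, 2, 3, 3, 2, 1, 0] i + 1) := tensorModel _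

theorem length_topTensor (i : Fin 7) :
    ∀ s ∈ topTensor i, s.2.length = ![1, 2, 3, 3, 2, 1, 0] i + 1 := by
  revert i
  decide +kernel

theorem length_topCoord (i : Fin 7) : (topCoord i).length = ![1, 2, 3, 3, 2, 1, 0] i + 1 := by
  revert i
  decide +kernel

theorem wt_topTensor (i j : Fin 7) :
    ∀ s ∈ topTensor i, (s.2.map (wt j)).sum = if j = i then 1 else 0 := by
  revert i j
  decide +kernel

theorem wt_topCoord (i j : Fin 7) :
    ((topCoord i).map (wt j)).sum = if j = i then 1 else 0 := by
  revert i j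
  decide +kernel

theorem collect_deriveTensor_raise (i j : Fin 7) :
    collect (deriveTensor (raise j) (topTensor i)) = [] := by
  revert i j
  decide +kernel

theorem isTop_topTensor (i : Fin 7) :
    IsTop (Pi.single i 1) (formalVec (fundModel i) (topTensor i)) where
  e_top j := by
    rw [lie_formalVec _ (lie_chevE_v j) (length_topTensor i), ← formalVec_collect,
      collect_deriveTensor_raise]
    rfl
  h_top j := by
    rw [lie_chevH_formalVec _ (length_topTensor i) (wt_topTensor i j), Pi.single_apply]
    push_cast
    rfl

theorem coord_topTensor (i : Fin 7) :
    (fundModel i).coord (topCoord i) (formalVec (fundModel i) (topTensor i)) = 1 := by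
  have h : ∀ i, ((topTensor i).map fun s => if s.2 = topCoord i then s.1 else 0).sum = 1 := by
    decide +kernel
  rw [coord_formalVec _ (length_topCoord i) (length_topTensor i), h, Int.cast_one]

/-- The tensor `topCoord i` has weight `ω_i`, so its coordinate is a functional of the weight
required in `hwCoeff_act`. -/
theorem coord_topCoord_lie_chevH (i j : Fin 7) (m : (fundModel i).M) :
    (fundModel i).coord (topCoord i) ⁅chevH j, m⁆ =
      (Pi.single i 1 : Fin 7 → ℂ) j * (fundModel i).coord (topCoord i) m := by
  rw [(fundModel i).coord_lie_chevH j _ (length_topCoord i), wt_topCoord, Pi.single_apply]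
  push_cast
  rfl

/-! ### Matrix coefficients on the torus -/

/-- The product of the `x_{r k}(a_k)` along a list of indices. -/
def xProd (a : ℕ → ℂ) (L : List ℕ) : Grp := (L.map fun k => x (r k) (a k)).prod

theorem transpose_yProd (a : ℕ → ℂ) (L : List ℕ) :
    transpose ((L.reverse.map fun k => y (r k) (a k)).prod) = xProd a L := by
  induction L with
  | nil => rfl
  | cons k L ih =>
    rw [List.reverse_cons, List.map_append, List.prod_append, transpose_mul, ih,
      List.map_singleton, List.prod_singleton, transpose_y, xProd, xProd, List.map_cons,
      List.prod_cons]

section eval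
variable {μ : ℕ →* ℂ} {a : ℕ → ℂ}

theorem eval_rowUnit (b c : PIdx) :
    (rowUnit c b).eval μ = minCoord c (Minuscule.v b) := by
  rw [minCoord_v, rowUnit]
  split_ifs <;> simp

theorem eval_rowStep {t : PIdx → Option PIdx} {k : ℕ} (hk : μ (Poly.var k) = a k)
    {R : PIdx → Poly} {ψ : Minuscule →ₗ[ℂ] ℂ} (h : ∀ b, (R b).eval μ = ψ (Minuscule.v b))
    (b : PIdx) :
    (rowStep t k R b).eval μ =
      ψ (Minuscule.v b + a k • (t b).elim 0 Minuscule.v) := by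
  rw [rowStep]
  cases t b with
  | none => simp [h]
  | some c => simp [h, hk]

/-- The functional `ψ` must be general: each step absorbs the leftmost remaining factor by
precomposing `ψ` with it. -/
theorem eval_foldl_rowStep {L : List ℕ} (hL : ∀ k ∈ L, μ (Poly.var k) = a k)
    {R : PIdx → Poly} {ψ : Minuscule →ₗ[ℂ] ℂ} (h : ∀ b, (R b).eval μ = ψ (Minuscule.v b))
    (b : PIdx) :
    (L.foldl (fun R k => rowStep (raise (r k)) k R) R b).eval μ =
      ψ ((act Minuscule (xProd a L) : Module.End ℂ Minuscule) (Minuscule.v b)) := by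
  induction L generalizing R ψ with
  | nil => simpa [xProd] using h b
  | cons k L ih =>
    rw [List.foldl_cons, ih (fun k hk => hL k (by simp [hk]))
      (ψ := ψ ∘ₗ (act Minuscule (x (r k) (a k)) : Module.End ℂ Minuscule))
      (fun b => ?_)]
    · rw [xProd, xProd, List.map_cons, List.prod_cons, map_mul]
      rfl
    · rw [eval_rowStep (hL k (by simp)) h, LinearMap.comp_apply, act_x_v]

theorem eval_foldr_rowStep {L : List ℕ} (hL : ∀ k ∈ L, μ (Poly.var k) = a k) (b : PIdx) :
    (L.foldr (fun k R => rowStep (lower (r k)) k R) (rowUnit .v0) b).eval μ =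
      plucker (L.reverse.map fun k => y (r k) (a k)).prod b := by
  induction L generalizing b with
  | nil =>
    rw [List.foldr_nil, eval_rowUnit]
    simp only [List.reverse_nil, List.map_nil, List.prod_nil, plucker, map_one]
    rfl
  | cons k L ih =>
    rw [List.foldr_cons, eval_rowStep (hL k (by simp))
      (ψ := minCoord .v0 ∘ₗ (act Minuscule (L.reverse.map fun k => y (r k) (a k)).prod :
        Module.End ℂ Minuscule)) (ih fun k hk => hL k (by simp [hk])), ← act_y_v,
      List.reverse_cons, List.map_append, List.prod_append, List.map_singleton,
      List.prod_singleton, plucker, map_mul]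
    rfl

theorem plucker_eq (h : ∀ k, 1 ≤ k → k ≤ 27 → μ (Poly.var k) = a k) (b : PIdx) :
    plucker (((List.range' 1 27).reverse).map fun k => y (r k) (a k)).prod b =
      (pluckerPoly b).eval μ :=
  (eval_foldr_rowStep (fun k hk => h k (by simp at hk; omega) (by simp at hk; omega)) b).symm

theorem eval_rowX (h : ∀ k, 1 ≤ k → k ≤ 27 → μ (Poly.var k) = a k) {s : ℕ} (hs : 1 ≤ s) (c b : PIdx) :
    (rowX s c b).eval μ =
      minCoord c ((act Minuscule (xProd a (List.range' s (28 - s))) : Module.End ℂ Minuscule)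
        (Minuscule.v b)) :=
  eval_foldl_rowStep (fun k hk => h k (by simp at hk; omega) (by simp at hk; omega))
    (fun b => eval_rowUnit b c) b

theorem eval_termPoly (h : ∀ k, 1 ≤ k → k ≤ 27 → μ (Poly.var k) = a k) {s : ℕ}
    (hs : 1 ≤ s) {ω : List (Fin 7)} (hω : coxeter.IsReduced ω)
    (cs l : List PIdx) :
    (termPoly ω (cs.map (rowX s)) l).eval μ =
      matrixCoeff (xProd a (List.range' s (28 - s)) * wbar (coxeter.wordProd ω)) cs l := by
  induction cs generalizing l with
  | nil => cases l <;> simp [termPoly, matrixCoeff]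
  | cons c cs ih =>
    cases l with
    | nil => simp [termPoly, matrixCoeff]
    | cons b l =>
      rw [List.map_cons, termPoly, matrixCoeff, Poly.eval_mul, ih, Poly.eval_scale, eval_rowX h hs,
        map_mul, Units.val_mul, Module.End.mul_apply, act_wbar hω, map_smul, map_smul, map_one,
        mul_one, smul_eq_mul]

end eval

/-! ### The minors as polynomials -/

/-- Leading factors whose label is not `i` do not change the coefficient of weight `ω_i`. Dropping
those before the first occurrence of `i` keeps the polynomials small. -/
theorem functional_act_xProd_mul {i : Fin 7} {L : List ℕ} (hL : ∀ k ∈ L, r k ≠ i) (a : ℕ → ℂ)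
    (g : Grp) :
    (fundModel i).coord (topCoord i) ((act (fundModel i).M (xProd a L * g) : Module.End ℂ (fundModel i).M)
        (formalVec (fundModel i) (topTensor i))) =
      (fundModel i).coord (topCoord i) ((act (fundModel i).M g : Module.End ℂ (fundModel i).M)
        (formalVec (fundModel i) (topTensor i))) := by
  induction L with
  | nil => rw [xProd, List.map_nil, List.prod_nil, one_mul]
  | cons k L ih =>
    rw [← ih fun k hk => hL k (by simp [hk]), xProd, List.map_cons, List.prod_cons, mul_assoc]
    exact functional_act_x_mul (isTop_topTensor i) _ (coord_topCoord_lie_chevH i)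
      (Pi.single_eq_of_ne (hL k (by simp)) _) (a k) _

theorem range_split (i : Fin 7) :
    1 ≤ firstPos i ∧ (∀ k ∈ List.range' 1 (firstPos i - 1), r k ≠ i) ∧
    List.range' 1 27 =
      List.range' 1 (firstPos i - 1) ++ List.range' (firstPos i) (28 - firstPos i) := by
  revert i
  decide +kernel

section minors
variable (V : ∀ i, FundamentalRep i) {μ : ℕ →* ℂ} {a : ℕ → ℂ}

theorem minor_eq (i : Fin 7) (w₁ w₂ : Weyl) (g : Grp) :
    minor (V i) w₁ w₂ g = (fundModel i).coord (topCoord i)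
      ((act (fundModel i).M ((wbar w₁)⁻¹ * g * wbar w₂) : Module.End ℂ (fundModel i).M)
        (formalVec (fundModel i) (topTensor i))) :=
  hwCoeff_act (V i) (isTop_topTensor i) _ (coord_topCoord_lie_chevH i) (coord_topTensor i) _

theorem phi_eq (h : ∀ k, 1 ≤ k → k ≤ 27 → μ (Poly.var k) = a k) (i : Fin 7) (k : ℕ) :
    phi V k i (((List.range' 1 27).reverse).map fun k => y (r k) (a k)).prod =
      (minorPoly i k).eval μ := by
  obtain ⟨hs, hL, hsplit⟩ := range_split i
  have hω : coxeter.IsReduced (w0Word.reverse.take (63 - (64 - k))) :=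
    (coxeter.isReduced_reverse_iff _ |>.2 isReduced_w0Word).take _
  -- The left representative disappears because `w₀² = 1`, and the right one belongs to `s_{r 1} ⋯
  -- s_{r (k-1)}`. The transposed product is then cut at the first occurrence of `i`.
  rw [phi, minorT, minor_eq, w0_mul_w0, wbar_one, inv_one, one_mul, uGe_mul_w0, transpose_yProd,
    hsplit, xProd, List.map_append, List.prod_append, ← xProd, mul_assoc,
    functional_act_xProd_mul hL, ← xProd, coord_act_formalVec _ _ (length_topCoord i)
    (length_topTensor i), minorPoly, Poly.eval_sum, List.map_map]
  congr 1
  refine List.map_congr_left fun t _ => ?_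
  rw [Function.comp_apply, Poly.eval_scale, eval_termPoly h hs hω, map_one, mul_one]

/-- The representative of `w₀` sends `v₂₇` to `v₀` and no other basis vector to a multiple of `v₀`.
Conjugation by it turns the coefficient at `v₂₇` into the diagonal entry at `v₀`. -/
theorem minorT_one_one (h : ∀ k, 1 ≤ k → k ≤ 27 → μ (Poly.var k) = a k) :
    minorT (V (node 7)) 1 1 (((List.range' 1 27).reverse).map fun k => y (r k) (a k)).prod =
      (rowX 1 .v0 .v0).eval μ := by
  have hw : ∀ b, wordIdx w0Word b = (.v0, 1) ∧ b = .v27 ∨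
      (wordIdx w0Word b).1 ≠ .v0 ∧ b ≠ .v27 := by decide +kernel
  have htop : topTensor (node 7) = [(1, [.v27])] := rfl
  have hcoord : topCoord (node 7) = [.v27] := rfl
  have hψ : minCoord .v0 ∘ₗ (act Minuscule (wbar w0) : Module.End ℂ Minuscule) =
      minCoord .v27 := by
    refine minuscule_ext fun b => ?_
    rw [LinearMap.comp_apply, w0, act_wbar isReduced_w0Word, map_smul, minCoord_v, minCoord_v]
    rcases hw b with ⟨h1, h2⟩ | ⟨h1, h2⟩
    · rw [h1, h2]
      simp
    · simp [h1, h2]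
  have hinv : ∀ m, minCoord .v27 ((act Minuscule (wbar w0)⁻¹ : Module.End ℂ Minuscule) m) =
      minCoord .v0 m := by
    intro m
    rw [← hψ, LinearMap.comp_apply, ← Module.End.mul_apply, ← Units.val_mul, ← map_mul,
      mul_inv_cancel, map_one]
    rfl
  have h0 : (act Minuscule (wbar w0) : Module.End ℂ Minuscule) (Minuscule.v .v27) =
      Minuscule.v .v0 := by
    have h1 : wordIdx w0Word .v27 = (.v0, 1) := by decide +kernel
    rw [w0, act_wbar isReduced_w0Word, h1, Int.cast_one, one_smul]
  rw [minorT, minor_eq, one_mul, transpose_yProd,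
    coord_act_formalVec _ _ (length_topCoord _) (length_topTensor _), htop, hcoord, eval_rowX h le_rfl]
  simp only [List.map_cons, List.map_nil, List.sum_cons, List.sum_nil, matrixCoeff, Int.cast_one, one_mul, mul_one,
    add_zero]
  rw [map_mul, map_mul, Units.val_mul, Units.val_mul, Module.End.mul_apply, Module.End.mul_apply,
    h0, hinv]

/-! ### The index sets -/

theorem frozenIndex_eq {i : Fin 7} {t : ℕ} (hi : i ≠ node 7) (ht : 27 < t ∧ t ≤ 63 ∧ r t = i)
    (h : ∀ s < t, 27 < s → r s ≠ i) : frozenIndex i = t := by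
  rw [frozenIndex, if_neg hi]
  refine IsLeast.csInf_eq ⟨ht, fun s hs => ?_⟩
  by_contra hlt
  exact h s (not_le.1 hlt) hs.1 hs.2.2

end minors

theorem frozenIndex_values :
    frozenIndex (node 1) = 28 ∧ frozenIndex (node 2) = 33 ∧ frozenIndex (node 3) = 29 ∧
      frozenIndex (node 4) = 30 ∧ frozenIndex (node 5) = 31 ∧ frozenIndex (node 6) = 32 ∧
      frozenIndex (node 7) = 70 := by
  refine ⟨?_, ?_, ?_, ?_, ?_, ?_, rfl⟩ <;>
    exact frozenIndex_eq (by decide) (by decide) (by decide)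

/-! ### The identities of the initial seed -/

set_option maxRecDepth 100000

/-- The element `y_{r 27}(a_27) ⋯ y_{r 1}(a_1)`. -/
abbrev yProd (a : ℕ → ℂ) : Grp := (((List.range' 1 27).reverse).map fun k => y (r k) (a k)).prod

section seed
variable (V : ∀ i, FundamentalRep i) {μ : ℕ →* ℂ} {a : ℕ → ℂ}

-- Once both sides are written as values of explicit polynomials under the same evaluation, equality
-- of the lists of terms is enough.
set_option maxHeartbeats 4000000 in
theorem phi_mutable (h : ∀ k, 1 ≤ k → k ≤ 27 → μ (Poly.var k) = a k) :
    phi V 7 (node 4) (yProd a) = plucker (yProd a) .v4 ∧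
      phi V 8 (node 5) (yProd a) = plucker (yProd a) .v3 ∧
      phi V 9 (node 6) (yProd a) = plucker (yProd a) .v2 ∧
      phi V 11 (node 3) (yProd a) = plucker (yProd a) .v5'' ∧
      phi V 12 (node 4) (yProd a) = q10'' (plucker (yProd a)) ∧
      phi V 13 (node 2) (yProd a) = plucker (yProd a) .v5' ∧
      phi V 14 (node 5) (yProd a) = q10' (plucker (yProd a)) ∧
      phi V 15 (node 7) (yProd a) = plucker (yProd a) .v1 ∧
      phi V 16 (node 4) (yProd a) = q18' (plucker (yProd a)) ∧
      phi V 17 (node 3) (yProd a) = q12 (plucker (yProd a)) ∧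
      phi V 18 (node 1) (yProd a) = plucker (yProd a) .v6'' ∧
      phi V 19 (node 6) (yProd a) = q10 (plucker (yProd a)) ∧
      phi V 20 (node 5) (yProd a) = q19' (plucker (yProd a)) ∧
      phi V 21 (node 4) (yProd a) = q28' (plucker (yProd a)) ∧
      phi V 22 (node 2) (yProd a) = q14 (plucker (yProd a)) ∧
      phi V 23 (node 3) (yProd a) = q23 (plucker (yProd a)) ∧
      phi V 24 (node 4) (yProd a) = q40 (plucker (yProd a)) ∧
      phi V 25 (node 5) (yProd a) = q30 (plucker (yProd a)) ∧
      phi V 26 (node 6) (yProd a) = q20 (plucker (yProd a)) ∧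
      phi V 27 (node 7) (yProd a) = plucker (yProd a) .v10 := by
  refine ⟨?_, ?_, ?_, ?_, ?_, ?_, ?_, ?_, ?_, ?_,
    ?_, ?_, ?_, ?_, ?_, ?_, ?_, ?_, ?_, ?_⟩ <;>
  · simp only [phi_eq V h, q10, q10', q10'', q12, q14, q18', q19', q20, q23,
      q27'', q28', q30, q40, plucker_eq h, ← Poly.eval_mul, ← Poly.eval_add, ← Poly.eval_sub,
      ← Poly.eval_neg]
    refine congrArg _ ?_
    decide +kernel

-- The index `70` uses the whole word of `w₀`, so that `v₂₇` is moved to the lowest weight vector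
-- before taking the top coefficient.
set_option maxHeartbeats 4000000 in
theorem phi_frozen (h : ∀ k, 1 ≤ k → k ≤ 27 → μ (Poly.var k) = a k) :
    phi V 28 (node 1) (yProd a) = q18 (plucker (yProd a)) ∧
      phi V 29 (node 3) (yProd a) = q36' (plucker (yProd a)) ∧
      phi V 30 (node 4) (yProd a) = q54 (plucker (yProd a)) ∧
      phi V 31 (node 5) (yProd a) = q45 (plucker (yProd a)) ∧
      phi V 32 (node 6) (yProd a) = q36 (plucker (yProd a)) ∧
      phi V 33 (node 2) (yProd a) = q27 (plucker (yProd a)) ∧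
      phi V 70 (node 7) (yProd a) = plucker (yProd a) .v27 ∧
      minorT (V (node 7)) 1 1 (yProd a) = plucker (yProd a) .v0 := by
  refine ⟨?_, ?_, ?_, ?_, ?_, ?_, ?_, ?_⟩ <;>
  · simp only [phi_eq V h, minorT_one_one V h, q18, q27, q27', q27'', q36, q36', q45, q54, plucker_eq h, ← Poly.eval_mul,
      ← Poly.eval_add, ← Poly.eval_sub, ← Poly.eval_neg]
    refine congrArg _ ?_
    decide +kernel

/-! ### Exchangeable indices -/

/-- The Plücker coordinates of `yProd 1`. -/
def pluckerAtOne : PIdx → ℤ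
  | .v0 | .v17 | .v21'' | .v22' | .v22'' | .v23 | .v24 | .v25 | .v26 | .v27 => 1
  | .v18 | .v19' | .v20' | .v21' => 2
  | .v1 | .v20'' => 3
  | .v16 | .v18'' | .v19'' => 5
  | .v2 => 6
  | .v18' => 7
  | .v17' => 9
  | .v3 | .v6'' | .v15'' | .v16'' | .v17'' => 12
  | .v15 => 13
  | .v12'' => 14
  | .v5' | .v16' => 21
  | .v14 => 23
  | .v4 | .v7'' => 24
  | .v5'' => 27
  | .v13'' => 28
  | .v9'' => 29
  | .v14' | .v15' => 33
  | .v13' => 34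
  | .v6' | .v11'' => 42
  | .v14'' => 45
  | .v8'' => 48
  | .v10'' => 58
  | .v7' => 60
  | .v9' => 67
  | .v12' => 70
  | .v8' => 72
  | .v11' => 74
  | .v10' => 76
  | .v9 => 77
  | .v10 | .v11 | .v12 | .v13 => 78

/-- The constant map `μ = 1` sets every `a_k` to `1`, so a polynomial takes the sum of its
coefficients as value. -/
theorem plucker_yProd_one (b : PIdx) : plucker (yProd 1) b = pluckerAtOne b := by
  have h : ∀ b, ((pluckerPoly b).map (·.2)).sum = pluckerAtOne b := by decide +kernel
  have key : ∀ p : Poly, p.eval 1 = ((p.map (·.2)).sum : ℤ) := by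
    intro p
    induction p with
    | nil => simp
    | cons t p ih => rw [Poly.eval_cons, ih]; simp
  rw [plucker_eq (μ := 1) (a := 1) (fun _ _ _ => rfl), key, h]

/-- The exchangeable indices. -/
def exchangeableIndices : List ℕ :=
  [7, 8, 9, 11, 12, 13, 14, 15, 16, 17, 18, 19, 20, 21, 22, 23, 24, 25, 26, 27]

/-- The witness is the torus point with all parameters `1`. There the identities of the seed reduce
each minor to arithmetic with the tabulated Plücker coordinates. -/
theorem exchangeable_of_mem {k : ℕ} (hk : k ∈ exchangeableIndices) : Exchangeable V k := by
  have key : ∀ {k : ℕ} {i : Fin 7}, r k = i → phi V k i (yProd 1) ≠ 1 → Exchangeable V k := by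
    rintro k _ rfl h
    exact ⟨_, ⟨1, fun _ => one_ne_zero, rfl⟩, h⟩
  have hp := plucker_yProd_one
  obtain ⟨e7, e8, e9, e11, e12, e13, e14, e15, e16, e17, e18, e19, e20, e21, e22, e23, e24, e25, e26, e27⟩ := phi_mutable V (μ := 1) (a := 1) fun _ _ _ => rfl
  simp only [exchangeableIndices, List.mem_cons, List.not_mem_nil, or_false] at hk
  rcases hk with rfl | rfl | rfl | rfl | rfl | rfl | rfl | rfl | rfl | rfl | rfl | rfl | rfl | rfl | rfl | rfl | rfl | rfl | rfl | rfl
  · exact key (by decide) (i := node 4) (by rw [e7]; norm_num [hp, pluckerAtOne])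
  · exact key (by decide) (i := node 5) (by rw [e8]; norm_num [hp, pluckerAtOne])
  · exact key (by decide) (i := node 6) (by rw [e9]; norm_num [hp, pluckerAtOne])
  · exact key (by decide) (i := node 3) (by rw [e11]; norm_num [hp, pluckerAtOne])
  · exact key (by decide) (i := node 4) (by rw [e12]; norm_num [hp, pluckerAtOne, q10''])
  · exact key (by decide) (i := node 2) (by rw [e13]; norm_num [hp, pluckerAtOne])
  · exact key (by decide) (i := node 5) (by rw [e14]; norm_num [hp, pluckerAtOne, q10'])
  · exact key (by decide) (i := node 7) (by rw [e15]; norm_num [hp, pluckerAtOne])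
  · exact key (by decide) (i := node 4) (by rw [e16]; norm_num [hp, pluckerAtOne, q18'])
  · exact key (by decide) (i := node 3) (by rw [e17]; norm_num [hp, pluckerAtOne, q12])
  · exact key (by decide) (i := node 1) (by rw [e18]; norm_num [hp, pluckerAtOne])
  · exact key (by decide) (i := node 6) (by rw [e19]; norm_num [hp, pluckerAtOne, q10])
  · exact key (by decide) (i := node 5) (by rw [e20]; norm_num [hp, pluckerAtOne, q19'])
  · exact key (by decide) (i := node 4) (by rw [e21]; norm_num [hp, pluckerAtOne, q28'])
  · exact key (by decide) (i := node 2) (by rw [e22]; norm_num [hp, pluckerAtOne, q14])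
  · exact key (by decide) (i := node 3) (by rw [e23]; norm_num [hp, pluckerAtOne, q23])
  · exact key (by decide) (i := node 4) (by rw [e24]; norm_num [hp, pluckerAtOne, q40, q27''])
  · exact key (by decide) (i := node 5) (by rw [e25]; norm_num [hp, pluckerAtOne, q30, q27''])
  · exact key (by decide) (i := node 6) (by rw [e26]; norm_num [hp, pluckerAtOne, q20])
  · exact key (by decide) (i := node 7) (by rw [e27]; norm_num [hp, pluckerAtOne])

/-- These are the first occurrences of the seven labels. None of the letters before position `k`
equals `r k`, so their representatives fix `v⁺` and the minor is the coefficient of `v⁺` in a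
unipotent element applied to `v⁺`. The computation confirms that the polynomial is `1`. -/
theorem not_exchangeable {k : ℕ} (hk : k ∈ [1, 2, 3, 4, 5, 6, 10]) : ¬ Exchangeable V k := by
  have h : ∀ k ∈ [1, 2, 3, 4, 5, 6, 10], minorPoly (r k) k = [(1, 1)] := by decide +kernel
  rintro ⟨_, ⟨a, -, rfl⟩, hu⟩
  obtain ⟨μ, hμ⟩ := Poly.exists_eval_var a
  rw [phi_eq V hμ, h k hk] at hu
  simp at hu

theorem mem_mutableIndices (ki : ℕ × Fin 7) :
    ki ∈ mutableIndices V ↔ ki ∈ exchangeableIndices.map fun k => (k, r k) := by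
  have hb : ∀ k ∈ exchangeableIndices, 1 ≤ k ∧ k ≤ 27 := by decide
  have hk : ∀ k < 28, 1 ≤ k → k ∈ exchangeableIndices ∨ k ∈ [1, 2, 3, 4, 5, 6, 10] := by
    decide +kernel
  obtain ⟨k, i⟩ := ki
  rw [List.mem_map]
  constructor
  · rintro ⟨⟨h1, h2⟩, he, hi⟩
    exact ⟨k, (hk k (Nat.lt_succ_of_le h2) h1).resolve_right fun h => not_exchangeable V h he,
      Prod.ext rfl hi.symm⟩
  · rintro ⟨k, hk, h⟩
    obtain ⟨rfl, rfl⟩ := Prod.mk.inj h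
    exact ⟨hb k hk, exchangeable_of_mem V hk, rfl⟩

end seed

end Freudenthal
end


open Freudenthal in
theorem lemma4p2 (V : ∀ i : Fin 7, FundamentalRep i) :
    mutableIndices V =
      {(7, node 4), (8, node 5), (9, node 6), (11, node 3), (12, node 4),
        (13, node 2), (14, node 5), (15, node 7), (16, node 4), (17, node 3),
        (18, node 1), (19, node 6), (20, node 5), (21, node 4), (22, node 2),
        (23, node 3), (24, node 4), (25, node 5), (26, node 6), (27, node 7)} ∧
    (frozenIndex (node 1) = 28 ∧ frozenIndex (node 2) = 33 ∧ frozenIndex (node 3) = 29 ∧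
      frozenIndex (node 4) = 30 ∧ frozenIndex (node 5) = 31 ∧ frozenIndex (node 6) = 32 ∧
      frozenIndex (node 7) = 70) ∧
    ∀ u ∈ uMinusCirc,
      (phi V 7 (node 4) u = plucker u .v4 ∧
        phi V 8 (node 5) u = plucker u .v3 ∧
        phi V 9 (node 6) u = plucker u .v2 ∧
        phi V 11 (node 3) u = plucker u .v5'' ∧
        phi V 12 (node 4) u = q10'' (plucker u) ∧
        phi V 13 (node 2) u = plucker u .v5' ∧
        phi V 14 (node 5) u = q10' (plucker u) ∧
        phi V 15 (node 7) u = plucker u .v1 ∧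
        phi V 16 (node 4) u = q18' (plucker u) ∧
        phi V 17 (node 3) u = q12 (plucker u) ∧
        phi V 18 (node 1) u = plucker u .v6'' ∧
        phi V 19 (node 6) u = q10 (plucker u) ∧
        phi V 20 (node 5) u = q19' (plucker u) ∧
        phi V 21 (node 4) u = q28' (plucker u) ∧
        phi V 22 (node 2) u = q14 (plucker u) ∧
        phi V 23 (node 3) u = q23 (plucker u) ∧
        phi V 24 (node 4) u = q40 (plucker u) ∧
        phi V 25 (node 5) u = q30 (plucker u) ∧
        phi V 26 (node 6) u = q20 (plucker u) ∧
        phi V 27 (node 7) u = plucker u .v10) ∧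
      (phi V (frozenIndex (node 1)) (node 1) u = q18 (plucker u) ∧
        phi V (frozenIndex (node 3)) (node 3) u = q36' (plucker u) ∧
        phi V (frozenIndex (node 4)) (node 4) u = q54 (plucker u) ∧
        phi V (frozenIndex (node 5)) (node 5) u = q45 (plucker u) ∧
        phi V (frozenIndex (node 6)) (node 6) u = q36 (plucker u) ∧
        phi V (frozenIndex (node 2)) (node 2) u = q27 (plucker u) ∧
        phi V (frozenIndex (node 7)) (node 7) u = plucker u .v27 ∧
        minorT (V (node 7)) 1 1 u = plucker u .v0) := by
  refine ⟨?_, frozenIndex_values, ?_⟩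
  · have h : exchangeableIndices.map (fun k => (k, r k)) = [(7, node 4), (8, node 5), (9, node 6),
        (11, node 3), (12, node 4), (13, node 2), (14, node 5), (15, node 7), (16, node 4),
        (17, node 3), (18, node 1), (19, node 6), (20, node 5), (21, node 4), (22, node 2),
        (23, node 3), (24, node 4), (25, node 5), (26, node 6), (27, node 7)] := by decide +kernel
    ext ki
    rw [mem_mutableIndices, h]
    simp only [List.mem_cons, List.not_mem_nil, or_false, Set.mem_insert_iff,
      Set.mem_singleton_iff]
  · rintro _ ⟨a, -, rfl⟩
    obtain ⟨μ, hμ⟩ := Poly.exists_eval_var a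
    obtain ⟨h1, h2, h3, h4, h5, h6, h7⟩ := frozenIndex_values
    rw [h1, h2, h3, h4, h5, h6, h7]
    exact ⟨phi_mutable V hμ, phi_frozen V hμ⟩
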